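/- Let $G$ be an affine group scheme of finite type over $\mathbb C$, let $\rho: H\hookrightarrow G$ be a closed subgroup scheme (neither needs to be reductive), and let $X$ be a scheme over $\mathbb C$ with an action of $H$. Let $G\times H$ act on $G\times X$ by $(g,h)\cdot(g',x)=(gg'\rho(h)^{-1},hx)$. Assume that the quotient $\tilde X=G\times^H X=(G\times X)/H$ exists as a scheme: $\tilde X$ is a $\mathbb C$-scheme with an action of $G$, and $\pi: G\times X\to\tilde X$ is a $G$-equivariant principal $H$-bundle (a flat, surjective, locally finitely presented, $H$-invariant morphism such that any two $T$-points of $G\times X$ with the same image differ by a unique element of $H(T)$, for every $\mathbb C$-scheme $T$). For a group scheme $K$ acting on a scheme $Y$ over $\mathbb C$, let $\mathrm{QCoh}^K(Y)$ be the symmetric monoidal $\mathbb C$-linear category of $K$-equivariant quasi-coherent sheaves on $Y$. Let $A=\mathrm{pr}^*:\mathrm{QCoh}^H(X)\to\mathrm{QCoh}^{G\times H}(G\times X)$ and $B=\pi^*:\mathrm{QCoh}^G(\tilde X)\to\mathrm{QCoh}^{G\times H}(G\times X)$ be the pullback functors, which are symmetric monoidal, where $\mathrm{pr}:G\times X\to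 X$ is the projection. For a morphism $f:V\to W$ in $\mathrm{QCoh}^K(Y)$ (for instance of $K$-equivariant vector bundles), regarded as a complex $\mathcal X$ with $V$ in degree $-1$ and $W$ in degree $0$, let $\mathcal{S}ym(\mathcal X)$ be the dg-algebra in $\mathrm{QCoh}^K(Y)$ with $\mathcal{S}ym(\mathcal X)^{-k}=\Lambda^kV\otimes\mathrm{Sym}(W)$ for $k\ge 0$, zero in positive degrees, with the usual product, and with differential $$d(v_1\wedge\dots\wedge v_n\otimes w)=\sum_{i=1}^n(-1)^i\,v_1\wedge\dots\widehat{v_i}\dots\wedge v_n\otimes f(v_i)w.$$ For a dg-algebra $\mathcal A$ in $\mathrm{QCoh}^K(Y)$, let $\mathcal C\,\mathrm{QCoh}^K(\mathcal A)$ be the dg-category over $\mathbb C$ of (unbounded) left dg-modules over $\mathcal A$ in $\mathrm{QCoh}^K(Y)$: the degree $i$ part of the complex of morphisms from $M$ to $N$ consists of the homogeneous maps $\varphi$ of degree $i$ with $\varphi(am)=(-1)^{i|a|}a\varphi(m)$, with differential $\varphi\mapsto d\circ\varphi-(-1)^{i}\varphi\circ d$. Then: 1. $A$ and $B$ are equivalences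 of categories. 2. There is a symmetric monoidal $\mathbb C$-linear equivalence $\mathrm{Ind}:\mathrm{QCoh}^H(X)\to\mathrm{QCoh}^G(\tilde X)$ with a monoidal isomorphism $B\circ\mathrm{Ind}\cong A$ such that, for every morphism $f:V\to W$ in $\mathrm{QCoh}^H(X)$, with $\mathcal X=(V\xrightarrow{f}W)$ and $\tilde{\mathcal X}=(\mathrm{Ind}\,V\xrightarrow{\mathrm{Ind}f}\mathrm{Ind}\,W)$, there is an isomorphism of dg-algebras $\theta:\mathrm{Ind}(\mathcal{S}ym_{\mathcal O_X}(\mathcal X))\cong\mathcal{S}ym_{\mathcal O_{\tilde X}}(\tilde{\mathcal X})$ that is the identity on the generators $\mathrm{Ind}\,V$ and $\mathrm{Ind}\,W$, and the dg-functor which sends a dg-module $M$ to $\mathrm{Ind}(M)$, regarded as a dg-module over $\mathcal{S}ym(\tilde{\mathcal X})$ through $\theta^{-1}$, is an equivalence of dg-categories $$\mathcal C\,\mathrm{QCoh}^H(\mathcal{S}ym_{\mathcal O_X}(\mathcal X))\;\simeq\;\mathcal C\,\mathrm{QCoh}^G(\mathcal{S}ym_{\mathcal O_{\tilde X}}(\tilde{\mathcal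 X}))$$ (it is bijective on the complexes of morphisms, and every dg-module over the target is isomorphic, by closed mutually inverse morphisms of degree $0$, to one in the image). -/

import Mathlib

section

open CategoryTheory MonoidalCategory CochainComplex CochainComplex.HomComplex

universe w v u

/-- A differential graded category over a commutative ring `k`. -/
class DGCategory (k : Type w) [CommRing k] (𝒞 : Type u) where
  Hom : 𝒞 → 𝒞 → ℤ → Type v
  [addCommGroup (X Y : 𝒞) (n : ℤ) : AddCommGroup (Hom X Y n)]
  [module (X Y : 𝒞) (n : ℤ) : Module k (Hom X Y n)]
  d {X Y : 𝒞} (n m : ℤ) (h : n + 1 = m) : Hom X Y n →ₗ[k] Hom X Y m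
  id (X : 𝒞) : Hom X X 0
  comp {X Y Z : 𝒞} (p q r : ℤ) (h : p + q = r) : Hom X Y p →ₗ[k] Hom Y Z q →ₗ[k] Hom X Z r
  d_d {X Y : 𝒞} (n m l : ℤ) (h : n + 1 = m) (h' : m + 1 = l) (f : Hom X Y n) :
    d m l h' (d n m h f) = 0
  id_comp {X Y : 𝒞} (n : ℤ) (f : Hom X Y n) : comp 0 n n (zero_add n) (id X) f = f
  comp_id {X Y : 𝒞} (n : ℤ) (f : Hom X Y n) : comp n 0 n (add_zero n) f (id Y) = f
  assoc {X Y Z W : 𝒞} (p q r pq qr pqr : ℤ) (hpq : p + q = pq) (hqr : q + r = qr)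
    (h : pq + r = pqr) (h' : p + qr = pqr) (f : Hom X Y p) (g : Hom Y Z q) (e : Hom Z W r) :
    comp pq r pqr h (comp p q pq hpq f g) e = comp p qr pqr h' f (comp q r qr hqr g e)
  /-- The Leibniz rule, for composition written in diagrammatic order: with `g ∘ f` the composite
  of `f` of degree `p` and `g` of degree `q`, it reads `d (g ∘ f) = d g ∘ f + (-1) ^ q g ∘ d f`. -/
  leibniz {X Y Z : 𝒞} (p q r p' q' r' : ℤ) (h : p + q = r) (hp : p + 1 = p') (hq : q + 1 = q')
    (hr : r + 1 = r') (f : Hom X Y p) (g : Hom Y Z q) :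
    d r r' hr (comp p q r h f g) =
      comp p q' r' (by omega) f (d q q' hq g) +
        q.negOnePow • comp p' q r' (by omega) (d p p' hp f) g

attribute [reducible, instance] DGCategory.addCommGroup DGCategory.module

/-- A dg-functor: a functor that is linear and compatible with degrees and differentials on the
complexes of morphisms. -/
structure DGFunctor (k : Type w) [CommRing k] (𝒞 𝒟 : Type*) [DGCategory k 𝒞]
    [DGCategory k 𝒟] where
  obj : 𝒞 → 𝒟
  map {X Y : 𝒞} (n : ℤ) :
    DGCategory.Hom k X Y n →ₗ[k] DGCategory.Hom k (obj X) (obj Y) n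
  map_d {X Y : 𝒞} (n m : ℤ) (h : n + 1 = m) (f : DGCategory.Hom k X Y n) :
    map m (DGCategory.d n m h f) = DGCategory.d n m h (map n f)
  map_id (X : 𝒞) : map 0 (DGCategory.id (k := k) X) = DGCategory.id (obj X)
  map_comp {X Y Z : 𝒞} (p q r : ℤ) (h : p + q = r) (f : DGCategory.Hom k X Y p)
    (g : DGCategory.Hom k Y Z q) :
    map r (DGCategory.comp p q r h f g) = DGCategory.comp p q r h (map p f) (map q g)

namespace DGFunctor

variable {k : Type w} [CommRing k] {𝒞 𝒟 ℰ : Type*} [DGCategory k 𝒞] [DGCategory k 𝒟]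
  [DGCategory k ℰ]

/-- Composition of dg-functors. -/
def comp (F : DGFunctor k 𝒞 𝒟) (G : DGFunctor k 𝒟 ℰ) : DGFunctor k 𝒞 ℰ where
  obj X := G.obj (F.obj X)
  map n := G.map n ∘ₗ F.map n
  map_d n m h f := by simp [F.map_d, G.map_d]
  map_id X := by simp [F.map_id, G.map_id]
  map_comp p q r h f g := by simp [F.map_comp, G.map_comp]

/-- A dg-functor is an equivalence of dg-categories if it induces isomorphisms on the complexes
of morphisms, and if every object of the target is isomorphic to an object in the image by closed
mutually inverse morphisms of degree zero. -/
def IsDGEquivalence (F : DGFunctor k 𝒞 𝒟) : Prop :=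
  (∀ (X Y : 𝒞) (n : ℤ), Function.Bijective (F.map (X := X) (Y := Y) n)) ∧
  ∀ Z : 𝒟, ∃ (X : 𝒞) (u : DGCategory.Hom k (F.obj X) Z 0) (v : DGCategory.Hom k Z (F.obj X) 0),
    DGCategory.d 0 1 (zero_add 1) u = 0 ∧ DGCategory.d 0 1 (zero_add 1) v = 0 ∧
    DGCategory.comp 0 0 0 (zero_add 0) u v = DGCategory.id (F.obj X) ∧
    DGCategory.comp 0 0 0 (zero_add 0) v u = DGCategory.id Z

end DGFunctor

section

variable {C : Type u} [Category.{v} C] [MonoidalCategory C] {D : Type*} [Category* D]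
  [MonoidalCategory D] (F : C ⥤ D) [F.LaxMonoidal]

open Functor.LaxMonoidal

lemma restrict_aux {P P' Q Q' X Y Z : C} (f : P ⟶ P') (g : Q ⟶ Q') (a : Q' ⊗ X ⟶ Y)
    (b : P' ⊗ Y ⟶ Z) :
    (f ⊗ₘ g) ▷ X ≫ (α_ P' Q' X).hom ≫ P' ◁ a ≫ b =
      (α_ P Q X).hom ≫ P ◁ (g ▷ X ≫ a) ≫ f ▷ Y ≫ b := by
  rw [MonoidalCategory.whiskerLeft_comp_assoc, whisker_exchange_assoc, whisker_exchange_assoc,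
    ← associator_naturality_left_assoc, ← associator_naturality_middle_assoc,
    MonoidalCategory.tensorHom_def, comp_whiskerRight_assoc]

lemma lax_left_unit {X A : C} (o : 𝟙_ C ⟶ A) (m : A ⊗ X ⟶ X) (h : o ▷ X ≫ m = (λ_ X).hom) :
    (ε F ≫ F.map o) ▷ F.obj X ≫ μ F A X ≫ F.map m = (λ_ (F.obj X)).hom := by
  rw [comp_whiskerRight_assoc, μ_natural_left_assoc, ← F.map_comp, h, left_unitality]

lemma lax_right_unit {X A : C} (o : 𝟙_ C ⟶ A) (m : X ⊗ A ⟶ X) (h : X ◁ o ≫ m = (ρ_ X).hom) :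
    F.obj X ◁ (ε F ≫ F.map o) ≫ μ F X A ≫ F.map m = (ρ_ (F.obj X)).hom := by
  rw [MonoidalCategory.whiskerLeft_comp_assoc, μ_natural_right_assoc, ← F.map_comp, h,
    right_unitality]

lemma lax_assoc {X Y Z XY YZ T : C} (m : X ⊗ Y ⟶ XY) (m' : XY ⊗ Z ⟶ T) (n : Y ⊗ Z ⟶ YZ)
    (n' : X ⊗ YZ ⟶ T) (h : m ▷ Z ≫ m' = (α_ X Y Z).hom ≫ X ◁ n ≫ n') :
    (μ F X Y ≫ F.map m) ▷ F.obj Z ≫ μ F XY Z ≫ F.map m' =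
      (α_ (F.obj X) (F.obj Y) (F.obj Z)).hom ≫ F.obj X ◁ (μ F Y Z ≫ F.map n) ≫
        μ F X YZ ≫ F.map n' := by
  rw [comp_whiskerRight_assoc, MonoidalCategory.whiskerLeft_comp_assoc, μ_natural_left_assoc,
    μ_natural_right_assoc, ← F.map_comp, ← F.map_comp, h, F.map_comp, associativity_assoc]

end

/-- A dg-algebra in a preadditive monoidal category `C`: a cochain complex `A` of objects of `C`
with a unital and associative multiplication `A ⊗ A ⟶ A`, given by its components
`A^p ⊗ A^q ⟶ A^(p + q)`, for which the differential satisfies the graded Leibniz rule. -/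
structure DGAlgebra (C : Type u) [Category.{v} C] [Preadditive C] [MonoidalCategory C] where
  cx : CochainComplex C ℤ
  one : 𝟙_ C ⟶ cx.X 0
  mul (p q r : ℤ) (h : p + q = r) : cx.X p ⊗ cx.X q ⟶ cx.X r
  one_mul (p : ℤ) : one ▷ cx.X p ≫ mul 0 p p (zero_add p) = (λ_ (cx.X p)).hom
  mul_one (p : ℤ) : cx.X p ◁ one ≫ mul p 0 p (add_zero p) = (ρ_ (cx.X p)).hom
  mul_assoc (p q r pq qr pqr : ℤ) (hpq : p + q = pq) (hqr : q + r = qr) (h : pq + r = pqr)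
    (h' : p + qr = pqr) :
    mul p q pq hpq ▷ cx.X r ≫ mul pq r pqr h =
      (α_ (cx.X p) (cx.X q) (cx.X r)).hom ≫ cx.X p ◁ mul q r qr hqr ≫ mul p qr pqr h'
  leibniz (p q r p' q' r' : ℤ) (h : p + q = r) (hp : p + 1 = p') (hq : q + 1 = q')
    (hr : r + 1 = r') :
    mul p q r h ≫ cx.d r r' =
      cx.d p p' ▷ cx.X q ≫ mul p' q r' (by omega) +
        p.negOnePow • (cx.X p ◁ cx.d q q' ≫ mul p q' r' (by omega))

section

variable {C : Type u} [Category.{v} C] [Preadditive C] [MonoidalCategory C]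

/-- A morphism of dg-algebras. -/
@[ext]
structure DGAlgebra.Hom (A B : DGAlgebra C) where
  hom : A.cx ⟶ B.cx
  one_hom : A.one ≫ hom.f 0 = B.one
  mul_hom (p q r : ℤ) (h : p + q = r) :
    A.mul p q r h ≫ hom.f r = (hom.f p ⊗ₘ hom.f q) ≫ B.mul p q r h

instance : Category (DGAlgebra C) where
  Hom := DGAlgebra.Hom
  id A := ⟨𝟙 _, by simp, by simp⟩
  comp f g := ⟨f.hom ≫ g.hom, by simp [reassoc_of% f.one_hom, g.one_hom],
    fun p q r h => by simp [reassoc_of% f.mul_hom, g.mul_hom]⟩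
  id_comp _ := by apply DGAlgebra.Hom.ext; simp
  comp_id _ := by apply DGAlgebra.Hom.ext; simp
  assoc _ _ _ := by apply DGAlgebra.Hom.ext; simp

/-- A left dg-module over a dg-algebra `A` in `C`. -/
structure DGModule (A : DGAlgebra C) where
  cx : CochainComplex C ℤ
  act (p i j : ℤ) (h : p + i = j) : A.cx.X p ⊗ cx.X i ⟶ cx.X j
  one_act (i : ℤ) : A.one ▷ cx.X i ≫ act 0 i i (zero_add i) = (λ_ (cx.X i)).hom
  mul_act (p q i pq qi pqi : ℤ) (hpq : p + q = pq) (hqi : q + i = qi) (h : pq + i = pqi)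
    (h' : p + qi = pqi) :
    A.mul p q pq hpq ▷ cx.X i ≫ act pq i pqi h =
      (α_ (A.cx.X p) (A.cx.X q) (cx.X i)).hom ≫ A.cx.X p ◁ act q i qi hqi ≫ act p qi pqi h'
  leibniz (p i j p' i' j' : ℤ) (h : p + i = j) (hp : p + 1 = p') (hi : i + 1 = i')
    (hj : j + 1 = j') :
    act p i j h ≫ cx.d j j' =
      A.cx.d p p' ▷ cx.X i ≫ act p' i j' (by omega) +
        p.negOnePow • (A.cx.X p ◁ cx.d i i' ≫ act p i' j' (by omega))

namespace DGModule

variable (k : Type w) [CommRing k] [Linear k C] [MonoidalPreadditive C] [MonoidalLinear k C]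
  {A : DGAlgebra C}

/-- The homomorphisms of degree `n` of graded left `A`-modules `M → N`, which need not commute
with the differentials: `φ (a m) = (-1) ^ (n |a|) a φ (m)`. -/
def linearCochains (M N : DGModule A) (n : ℤ) : Submodule k (Cochain M.cx N.cx n) where
  carrier := {φ | ∀ (p i j i' j' : ℤ) (h : p + i = j) (hi : i + n = i') (hj : j + n = j'),
    M.act p i j h ≫ φ.v j j' hj =
      (n * p).negOnePow • (A.cx.X p ◁ φ.v i i' hi ≫ N.act p i' j' (by omega))}
  add_mem' {φ ψ} hφ hψ p i j i' j' h hi hj := by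
    simp [hφ p i j i' j' h hi hj, hψ p i j i' j' h hi hj, MonoidalPreadditive.whiskerLeft_add]
  zero_mem' p i j i' j' h hi hj := by simp
  smul_mem' c φ hφ p i j i' j' h hi hj := by
    simp [hφ p i j i' j' h hi hj, smul_comm c]

variable {k}

lemma δ_mem {M N : DGModule A} {n m : ℤ} (h : n + 1 = m) {φ : Cochain M.cx N.cx n}
    (hφ : φ ∈ linearCochains k M N n) : δ n m φ ∈ linearCochains k M N m := by
  intro p i j i' j' hj hi' hj'
  obtain rfl : m = n + 1 := h.symm
  have h1 := hφ p i j (i + n) (j + n) hj rfl rfl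
  have h2 := hφ p (i + 1) (j + 1) i' j' (by omega) (by omega) (by omega)
  have h3 := hφ (p + 1) i (j + 1) (i + n) j' (by omega) rfl (by omega)
  have h4 := N.leibniz p (i + n) (j + n) (p + 1) i' j' (by omega) rfl (by omega) (by omega)
  have h5 := M.leibniz p i j (p + 1) (i + 1) (j + 1) (by omega) rfl rfl rfl
  rw [δ_v n (n + 1) rfl φ j j' hj' (j + n) (j + 1) (by omega) rfl,
    δ_v n (n + 1) rfl φ i i' hi' (i + n) (i + 1) (by omega) rfl]
  rw [Preadditive.comp_add, reassoc_of% h1, Linear.comp_units_smul, reassoc_of% h5]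
  simp only [Preadditive.add_comp, Linear.units_smul_comp, Category.assoc, h2, h3, h4,
    Preadditive.comp_add, Linear.comp_units_smul, MonoidalPreadditive.whiskerLeft_add, smul_add,
    MonoidalCategory.whiskerLeft_comp, smul_smul]
  have e1 : A.cx.X p ◁ ((n + 1).negOnePow • (M.cx.d i (i + 1) ≫ φ.v (i + 1) i' (by omega))) =
      (n + 1).negOnePow • (A.cx.X p ◁ M.cx.d i (i + 1) ≫ A.cx.X p ◁ φ.v (i + 1) i' (by omega)) := by
    rw [Units.smul_def, ← Int.cast_smul_eq_zsmul k, MonoidalLinear.whiskerLeft_smul,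
      Int.cast_smul_eq_zsmul, MonoidalCategory.whiskerLeft_comp]; rfl
  rw [e1]
  simp only [Linear.units_smul_comp, Category.assoc, smul_smul]
  have e2 : A.cx.X p ◁ φ.v i (i + n) rfl ≫ A.cx.d p (p + 1) ▷ N.cx.X (i + n) ≫
        N.act (p + 1) (i + n) j' (by omega) =
      A.cx.d p (p + 1) ▷ M.cx.X i ≫ A.cx.X (p + 1) ◁ φ.v i (i + n) rfl ≫
        N.act (p + 1) (i + n) j' (by omega) := by
    rw [whisker_exchange_assoc]
  rw [e2]
  have s1 : (n * p).negOnePow * p.negOnePow = ((n + 1) * p).negOnePow := by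
    rw [← Int.negOnePow_add]; ring_nf
  have s2 : (n + 1).negOnePow * (n * (p + 1)).negOnePow = - (n * p).negOnePow := by
    rw [← Int.negOnePow_add, show n + 1 + n * (p + 1) = n * p + 1 + (n + n) by ring,
      Int.negOnePow_add, Int.negOnePow_add (n + n |> fun _ => n * p) 1, Int.negOnePow_add n n]
    simp [Int.units_mul_self]
  have s3 : (n + 1).negOnePow * (p.negOnePow * (n * p).negOnePow) =
      ((n + 1) * p).negOnePow * (n + 1).negOnePow := by
    rw [← s1]; ac_rfl
  rw [s1, s2, s3]
  simp only [Units.neg_smul]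
  abel

lemma comp_mem {M N P : DGModule A} {n m l : ℤ} (h : n + m = l) {φ : Cochain M.cx N.cx n}
    {ψ : Cochain N.cx P.cx m} (hφ : φ ∈ linearCochains k M N n)
    (hψ : ψ ∈ linearCochains k N P m) : φ.comp ψ h ∈ linearCochains k M P l := by
  intro p i j i' j' hj hi' hj'
  rw [Cochain.comp_v φ ψ h j (j + n) j' rfl (by omega),
    Cochain.comp_v φ ψ h i (i + n) i' rfl (by omega),
    reassoc_of% (hφ p i j (i + n) (j + n) hj rfl rfl), Linear.units_smul_comp, Category.assoc,
    hψ p (i + n) (j + n) i' j' (by omega) (by omega) (by omega), Linear.comp_units_smul, smul_smul,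
    MonoidalCategory.whiskerLeft_comp, Category.assoc, ← Int.negOnePow_add, ← add_mul, h]

variable (k) in
lemma id_mem (M : DGModule A) : Cochain.ofHom (𝟙 M.cx) ∈ linearCochains k M M 0 := by
  intro p i j i' j' hj hi hj'
  obtain rfl : i = i' := by omega
  obtain rfl : j = j' := by omega
  simp

/-- The dg-category of left dg-modules over the dg-algebra `A`: the complex of morphisms consists
of the `A`-linear homogeneous maps, with differential `φ ↦ d ∘ φ - (-1) ^ |φ| φ ∘ d`. -/
instance dgCategory : DGCategory k (DGModule A) where
  Hom M N n := linearCochains k M N n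
  d {M N} n m h := (δ_hom k M.cx N.cx n m).restrict fun _ hφ => δ_mem h hφ
  id M := ⟨_, id_mem k M⟩
  comp {M N P} p q r h := LinearMap.mk₂ k
    (fun φ ψ => ⟨φ.1.comp ψ.1 h, comp_mem h φ.2 ψ.2⟩)
    (fun _ _ _ => Subtype.ext (Cochain.add_comp _ _ _ h))
    (fun _ _ _ => Subtype.ext (Cochain.smul_comp _ _ _ h))
    (fun _ _ _ => Subtype.ext (Cochain.comp_add _ _ _ h))
    (fun _ _ _ => Subtype.ext (Cochain.comp_smul _ _ _ h))
  d_d n m l h h' f := Subtype.ext (δ_δ n m l f.1)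
  id_comp n f := Subtype.ext (Cochain.id_comp f.1)
  comp_id n f := Subtype.ext (Cochain.comp_id f.1)
  assoc p q r pq qr pqr hpq hqr h h' f g e :=
    Subtype.ext (Cochain.comp_assoc f.1 g.1 e.1 hpq hqr (by omega))
  leibniz p q r p' q' r' h hp hq hr f g :=
    Subtype.ext (δ_comp f.1 g.1 h p' q' r' hr hp hq)

/-- The dg-module over `A` obtained from a dg-module over `B` by restriction of scalars along
`θ : A ⟶ B`. -/
def restrict {A B : DGAlgebra C} (θ : A ⟶ B) (M : DGModule B) : DGModule A where
  cx := M.cx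
  act p i j h := θ.hom.f p ▷ M.cx.X i ≫ M.act p i j h
  one_act i := by
    rw [← comp_whiskerRight_assoc, θ.one_hom, M.one_act]
  mul_act p q i pq qi pqi hpq hqi h h' := by
    rw [← comp_whiskerRight_assoc, θ.mul_hom, comp_whiskerRight_assoc,
      M.mul_act p q i pq qi pqi hpq hqi h h']
    exact restrict_aux _ _ _ _
  leibniz p i j p' i' j' h hp hi hj := by
    rw [Category.assoc, M.leibniz p i j p' i' j' h hp hi hj, Preadditive.comp_add,
      Linear.comp_units_smul, ← comp_whiskerRight_assoc, θ.hom.comm p p',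
      comp_whiskerRight_assoc, whisker_exchange_assoc]

lemma restrict_mem {A B : DGAlgebra C} (θ : A ⟶ B) {M N : DGModule B} {n : ℤ}
    {φ : Cochain M.cx N.cx n} (hφ : φ ∈ linearCochains k M N n) :
    φ ∈ linearCochains k (restrict θ M) (restrict θ N) n := by
  intro p i j i' j' h hi hj
  change (θ.hom.f p ▷ M.cx.X i ≫ M.act p i j h) ≫ φ.v j j' hj =
    (n * p).negOnePow • (A.cx.X p ◁ φ.v i i' hi ≫ θ.hom.f p ▷ N.cx.X i' ≫ N.act p i' j' _)
  rw [Category.assoc, hφ p i j i' j' h hi hj, Linear.comp_units_smul, whisker_exchange_assoc]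

variable (k) in
/-- Restriction of scalars along a morphism of dg-algebras, as a dg-functor. -/
def restrictScalars {A B : DGAlgebra C} (θ : A ⟶ B) :
    DGFunctor k (DGModule B) (DGModule A) where
  obj M := restrict θ M
  map {M N} n :=
    { toFun := fun φ => ⟨φ.1, restrict_mem θ φ.2⟩
      map_add' := fun _ _ => rfl
      map_smul' := fun _ _ => rfl }
  map_d n m h φ := rfl
  map_id M := rfl
  map_comp p q r h φ ψ := rfl

end DGModule

end

section

variable {C : Type u} [Category.{v} C] [Preadditive C] [MonoidalCategory C]
  {D : Type*} [Category* D] [Preadditive D] [MonoidalCategory D]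
  (F : C ⥤ D) [F.Additive] [F.LaxMonoidal]

open Functor.LaxMonoidal

lemma lax_leibniz {X Y X' Y' Z Z' : C} (m : X ⊗ Y ⟶ Z) (d : Z ⟶ Z') (dX : X ⟶ X') (dY : Y ⟶ Y')
    (m₁ : X' ⊗ Y ⟶ Z') (m₂ : X ⊗ Y' ⟶ Z') (s : ℤˣ)
    (h : m ≫ d = dX ▷ Y ≫ m₁ + s • (X ◁ dY ≫ m₂)) :
    (μ F X Y ≫ F.map m) ≫ F.map d =
      F.map dX ▷ F.obj Y ≫ μ F X' Y ≫ F.map m₁ +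
        s • (F.obj X ◁ F.map dY ≫ μ F X Y' ≫ F.map m₂) := by
  rw [Category.assoc, ← F.map_comp, h, F.map_add, Preadditive.comp_add, μ_natural_left_assoc,
    μ_natural_right_assoc, ← F.map_comp, ← F.map_comp, Units.smul_def, Units.smul_def, F.map_zsmul,
    Preadditive.comp_zsmul]

lemma lax_linear {P I J I' J' : C} (a : P ⊗ I ⟶ J) (f : I ⟶ I') (g : J ⟶ J')
    (a' : P ⊗ I' ⟶ J') (s : ℤˣ) (h : a ≫ g = s • (P ◁ f ≫ a')) :
    (μ F P I ≫ F.map a) ≫ F.map g = s • (F.obj P ◁ F.map f ≫ μ F P I' ≫ F.map a') := by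
  rw [Category.assoc, ← F.map_comp, h, μ_natural_right_assoc, ← F.map_comp, Units.smul_def,
    Units.smul_def, F.map_zsmul, Preadditive.comp_zsmul]

/-- The image of a dg-algebra under an additive (lax) monoidal functor. -/
def DGAlgebra.map (A : DGAlgebra C) : DGAlgebra D where
  cx := (F.mapHomologicalComplex _).obj A.cx
  one := ε F ≫ F.map A.one
  mul p q r h := μ F (A.cx.X p) (A.cx.X q) ≫ F.map (A.mul p q r h)
  one_mul p := lax_left_unit F _ _ (A.one_mul p)
  mul_one p := lax_right_unit F _ _ (A.mul_one p)
  mul_assoc p q r pq qr pqr hpq hqr h h' :=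
    lax_assoc F _ _ _ _ (A.mul_assoc p q r pq qr pqr hpq hqr h h')
  leibniz p q r p' q' r' h hp hq hr :=
    lax_leibniz F _ _ _ _ _ _ _ (A.leibniz p q r p' q' r' h hp hq hr)

/-- The dg-functor from dg-modules over `A` to dg-modules over the image of `A`, induced by a
linear (lax) monoidal functor `F`. It applies `F` to the underlying complex of a dg-module. -/
def DGModule.map (k : Type w) [CommRing k] [Linear k C] [Linear k D] [MonoidalPreadditive C]
    [MonoidalPreadditive D] [MonoidalLinear k C] [MonoidalLinear k D] [F.Linear k]
    (A : DGAlgebra C) : DGFunctor k (DGModule A) (DGModule (A.map F)) where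
  obj M :=
    { cx := (F.mapHomologicalComplex _).obj M.cx
      act p i j h := μ F (A.cx.X p) (M.cx.X i) ≫ F.map (M.act p i j h)
      one_act i := lax_left_unit F _ _ (M.one_act i)
      mul_act p q i pq qi pqi hpq hqi h h' :=
        lax_assoc F _ _ _ _ (M.mul_act p q i pq qi pqi hpq hqi h h')
      leibniz p i j p' i' j' h hp hi hj :=
        lax_leibniz F _ _ _ _ _ _ _ (M.leibniz p i j p' i' j' h hp hi hj) }
  map {M N} n := LinearMap.restrict (p := linearCochains k M N n)
    { toFun := fun φ => φ.map F
      map_add' := fun φ ψ => Cochain.map_add φ ψ F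
      map_smul' := fun c φ => by
        ext p q h
        exact F.map_smul c (φ.v p q h) }
    fun φ hφ p i j i' j' h hi hj =>
      lax_linear F _ (φ.v i i' hi) (φ.v j j' hj) _ _ (hφ p i j i' j' h hi hj)
  map_d n m h φ := Subtype.ext (δ_map n m φ.1 F).symm
  map_id M := Subtype.ext ((Cochain.map_ofHom (K := M.cx) (L := M.cx) (f := 𝟙 _) (Φ := F)).trans
    (congrArg Cochain.ofHom (CategoryTheory.Functor.map_id _ _)))
  map_comp p q r h φ ψ := Subtype.ext (Cochain.map_comp (z₁ := φ.1) (z₂ := ψ.1) (h := h) (Φ := F))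

end

end

section

open scoped TensorProduct

namespace SymComplex

universe u

variable (R : Type u) [CommRing R] (V W : Type u) [AddCommGroup V] [Module R V] [AddCommGroup W]
  [Module R W]

/-- The symmetric algebra of a module. -/
def Sym : Type u := SymmetricAlgebra R W

noncomputable instance : CommRing (Sym R W) := inferInstanceAs (CommRing (SymmetricAlgebra R W))

noncomputable instance : Algebra R (Sym R W) := inferInstanceAs (Algebra R (SymmetricAlgebra R W))

/-- The inclusion of a module in its symmetric algebra. -/
noncomputable def Sym.ι : W →ₗ[R] Sym R W := SymmetricAlgebra.ι R W

variable {W} in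
/-- The universal property of the symmetric algebra. -/
noncomputable def Sym.lift {A : Type u} [CommRing A] [Algebra R A] (f : W →ₗ[R] A) :
    Sym R W →ₐ[R] A :=
  SymmetricAlgebra.lift f

lemma Sym.lift_ι {A : Type u} [CommRing A] [Algebra R A] (f : W →ₗ[R] A) (w : W) :
    Sym.lift R f (Sym.ι R W w) = f w :=
  SymmetricAlgebra.lift_ι_apply f w

variable {R W} in
lemma Sym.induction {C : Sym R W → Prop} (scalar : ∀ r : R, C (algebraMap R _ r))
    (ι : ∀ w, C (Sym.ι R W w)) (mul : ∀ a b, C a → C b → C (a * b))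
    (add : ∀ a b, C a → C b → C (a + b)) (a : Sym R W) : C a :=
  SymmetricAlgebra.induction R W (motive := C) scalar ι mul add a

/-- The ring `Λ(V) ⊗ Sym(W)`, which is the underlying ring of the symmetric algebra of a
two-term complex `V ⟶ W`. -/
abbrev Total : Type u := ExteriorAlgebra R V ⊗[R] Sym R W

/-- The part of cohomological degree `n` of `Λ(V)`, for `V` in degree `-1`. -/
noncomputable def extPart (n : ℤ) : Submodule R (ExteriorAlgebra R V) :=
  if n ≤ 0 then ⋀[R]^((-n).toNat) V else ⊥

/-- The part of cohomological degree `n` of `Λ(V) ⊗ Sym(W)`, where `V` is in degree `-1` and `W` in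
degree zero: it is (the isomorphic image of) `Λ^(-n)(V) ⊗ Sym(W)` for `n ≤ 0` and it is zero
for `n > 0`. -/
noncomputable def part (n : ℤ) : Submodule R (Total R V W) :=
  LinearMap.range ((extPart R V n).subtype.rTensor (Sym R W))

variable {R V W}

lemma extPart_neg (k : ℕ) : extPart R V (-k) = ⋀[R]^k V := by
  simp [extPart]

lemma extPart_induction {C : ℤ → ExteriorAlgebra R V → Prop}
    (zero : ∀ n, C n 0)
    (one : ∀ r : R, C 0 (algebraMap R _ r))
    (add : ∀ n x y, C n x → C n y → C n (x + y))
    (mul : ∀ n m x v, x ∈ extPart R V n → m + 1 = n → C n x → C m (ExteriorAlgebra.ι R v * x))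
    {n : ℤ} {x : ExteriorAlgebra R V} (hx : x ∈ extPart R V n) : C n x := by
  unfold extPart at hx
  split_ifs at hx with h
  · obtain ⟨k, rfl⟩ : ∃ k : ℕ, n = -k := ⟨(-n).toNat, by omega⟩
    rw [show (-(-(k : ℤ))).toNat = k by omega] at hx
    clear h
    induction hx using Submodule.pow_induction_on_left' with
    | algebraMap r => exact one r
    | add x y i hx hy h1 h2 => exact add _ _ _ h1 h2
    | mem_mul m hm i x hx h =>
      obtain ⟨v, rfl⟩ := hm
      exact mul (-i) _ x v (by rw [extPart_neg]; exact hx) (by push_cast; ring) h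
  · obtain rfl : x = 0 := by simpa using hx
    exact zero n

lemma ι_mul_mem {n m : ℤ} (h : m + 1 = n) (v : V) {x : ExteriorAlgebra R V}
    (hx : x ∈ extPart R V n) : ExteriorAlgebra.ι R v * x ∈ extPart R V m := by
  unfold extPart at hx
  split_ifs at hx with hn
  · obtain ⟨k, rfl⟩ : ∃ k : ℕ, n = -k := ⟨(-n).toNat, by omega⟩
    obtain rfl : m = -((k + 1 : ℕ) : ℤ) := by push_cast; omega
    rw [extPart_neg]
    rw [show (-(-(k : ℤ))).toNat = k by omega] at hx
    have := Submodule.mul_mem_mul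
      (LinearMap.mem_range_self (ExteriorAlgebra.ι R : V →ₗ[R] _) v) hx
    rwa [← pow_succ'] at this
  · obtain rfl : x = 0 := by simpa using hx
    simp

lemma extPart_mul_mem {p q : ℤ} {x y : ExteriorAlgebra R V} (hx : x ∈ extPart R V p)
    (hy : y ∈ extPart R V q) : x * y ∈ extPart R V (p + q) := by
  refine extPart_induction (C := fun n x => x * y ∈ extPart R V (n + q)) ?_ ?_ ?_ ?_ hx
  · simp
  · intro r
    rw [zero_add, ← Algebra.smul_def]
    exact Submodule.smul_mem _ _ hy
  · intro n x x' h1 h2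
    rw [add_mul]
    exact add_mem h1 h2
  · intro n m x v hx h ih
    rw [_root_.mul_assoc]
    exact ι_mul_mem (by omega) v ih

lemma tmul_mem {n : ℤ} {x : ExteriorAlgebra R V} (hx : x ∈ extPart R V n)
    (s : Sym R W) : x ⊗ₜ[R] s ∈ part R V W n :=
  ⟨⟨x, hx⟩ ⊗ₜ s, rfl⟩

lemma part_induction {n : ℤ} {C : Total R V W → Prop} (zero : C 0)
    (add : ∀ x y, C x → C y → C (x + y)) (tmul : ∀ x s, x ∈ extPart R V n → C (x ⊗ₜ s))
    {z : Total R V W} (hz : z ∈ part R V W n) : C z := by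
  obtain ⟨t, rfl⟩ := hz
  induction t using TensorProduct.induction_on with
  | zero => simpa using zero
  | tmul x s => exact tmul x s x.2
  | add x y h1 h2 => rw [map_add]; exact add _ _ h1 h2

lemma part_mul_mem {p q : ℤ} {x y : Total R V W} (hx : x ∈ part R V W p)
    (hy : y ∈ part R V W q) : x * y ∈ part R V W (p + q) := by
  refine part_induction (C := fun x => x * y ∈ part R V W (p + q)) ?_ ?_ ?_ hx
  · simp
  · intro x x' h1 h2
    rw [add_mul]
    exact add_mem h1 h2
  · intro x s hx
    refine part_induction (C := fun y => x ⊗ₜ s * y ∈ part R V W (p + q)) ?_ ?_ ?_ hy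
    · simp
    · intro x x' h1 h2
      rw [mul_add]
      exact add_mem h1 h2
    · intro y t hy
      rw [Algebra.TensorProduct.tmul_mul_tmul]
      exact tmul_mem (extPart_mul_mem hx hy) _

lemma one_mem_extPart : (1 : ExteriorAlgebra R V) ∈ extPart R V 0 := by
  simp [extPart]

lemma one_mem_part : (1 : Total R V W) ∈ part R V W 0 := tmul_mem one_mem_extPart 1

lemma ι_mem_extPart (v : V) : ExteriorAlgebra.ι R v ∈ extPart R V (-1) := by
  simpa using ι_mul_mem (n := 0) (m := -1) rfl v one_mem_extPart

variable (R) in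
/-- The inclusion of `V` in `Λ(V) ⊗ Sym(W)`. -/
noncomputable def inl (W : Type u) [AddCommGroup W] [Module R W] : V →ₗ[R] Total R V W :=
  Algebra.TensorProduct.includeLeft.toLinearMap ∘ₗ ExteriorAlgebra.ι R

variable (R) in
/-- The inclusion of `W` in `Λ(V) ⊗ Sym(W)`. -/
noncomputable def inr (V : Type u) [AddCommGroup V] [Module R V] : W →ₗ[R] Total R V W :=
  Algebra.TensorProduct.includeRight.toLinearMap ∘ₗ Sym.ι R W

lemma inl_mem (v : V) : inl R W v ∈ part R V W (-1) := tmul_mem (ι_mem_extPart v) 1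

lemma inr_mem (w : W) : inr R V w ∈ part R V W 0 := tmul_mem one_mem_extPart _

open ExteriorAlgebra in
/-- The components of the differential on `Λ(V)`: it sends `v₁ ∧ ⋯ ∧ vₙ` to
`∑ (-1) ^ i (v₁ ∧ ⋯ v̂ᵢ ⋯ ∧ vₙ) ⊗ f(vᵢ)`, where the sum is over `1 ≤ i ≤ n`. -/
noncomputable def diffAlternating (f : V →ₗ[R] W) : ∀ n : ℕ, V [⋀^Fin n]→ₗ[R] Total R V W
  | 0 => 0
  | n + 1 => -AlternatingMap.alternatizeUncurryFin
      { toFun := fun v => ((TensorProduct.mk R (ExteriorAlgebra R V) (Sym R W)).flip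
          (Sym.ι R W (f v))).compAlternatingMap (ιMulti R n)
        map_add' := fun v v' => by ext; simp
        map_smul' := fun r v => by ext; simp }

/-- The differential on `Λ(V) ⊗ Sym(W)` attached to `f : V ⟶ W`: it sends `v₁ ∧ ⋯ ∧ vₙ ⊗ s` to
`∑ (-1) ^ i v₁ ∧ ⋯ v̂ᵢ ⋯ ∧ vₙ ⊗ f(vᵢ) s`, where the sum is over `1 ≤ i ≤ n`. -/
noncomputable def diff (f : V →ₗ[R] W) : Total R V W →ₗ[R] Total R V W :=
  TensorProduct.lift ((LinearMap.mul R (Total R V W)).compl₁₂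
    (ExteriorAlgebra.liftAlternating (diffAlternating f))
    Algebra.TensorProduct.includeRight.toLinearMap)

lemma diff_ιMulti_tmul (f : V →ₗ[R] W) (n : ℕ) (v : Fin (n + 1) → V) (s : Sym R W) :
    diff f (ExteriorAlgebra.ιMulti R (n + 1) v ⊗ₜ s) =
      ∑ i : Fin (n + 1), (-1) ^ (i + 1 : ℕ) •
        (ExteriorAlgebra.ιMulti R n (i.removeNth v) ⊗ₜ (Sym.ι R W (f (v i)) * s)) := by
  simp only [diff, TensorProduct.lift.tmul, LinearMap.compl₁₂_apply,
    ExteriorAlgebra.liftAlternating_apply_ιMulti, diffAlternating, AlternatingMap.neg_apply,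
    AlternatingMap.alternatizeUncurryFin_apply, LinearMap.mul_apply']
  rw [neg_mul, Finset.sum_mul, ← Finset.sum_neg_distrib]
  refine Finset.sum_congr rfl fun i _ => ?_
  simp [pow_succ, _root_.mul_assoc]

lemma diff_algebraMap (f : V →ₗ[R] W) (r : R) (s : Sym R W) :
    diff f (algebraMap R (ExteriorAlgebra R V) r ⊗ₜ s) = 0 := by
  simp [diff, diffAlternating]

lemma diff_mul_tmul (f : V →ₗ[R] W) (z : Total R V W) (s : Sym R W) :
    diff f (z * 1 ⊗ₜ s) = diff f z * 1 ⊗ₜ s := by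
  induction z using TensorProduct.induction_on with
  | zero => simp
  | add x y hx hy => simp [add_mul, hx, hy]
  | tmul x t => simp [diff, _root_.mul_assoc]

lemma ι_mul_ιMulti (n : ℕ) (v : V) (w : Fin n → V) :
    ExteriorAlgebra.ι R v * ExteriorAlgebra.ιMulti R n w =
      ExteriorAlgebra.ιMulti R (n + 1) (Fin.cons v w : Fin (n + 1) → V) := by
  rw [ExteriorAlgebra.ιMulti_succ_apply]
  rfl

lemma diff_ι_mul_tmul_one (f : V →ₗ[R] W) (v : V) (x : ExteriorAlgebra R V) :
    diff f (inl R W v * x ⊗ₜ 1) =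
      -(x ⊗ₜ[R] Sym.ι R W (f v)) - inl R W v * diff f (x ⊗ₜ 1) := by
  suffices h : diff f ∘ₗ LinearMap.mulLeft R (inl R W v) ∘ₗ
      (Algebra.TensorProduct.includeLeft : _ →ₐ[R] Total R V W).toLinearMap =
      -((TensorProduct.mk R (ExteriorAlgebra R V) (Sym R W)).flip
          (Sym.ι R W (f v))) - LinearMap.mulLeft R (inl R W v) ∘ₗ diff f ∘ₗ
      (Algebra.TensorProduct.includeLeft : _ →ₐ[R] Total R V W).toLinearMap from
    LinearMap.congr_fun h x
  apply ExteriorAlgebra.lhom_ext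
  intro n
  ext w
  cases n with
  | zero =>
    simp only [inl, LinearMap.compAlternatingMap_apply, LinearMap.comp_apply,
      LinearMap.mulLeft_apply, AlgHom.toLinearMap_apply, LinearMap.sub_apply,
      Algebra.TensorProduct.includeLeft_apply, Algebra.TensorProduct.tmul_mul_tmul, ι_mul_ιMulti,
      diff_ιMulti_tmul, LinearMap.neg_apply]
    simp [diff, diffAlternating]
  | succ n =>
    simp only [inl, LinearMap.compAlternatingMap_apply, LinearMap.comp_apply,
      LinearMap.mulLeft_apply, AlgHom.toLinearMap_apply, LinearMap.sub_apply,
      Algebra.TensorProduct.includeLeft_apply, Algebra.TensorProduct.tmul_mul_tmul, ι_mul_ιMulti,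
      diff_ιMulti_tmul, LinearMap.neg_apply]
    rw [Fin.sum_univ_succ, sub_eq_add_neg, Finset.mul_sum, ← Finset.sum_neg_distrib]
    congr 1
    · simp
    · refine Finset.sum_congr rfl fun i _ => ?_
      rw [mul_smul_comm, ← neg_smul]
      congr 1
      · rw [Fin.val_succ, pow_succ _ (i + 1 : ℕ)]; simp
      · simp only [Fin.cons_succ, Algebra.TensorProduct.tmul_mul_tmul, _root_.mul_one, _root_.one_mul]
        rw [ι_mul_ιMulti]
        congr 2
        exact Fin.cons_comp_succ_succAbove _ _ _

lemma diff_mem (f : V →ₗ[R] W) {n m : ℤ} (h : n + 1 = m) {z : Total R V W}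
    (hz : z ∈ part R V W n) : diff f z ∈ part R V W m := by
  have key : ∀ x ∈ extPart R V n, diff f (x ⊗ₜ 1) ∈ part R V W (n + 1) := by
    intro x hx
    refine extPart_induction (C := fun n x => diff f (x ⊗ₜ 1) ∈ part R V W (n + 1)) ?_ ?_ ?_ ?_ hx
    · simp
    · intro r
      simp [diff_algebraMap]
    · intro n x x' h1 h2
      rw [TensorProduct.add_tmul, map_add]
      exact add_mem h1 h2
    · rintro n m x v hx rfl ih
      have := diff_ι_mul_tmul_one f v x
      rw [inl, LinearMap.comp_apply, AlgHom.toLinearMap_apply,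
        Algebra.TensorProduct.includeLeft_apply, Algebra.TensorProduct.tmul_mul_tmul,
        _root_.mul_one] at this
      rw [this]
      refine sub_mem (neg_mem (tmul_mem hx _)) ?_
      have h := part_mul_mem (tmul_mem (W := W) (ι_mem_extPart (R := R) v) 1) ih
      rwa [show -1 + (m + 1 + 1) = m + 1 by ring] at h
  subst h
  refine part_induction (C := fun z => diff f z ∈ part R V W (n + 1)) ?_ ?_ ?_ hz
  · simp
  · intro x x' h1 h2
    rw [map_add]
    exact add_mem h1 h2
  · intro x s hx
    have h1 := diff_mul_tmul f (x ⊗ₜ 1) s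
    rw [Algebra.TensorProduct.tmul_mul_tmul, _root_.mul_one, _root_.one_mul] at h1
    rw [h1]
    simpa using part_mul_mem (key x hx) (tmul_mem one_mem_extPart s)

lemma diff_inl_mul (f : V →ₗ[R] W) (v : V) (z : Total R V W) :
    diff f (inl R W v * z) = -(inr R V (f v) * z) - inl R W v * diff f z := by
  induction z using TensorProduct.induction_on with
  | zero => simp
  | add x y hx hy => rw [mul_add, map_add, hx, hy, map_add, mul_add, mul_add]; abel
  | tmul x s =>
    have e : x ⊗ₜ[R] s = x ⊗ₜ[R] 1 * 1 ⊗ₜ s := by simp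
    rw [e, ← _root_.mul_assoc, diff_mul_tmul, diff_ι_mul_tmul_one, diff_mul_tmul, sub_mul,
      _root_.mul_assoc, neg_mul]
    simp [inr]

lemma diff_leibniz (f : V →ₗ[R] W) {n : ℤ} {z : Total R V W} (hz : z ∈ part R V W n)
    (y : Total R V W) : diff f (z * y) = diff f z * y + n.negOnePow • (z * diff f y) := by
  have key : ∀ x ∈ extPart R V n, ∀ y : Total R V W,
      diff f (x ⊗ₜ 1 * y) = diff f (x ⊗ₜ 1) * y + n.negOnePow • (x ⊗ₜ 1 * diff f y) := by
    intro x hx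
    refine extPart_induction (C := fun n x => ∀ y : Total R V W,
      diff f (x ⊗ₜ 1 * y) = diff f (x ⊗ₜ 1) * y + n.negOnePow • (x ⊗ₜ 1 * diff f y))
        ?_ ?_ ?_ ?_ hx
    · simp
    · intro r y
      rw [diff_algebraMap]
      have : (algebraMap R (ExteriorAlgebra R V) r) ⊗ₜ[R] (1 : Sym R W) =
        algebraMap R (Total R V W) r := rfl
      rw [this, ← Algebra.smul_def, ← Algebra.smul_def, map_smul]
      simp
    · intro n x x' h1 h2 y
      simp only [TensorProduct.add_tmul, add_mul, map_add, h1, h2, smul_add]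
      abel
    · rintro n m x v hx rfl ih y
      have e : (ExteriorAlgebra.ι R v * x) ⊗ₜ[R] (1 : Sym R W) = inl R W v * x ⊗ₜ 1 := by
        simp [inl]
      rw [e, _root_.mul_assoc, diff_inl_mul, diff_inl_mul, ih, Int.negOnePow_succ]
      rcases Int.units_eq_one_or m.negOnePow with h | h <;>
      · simp only [h, sub_mul, mul_add, neg_mul, _root_.mul_assoc, neg_neg, Units.neg_smul,
          one_smul, mul_neg]
        abel
  refine part_induction (C := fun z => diff f (z * y) =
    diff f z * y + n.negOnePow • (z * diff f y)) ?_ ?_ ?_ hz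
  · simp
  · intro x x' h1 h2
    rw [add_mul, map_add, h1, h2, map_add, add_mul, add_mul, smul_add]
    abel
  · intro x s hx
    have e : x ⊗ₜ[R] s = x ⊗ₜ[R] 1 * 1 ⊗ₜ s := by simp
    have comm : ∀ z : Total R V W, 1 ⊗ₜ s * z = z * 1 ⊗ₜ s := by
      intro z
      induction z using TensorProduct.induction_on with
      | zero => simp
      | add x y hx hy => rw [mul_add, add_mul, hx, hy]
      | tmul x t => simp [_root_.mul_comm]
    rw [e, diff_mul_tmul, _root_.mul_assoc, comm, ← _root_.mul_assoc, diff_mul_tmul, key x hx,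
      add_mul, _root_.mul_assoc, ← comm y, _root_.mul_assoc (x ⊗ₜ[R] 1), comm (diff f y)]
    simp only [Units.smul_def, smul_mul_assoc, _root_.mul_assoc]

lemma Total.induction {C : Total R V W → Prop} (one_tmul : ∀ s : Sym R W, C (1 ⊗ₜ s))
    (inl_mul : ∀ v z, C z → C (inl R W v * z)) (add : ∀ x y, C x → C y → C (x + y))
    (z : Total R V W) : C z := by
  induction z using TensorProduct.induction_on with
  | zero => simpa using one_tmul 0
  | add x y hx hy => exact add x y hx hy
  | tmul x s =>
    induction x using CliffordAlgebra.left_induction with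
    | algebraMap r =>
      have := one_tmul (r • s)
      rw [← TensorProduct.smul_tmul] at this
      rwa [Algebra.algebraMap_eq_smul_one]
    | add x y hx hy => rw [TensorProduct.add_tmul]; exact add _ _ hx hy
    | ι_mul x v hx =>
      have := inl_mul v _ hx
      rwa [inl, LinearMap.comp_apply, AlgHom.toLinearMap_apply,
        Algebra.TensorProduct.includeLeft_apply, Algebra.TensorProduct.tmul_mul_tmul,
        _root_.one_mul] at this

lemma diff_one_tmul (f : V →ₗ[R] W) (s : Sym R W) : diff f (1 ⊗ₜ s) = 0 := by
  simpa using diff_algebraMap f 1 s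

lemma diff_inr_mul (f : V →ₗ[R] W) (w : W) (z : Total R V W) :
    diff f (inr R V w * z) = inr R V w * diff f z := by
  have h := diff_leibniz f (inr_mem (R := R) (V := V) w) z
  rw [h]
  have : diff f (inr R V w) = 0 := diff_one_tmul f _
  rw [this]
  simp

lemma diff_diff (f : V →ₗ[R] W) (z : Total R V W) : diff f (diff f z) = 0 := by
  induction z using Total.induction with
  | one_tmul s => rw [diff_one_tmul, map_zero]
  | add x y hx hy => rw [map_add, map_add, hx, hy, add_zero]
  | inl_mul v z hz =>
    rw [diff_inl_mul, map_sub, map_neg, diff_inr_mul, diff_inl_mul, hz, mul_zero, sub_zero,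
      sub_neg_eq_add, neg_add_cancel]

lemma diff_inl (f : V →ₗ[R] W) (v : V) : diff f (inl R W v) = -inr R V (f v) := by
  have := diff_inl_mul f v 1
  rwa [_root_.mul_one, _root_.mul_one, show diff f 1 = 0 from diff_one_tmul f 1, mul_zero,
    sub_zero] at this

lemma Total.ringHom_ext {T : Type u} [Ring T] {g h : Total R V W →+* T}
    (h₁ : ∀ r, g (algebraMap R _ r) = h (algebraMap R _ r))
    (h₂ : ∀ v, g (inl R W v) = h (inl R W v)) (h₃ : ∀ w, g (inr R V w) = h (inr R V w)) :
    g = h := by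
  refine RingHom.ext fun z => ?_
  induction z using Total.induction with
  | one_tmul s =>
    induction s using Sym.induction with
    | scalar r =>
      have := h₁ r
      rwa [Algebra.TensorProduct.algebraMap_apply', ] at this
    | ι w => exact h₃ w
    | mul a b ha hb =>
      rw [show (1 : ExteriorAlgebra R V) ⊗ₜ[R] (a * b) = 1 ⊗ₜ a * 1 ⊗ₜ b by simp, map_mul, ha, hb,
        map_mul]
    | add a b ha hb => rw [TensorProduct.tmul_add, map_add, ha, hb, map_add]
  | add x y hx hy => rw [map_add, hx, hy, map_add]
  | inl_mul v z hz => rw [map_mul, hz, h₂, map_mul]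

section BaseChange

/-- A semilinear map `g : M ⟶ N` over `φ : R ⟶ S` exhibits `N` as the base change of `M`: every
semilinear map from `M` to an `S`-module extends uniquely to an `S`-linear map from `N`. -/
def IsBaseChangeMap {R S : Type u} [CommRing R] [CommRing S] {φ : R →+* S} {M N : Type u}
    [AddCommGroup M] [Module R M] [AddCommGroup N] [Module S N] (g : M →ₛₗ[φ] N) : Prop :=
  ∀ (Q : Type u) [AddCommGroup Q] [Module S Q] (h : M →ₛₗ[φ] Q),
    ∃! h' : N →ₗ[S] Q, ∀ m, h' (g m) = h m

variable {S : Type u} [CommRing S] {φ : R →+* S}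

lemma IsBaseChangeMap.hom_ext {M N Q : Type u} [AddCommGroup M] [Module R M] [AddCommGroup N]
    [Module S N] [AddCommGroup Q] [Module S Q] {g : M →ₛₗ[φ] N} (hg : IsBaseChangeMap g)
    {h h' : N →ₗ[S] Q} (e : ∀ m, h (g m) = h' (g m)) : h = h' :=
  (hg Q (h.comp g)).unique (fun _ => rfl) (fun m => (e m).symm)

lemma IsBaseChangeMap.tensor {M N M' N' : Type u} [AddCommGroup M] [Module R M] [AddCommGroup N]
    [Module S N] [AddCommGroup M'] [Module R M'] [AddCommGroup N'] [Module S N']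
    {g : M →ₛₗ[φ] N} {g' : M' →ₛₗ[φ] N'} (hg : IsBaseChangeMap g) (hg' : IsBaseChangeMap g') :
    IsBaseChangeMap (TensorProduct.map g g') := by
  intro Q _ _ h
  choose l hl using fun m => (hg' Q (h.comp (TensorProduct.mk R M M' m))).exists
  let L : M →ₛₗ[φ] (N' →ₗ[S] Q) :=
    { toFun := l
      map_add' := fun m n => hg'.hom_ext fun m' => by
        simp only [LinearMap.add_apply, hl, LinearMap.comp_apply, map_add]
      map_smul' := fun r m => hg'.hom_ext fun m' => by
        simp only [LinearMap.smul_apply, hl, LinearMap.comp_apply, map_smul,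
          LinearMap.map_smulₛₗ] }
  obtain ⟨L', hL', -⟩ := hg _ L
  refine ⟨TensorProduct.lift L', fun z => ?_, fun k hk => ?_⟩
  · induction z using TensorProduct.induction_on with
    | zero => simp
    | add x y hx hy => simp only [map_add, hx, hy]
    | tmul m m' =>
      rw [TensorProduct.map_tmul, TensorProduct.lift.tmul, hL']
      exact hl m m'
  · have : TensorProduct.curry k = L' := by
      refine hg.hom_ext fun m => hg'.hom_ext fun m' => ?_
      rw [hL', TensorProduct.curry_apply]
      exact (hk (m ⊗ₜ m')).trans (hl m m').symm
    exact TensorProduct.ext' fun x y => by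
      rw [← this]; rfl

/-- Retracts of base changes are base changes. -/
lemma IsBaseChangeMap.of_retract {M N A B : Type u} [AddCommGroup M] [Module R M] [AddCommGroup N]
    [Module S N] [AddCommGroup A] [Module R A] [AddCommGroup B] [Module S B]
    {g : M →ₛₗ[φ] N} {g' : A →ₛₗ[φ] B} (hg : IsBaseChangeMap g) (i : A →ₗ[R] M) (p : M →ₗ[R] A)
    (i' : B →ₗ[S] N) (p' : N →ₗ[S] B) (hp' : ∀ x, p' (i' x) = x) (hp : ∀ x, p (i x) = x)
    (hi : ∀ x, g (i x) = i' (g' x)) (hpp : ∀ x, g' (p x) = p' (g x)) : IsBaseChangeMap g' := by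
  intro Q _ _ h
  obtain ⟨k, hk, -⟩ := hg Q (h.comp p)
  refine ⟨k.comp i', fun m => ?_, fun l hl => ?_⟩
  · rw [LinearMap.comp_apply, ← hi, hk, LinearMap.comp_apply, hp]
  · have : l.comp p' = k := hg.hom_ext fun m => by
      rw [LinearMap.comp_apply, ← hpp, hl, hk, LinearMap.comp_apply]
    ext x
    rw [← this, LinearMap.comp_apply, LinearMap.comp_apply, hp']

variable {V' W' : Type u} [AddCommGroup V'] [Module S V'] [AddCommGroup W'] [Module S W']

/-- The ring homomorphism between symmetric algebras which extends a semilinear map. -/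
noncomputable def Sym.map (b : W →ₛₗ[φ] W') : Sym R W →+* Sym S W' :=
  letI : Algebra R (Sym S W') := Algebra.compHom _ φ
  (Sym.lift R (A := Sym S W')
    { toFun := fun w => Sym.ι S W' (b w)
      map_add' := fun _ _ => by simp
      map_smul' := fun r w => by
        rw [LinearMap.map_smulₛₗ, map_smul]
        rfl }).toRingHom

lemma Sym.map_ι (b : W →ₛₗ[φ] W') (w : W) : Sym.map b (Sym.ι R W w) = Sym.ι S W' (b w) :=
  letI : Algebra R (Sym S W') := Algebra.compHom _ φ
  Sym.lift_ι R W (A := Sym S W') _ w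

lemma Sym.map_algebraMap (b : W →ₛₗ[φ] W') (r : R) :
    Sym.map b (algebraMap R _ r) = algebraMap S _ (φ r) :=
  letI : Algebra R (Sym S W') := Algebra.compHom _ φ
  AlgHom.commutes _ _

/-- The ring homomorphism between exterior algebras which extends a semilinear map. -/
noncomputable def extMap (a : V →ₛₗ[φ] V') : ExteriorAlgebra R V →+* ExteriorAlgebra S V' :=
  letI : Algebra R (ExteriorAlgebra S V') := Algebra.compHom _ φ
  (ExteriorAlgebra.lift R (A := ExteriorAlgebra S V') ⟨
    { toFun := fun v => ExteriorAlgebra.ι S (a v)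
      map_add' := fun _ _ => by simp
      map_smul' := fun r w => by
        rw [LinearMap.map_smulₛₗ, map_smul]
        rfl }, fun v => ExteriorAlgebra.ι_sq_zero _⟩).toRingHom

lemma extMap_ι (a : V →ₛₗ[φ] V') (v : V) :
    extMap a (ExteriorAlgebra.ι R v) = ExteriorAlgebra.ι S (a v) :=
  letI : Algebra R (ExteriorAlgebra S V') := Algebra.compHom _ φ
  ExteriorAlgebra.lift_ι_apply _ _ _ _

lemma extMap_algebraMap (a : V →ₛₗ[φ] V') (r : R) :
    extMap a (algebraMap R _ r) = algebraMap S _ (φ r) :=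
  letI : Algebra R (ExteriorAlgebra S V') := Algebra.compHom _ φ
  AlgHom.commutes (ExteriorAlgebra.lift R _) _

lemma extMap_smul (a : V →ₛₗ[φ] V') (r : R) (x : ExteriorAlgebra R V) :
    extMap a (r • x) = φ r • extMap a x := by
  rw [Algebra.smul_def, map_mul, extMap_algebraMap, ← Algebra.smul_def]

lemma Sym.map_smul (b : W →ₛₗ[φ] W') (r : R) (x : Sym R W) :
    Sym.map b (r • x) = φ r • Sym.map b x := by
  rw [Algebra.smul_def, map_mul, Sym.map_algebraMap, ← Algebra.smul_def]

/-- The ring homomorphism `extMap a`, as a semilinear map. -/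
noncomputable def extMapₗ (a : V →ₛₗ[φ] V') : ExteriorAlgebra R V →ₛₗ[φ] ExteriorAlgebra S V' :=
  { extMap a with map_smul' := extMap_smul a }

/-- The ring homomorphism `Sym.map b`, as a semilinear map. -/
noncomputable def Sym.mapₗ (b : W →ₛₗ[φ] W') : Sym R W →ₛₗ[φ] Sym S W' :=
  { Sym.map b with map_smul' := Sym.map_smul b }

/-- The semilinear map `Λ(V) ⊗ Sym(W) ⟶ Λ(V') ⊗ Sym(W')` induced by semilinear maps `V ⟶ V'`
and `W ⟶ W'`. -/
noncomputable def Total.map (a : V →ₛₗ[φ] V') (b : W →ₛₗ[φ] W') :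
    Total R V W →ₛₗ[φ] Total S V' W' :=
  TensorProduct.map (extMapₗ a) (Sym.mapₗ b)

variable (a : V →ₛₗ[φ] V') (b : W →ₛₗ[φ] W')

lemma Total.map_tmul (x : ExteriorAlgebra R V) (s : Sym R W) :
    Total.map a b (x ⊗ₜ s) = extMap a x ⊗ₜ Sym.map b s := rfl

lemma Total.map_mul (x y : Total R V W) :
    Total.map a b (x * y) = Total.map a b x * Total.map a b y := by
  induction x using TensorProduct.induction_on with
  | zero => simp
  | add x y hx hy => simp only [add_mul, map_add, hx, hy]
  | tmul x s =>
    induction y using TensorProduct.induction_on with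
    | zero => simp
    | add x y hx hy => simp only [mul_add, map_add, hx, hy]
    | tmul y t => simp [Total.map_tmul]

lemma Total.map_one : Total.map a b 1 = 1 := by
  rw [Algebra.TensorProduct.one_def, Total.map_tmul, _root_.map_one, _root_.map_one]
  rfl

lemma Total.map_inl (v : V) : Total.map a b (inl R W v) = inl S W' (a v) := by
  simp [inl, Total.map_tmul, extMap_ι]

lemma Total.map_inr (w : W) : Total.map a b (inr R V w) = inr S V' (b w) := by
  simp [inr, Total.map_tmul, Sym.map_ι]

lemma map_diff (f : V →ₗ[R] W) (f' : V' →ₗ[S] W') (h : ∀ v, b (f v) = f' (a v))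
    (z : Total R V W) : Total.map a b (diff f z) = diff f' (Total.map a b z) := by
  induction z using Total.induction with
  | one_tmul s => rw [diff_one_tmul, Total.map_tmul, _root_.map_one, diff_one_tmul, map_zero]
  | add x y hx hy => simp only [map_add, hx, hy]
  | inl_mul v z hz =>
    rw [diff_inl_mul, Total.map_mul, Total.map_inl, diff_inl_mul, map_sub, map_neg, Total.map_mul,
      Total.map_mul, Total.map_inl, Total.map_inr, hz, h]

lemma extMap_mem {n : ℤ} {x : ExteriorAlgebra R V} (hx : x ∈ extPart R V n) :
    extMap a x ∈ extPart S V' n := by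
  refine extPart_induction (C := fun n x => extMap a x ∈ extPart S V' n) ?_ ?_ ?_ ?_ hx
  · simp
  · intro r
    rw [extMap_algebraMap, Algebra.algebraMap_eq_smul_one]
    exact Submodule.smul_mem _ _ one_mem_extPart
  · intro n x x' h1 h2
    rw [map_add]
    exact add_mem h1 h2
  · intro n m x v hx h ih
    rw [_root_.map_mul, extMap_ι]
    exact ι_mul_mem h _ ih

lemma Total.map_mem {n : ℤ} {z : Total R V W} (hz : z ∈ part R V W n) :
    Total.map a b z ∈ part S V' W' n := by
  refine part_induction (C := fun z => Total.map a b z ∈ part S V' W' n) ?_ ?_ ?_ hz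
  · simp
  · intro x x' h1 h2
    rw [map_add]
    exact add_mem h1 h2
  · intro x s hx
    exact tmul_mem (extMap_mem a hx) _

lemma extMap_span (ha : ∀ v', v' ∈ Submodule.span S (Set.range a)) (x : ExteriorAlgebra S V') :
    x ∈ Submodule.span S (Set.range (extMap a)) := by
  have mul : ∀ x y, x ∈ Submodule.span S (Set.range (extMap a)) →
      y ∈ Submodule.span S (Set.range (extMap a)) →
      x * y ∈ Submodule.span S (Set.range (extMap a)) := by
    intro x y hx hy
    have := Submodule.mul_mem_mul hx hy
    rw [Submodule.span_mul_span] at this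
    refine Submodule.span_mono ?_ this
    rintro _ ⟨_, ⟨u, rfl⟩, _, ⟨v, rfl⟩, rfl⟩
    exact ⟨u * v, map_mul _ _ _⟩
  induction x using CliffordAlgebra.left_induction with
  | algebraMap r =>
    rw [Algebra.algebraMap_eq_smul_one]
    exact Submodule.smul_mem _ _ (Submodule.subset_span ⟨1, _root_.map_one _⟩)
  | add x y hx hy => exact add_mem hx hy
  | ι_mul x m hx =>
    refine mul _ _ ?_ hx
    have h1 := Submodule.mem_map_of_mem (f := ExteriorAlgebra.ι S) (ha m)
    rw [Submodule.map_span] at h1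
    refine Submodule.span_mono ?_ h1
    rintro _ ⟨_, ⟨v, rfl⟩, rfl⟩
    exact ⟨ExteriorAlgebra.ι R v, extMap_ι a v⟩

lemma Sym.map_span (hb : ∀ w', w' ∈ Submodule.span S (Set.range b)) (x : Sym S W') :
    x ∈ Submodule.span S (Set.range (Sym.map b)) := by
  induction x using Sym.induction with
  | scalar r =>
    rw [Algebra.algebraMap_eq_smul_one]
    exact Submodule.smul_mem _ _ (Submodule.subset_span ⟨1, _root_.map_one _⟩)
  | add x y hx hy => exact add_mem hx hy
  | mul x y hx hy =>
    have := Submodule.mul_mem_mul hx hy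
    rw [Submodule.span_mul_span] at this
    refine Submodule.span_mono ?_ this
    rintro _ ⟨_, ⟨u, rfl⟩, _, ⟨v, rfl⟩, rfl⟩
    exact ⟨u * v, _root_.map_mul _ _ _⟩
  | ι m =>
    have h1 := Submodule.mem_map_of_mem (f := Sym.ι S W') (hb m)
    rw [Submodule.map_span] at h1
    refine Submodule.span_mono ?_ h1
    rintro _ ⟨_, ⟨v, rfl⟩, rfl⟩
    exact ⟨Sym.ι R W v, Sym.map_ι b v⟩

lemma IsBaseChangeMap.span {M N : Type u} [AddCommGroup M] [Module R M] [AddCommGroup N]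
    [Module S N] {g : M →ₛₗ[φ] N} (hg : IsBaseChangeMap g) (x : N) :
    x ∈ Submodule.span S (Set.range g) := by
  have : (Submodule.span S (Set.range g)).mkQ = 0 := hg.hom_ext fun m => by
    rw [LinearMap.zero_apply, Submodule.mkQ_apply, Submodule.Quotient.mk_eq_zero]
    exact Submodule.subset_span ⟨m, rfl⟩
  rw [← Submodule.Quotient.mk_eq_zero, ← Submodule.mkQ_apply, this, LinearMap.zero_apply]

lemma isBaseChangeMap_of_span [Algebra R S] {M N : Type u} [AddCommGroup M] [Module R M]
    [AddCommGroup N] [Module S N] {g : M →ₛₗ[algebraMap R S] N}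
    (hg : ∀ x, x ∈ Submodule.span S (Set.range g)) (k : N →ₗ[S] S ⊗[R] M)
    (hk : ∀ m, k (g m) = 1 ⊗ₜ m) : IsBaseChangeMap g := by
  intro Q _ _ h
  let _ : Module R Q := Module.compHom Q (algebraMap R S)
  have : IsScalarTower R S Q := ⟨fun r s q => by
    rw [Algebra.smul_def, mul_smul]
    rfl⟩
  let h₁ : M →ₗ[R] Q := { h with map_smul' := fun r m => h.map_smulₛₗ r m }
  refine ⟨(TensorProduct.isBaseChange R M S).lift h₁ ∘ₗ k, fun m => ?_, fun l hl => ?_⟩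
  · rw [LinearMap.comp_apply, hk]
    exact IsBaseChange.lift_eq (TensorProduct.isBaseChange R M S) h₁ m
  · ext x
    have hx := hg x
    induction hx using Submodule.span_induction with
    | mem x hx =>
      obtain ⟨m, rfl⟩ := hx
      rw [LinearMap.comp_apply, hk, hl]
      exact (IsBaseChange.lift_eq (TensorProduct.isBaseChange R M S) h₁ m).symm
    | zero => simp
    | add x y _ _ hx hy => simp only [map_add, hx, hy]
    | smul s x _ hx => simp only [_root_.map_smul, hx]

variable {a b}

lemma isBaseChangeMap_ext_aux [Algebra R S] {a : V →ₛₗ[algebraMap R S] V'}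
    (ha : IsBaseChangeMap a) : IsBaseChangeMap (extMapₗ a) := by
  let ψ : V →ₛₗ[algebraMap R S] S ⊗[R] ExteriorAlgebra R V :=
    { toFun := fun v => 1 ⊗ₜ ExteriorAlgebra.ι R v
      map_add' := fun _ _ => by rw [map_add, TensorProduct.tmul_add]
      map_smul' := fun r v => by
        rw [_root_.map_smul, TensorProduct.tmul_smul, algebraMap_smul] }
  obtain ⟨l, hl, -⟩ := ha _ ψ
  have anti : ∀ x y, l x * l y + l y * l x = 0 := by
    have : (LinearMap.mul S (S ⊗[R] ExteriorAlgebra R V)).compl₁₂ l l +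
        (LinearMap.mul S (S ⊗[R] ExteriorAlgebra R V)).flip.compl₁₂ l l = 0 := by
      refine ha.hom_ext fun v => ha.hom_ext fun w => ?_
      simp [hl, ψ, ← TensorProduct.tmul_add, ExteriorAlgebra.ι_add_mul_swap]
    intro x y
    exact LinearMap.congr_fun₂ this x y
  have sq : ∀ x, l x * l x = 0 := by
    intro x
    have hx := ha.span x
    induction hx using Submodule.span_induction with
    | mem x hx =>
      obtain ⟨m, rfl⟩ := hx
      simp [hl, ψ]
    | zero => simp
    | add x y _ _ hx hy =>
      rw [map_add, mul_add, add_mul, add_mul, hx, hy, zero_add, add_zero, anti]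
    | smul s x _ hx => simp [hx]
  let k := ExteriorAlgebra.lift S ⟨l, sq⟩
  refine isBaseChangeMap_of_span (extMap_span a ha.span) k.toLinearMap fun m => ?_
  change k (extMap a m) = _
  induction m using CliffordAlgebra.left_induction with
  | algebraMap r =>
    rw [extMap_algebraMap, AlgHom.commutes, Algebra.TensorProduct.algebraMap_apply,
      Algebra.algebraMap_eq_smul_one (R := R) (A := ExteriorAlgebra R V),
      ← TensorProduct.smul_tmul, Algebra.smul_def, _root_.mul_one]
    rfl
  | add x y hx hy => rw [map_add, map_add, hx, hy, TensorProduct.tmul_add]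
  | ι_mul x m hx =>
    rw [_root_.map_mul, extMap_ι, _root_.map_mul, hx, ExteriorAlgebra.lift_ι_apply, hl]
    simp [ψ]

lemma isBaseChangeMap_sym_aux [Algebra R S] {b : W →ₛₗ[algebraMap R S] W'}
    (hb : IsBaseChangeMap b) : IsBaseChangeMap (Sym.mapₗ b) := by
  let ψ : W →ₛₗ[algebraMap R S] S ⊗[R] Sym R W :=
    { toFun := fun v => 1 ⊗ₜ Sym.ι R W v
      map_add' := fun _ _ => by rw [map_add, TensorProduct.tmul_add]
      map_smul' := fun r v => by
        rw [_root_.map_smul, TensorProduct.tmul_smul, algebraMap_smul] }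
  obtain ⟨l, hl, -⟩ := hb _ ψ
  let k := Sym.lift S l
  refine isBaseChangeMap_of_span (Sym.map_span b hb.span) k.toLinearMap fun m => ?_
  change k (Sym.map b m) = _
  induction m using Sym.induction with
  | scalar r =>
    rw [Sym.map_algebraMap, AlgHom.commutes, Algebra.TensorProduct.algebraMap_apply,
      Algebra.algebraMap_eq_smul_one (R := R) (A := Sym R W),
      ← TensorProduct.smul_tmul, Algebra.smul_def, _root_.mul_one]
    rfl
  | add x y hx hy => rw [map_add, map_add, hx, hy, TensorProduct.tmul_add]
  | mul x y hx hy =>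
    rw [_root_.map_mul, _root_.map_mul, hx, hy, Algebra.TensorProduct.tmul_mul_tmul,
      _root_.mul_one]
  | ι w =>
    rw [Sym.map_ι, Sym.lift_ι, hl]
    rfl

lemma isBaseChangeMap_total (ha : IsBaseChangeMap a) (hb : IsBaseChangeMap b) :
    IsBaseChangeMap (Total.map a b) := by
  let _ := φ.toAlgebra
  exact (isBaseChangeMap_ext_aux (a := a) ha).tensor (isBaseChangeMap_sym_aux (b := b) hb)

variable (R V) in
/-- The projection of `Λ(V)` to its part of cohomological degree `n`. -/
noncomputable def extProj (n : ℤ) : ExteriorAlgebra R V →ₗ[R] ExteriorAlgebra R V :=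
  if n ≤ 0 then GradedAlgebra.proj (fun i : ℕ => ⋀[R]^i V) ((-n).toNat) else 0

lemma extProj_mem (n : ℤ) (x : ExteriorAlgebra R V) : extProj R V n x ∈ extPart R V n := by
  unfold extProj extPart
  split_ifs
  · rw [GradedAlgebra.proj_apply]
    exact SetLike.coe_mem _
  · simp

lemma extProj_of_mem {n : ℤ} {x : ExteriorAlgebra R V} (hx : x ∈ extPart R V n) :
    extProj R V n x = x := by
  unfold extPart at hx
  unfold extProj
  split_ifs at hx ⊢
  · rw [GradedAlgebra.proj_apply]
    exact DirectSum.decompose_of_mem_same _ hx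
  · simpa using hx.symm

lemma extProj_of_ne (n : ℤ) {k : ℕ} (h : n ≠ -k) {x : ExteriorAlgebra R V} (hx : x ∈ ⋀[R]^k V) :
    extProj R V n x = 0 := by
  unfold extProj
  split_ifs
  · rw [GradedAlgebra.proj_apply]
    exact DirectSum.decompose_of_mem_ne _ hx (by omega)
  · simp

lemma extMap_extProj (a : V →ₛₗ[φ] V') (n : ℤ) (x : ExteriorAlgebra R V) :
    extMap a (extProj R V n x) = extProj S V' n (extMap a x) := by
  induction x using DirectSum.Decomposition.inductionOn fun i : ℕ => ⋀[R]^i V with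
  | zero => simp
  | add x y hx hy => simp only [map_add, hx, hy]
  | @homogeneous k x =>
    obtain ⟨x, hx0⟩ := x
    have hx : x ∈ extPart R V (-k) := by
      rw [extPart_neg]
      exact hx0
    have hx' := extMap_mem a hx
    change extMap a (extProj R V n x) = extProj S V' n (extMap a x)
    by_cases h : n = -k
    · subst h
      rw [extProj_of_mem hx, extProj_of_mem hx']
    · rw [extPart_neg] at hx'
      rw [extProj_of_ne n h hx0, extProj_of_ne n h hx', map_zero]

variable (R V W) in
/-- The projection of `Λ(V) ⊗ Sym(W)` to its part of cohomological degree `n`. -/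
noncomputable def proj (n : ℤ) : Total R V W →ₗ[R] part R V W n :=
  ((extProj R V n).rTensor (Sym R W)).codRestrict _ fun z => by
    induction z using TensorProduct.induction_on with
    | zero => simp
    | add x y hx hy => rw [map_add]; exact add_mem hx hy
    | tmul x s => exact tmul_mem (extProj_mem n x) s

lemma proj_of_mem {n : ℤ} {z : Total R V W} (hz : z ∈ part R V W n) :
    (proj R V W n z : Total R V W) = z := by
  refine part_induction (C := fun z => (proj R V W n z : Total R V W) = z) ?_ ?_ ?_ hz
  · simp
  · intro x x' h1 h2
    rw [map_add, Submodule.coe_add, h1, h2]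
  · intro x s hx
    exact congrArg (· ⊗ₜ s) (extProj_of_mem hx)

lemma map_proj (a : V →ₛₗ[φ] V') (b : W →ₛₗ[φ] W') (n : ℤ) (z : Total R V W) :
    Total.map a b (proj R V W n z) = proj S V' W' n (Total.map a b z) := by
  induction z using TensorProduct.induction_on with
  | zero => simp
  | add x y hx hy => simp only [map_add, Submodule.coe_add, hx, hy]
  | tmul x s => exact congrArg (· ⊗ₜ Sym.map b s) (extMap_extProj a n x)

/-- The part of cohomological degree `n` of `Total.map`. -/
noncomputable def partMap (a : V →ₛₗ[φ] V') (b : W →ₛₗ[φ] W') (n : ℤ) :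
    part R V W n →ₛₗ[φ] part S V' W' n where
  toFun z := ⟨Total.map a b z.1, Total.map_mem a b z.2⟩
  map_add' _ _ := Subtype.ext (map_add _ _ _)
  map_smul' _ _ := Subtype.ext (LinearMap.map_smulₛₗ _ _ _)

lemma isBaseChangeMap_part (ha : IsBaseChangeMap a) (hb : IsBaseChangeMap b) (n : ℤ) :
    IsBaseChangeMap (partMap a b n) :=
  (isBaseChangeMap_total ha hb).of_retract (part R V W n).subtype (proj R V W n)
    (part S V' W' n).subtype (proj S V' W' n) (fun x => Subtype.ext (proj_of_mem x.2))
    (fun x => Subtype.ext (proj_of_mem x.2)) (fun _ => rfl)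
    (fun z => Subtype.ext (map_proj a b n z))

/-- `Total.map`, as a ring homomorphism. -/
noncomputable def Total.mapRingHom (a : V →ₛₗ[φ] V') (b : W →ₛₗ[φ] W') :
    Total R V W →+* Total S V' W' where
  __ := Total.map a b
  map_one' := Total.map_one a b
  map_mul' := Total.map_mul a b
  map_zero' := map_zero _

end BaseChange

lemma Total.map_id (z : Total R V W) :
    Total.map (LinearMap.id : V →ₗ[R] V) (LinearMap.id : W →ₗ[R] W) z = z := by
  have : Total.mapRingHom (LinearMap.id : V →ₗ[R] V) (LinearMap.id : W →ₗ[R] W) =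
      RingHom.id _ := Total.ringHom_ext (fun r => ?_) (fun v => Total.map_inl _ _ v)
        (fun w => Total.map_inr _ _ w)
  · exact RingHom.congr_fun this z
  · rw [Algebra.algebraMap_eq_smul_one]
    exact ((Total.map _ _).map_smul r 1).trans (congrArg _ (Total.map_one _ _))

lemma Total.map_comp {S T : Type u} [CommRing S] [CommRing T] {φ : R →+* S} {ψ : S →+* T}
    {χ : R →+* T} [RingHomCompTriple φ ψ χ] {V' W' V'' W'' : Type u} [AddCommGroup V'] [Module S V']
    [AddCommGroup W'] [Module S W'] [AddCommGroup V''] [Module T V''] [AddCommGroup W'']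
    [Module T W''] (a : V →ₛₗ[φ] V') (b : W →ₛₗ[φ] W') (a' : V' →ₛₗ[ψ] V'') (b' : W' →ₛₗ[ψ] W'')
    (a'' : V →ₛₗ[χ] V'') (b'' : W →ₛₗ[χ] W'') (h : ∀ v, a'' v = a' (a v))
    (h' : ∀ w, b'' w = b' (b w)) (z : Total R V W) :
    Total.map a'' b'' z = Total.map a' b' (Total.map a b z) := by
  have : Total.mapRingHom a'' b'' =
      (Total.mapRingHom a' b').comp (Total.mapRingHom a b) := Total.ringHom_ext (fun r => ?_)
        (fun v => ?_) (fun w => ?_)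
  · exact RingHom.congr_fun this z
  · rw [Algebra.algebraMap_eq_smul_one]
    refine ((Total.map a'' b'').map_smulₛₗ r 1).trans ?_
    rw [Total.map_one]
    change _ = Total.map a' b' (Total.map a b (r • 1))
    rw [LinearMap.map_smulₛₗ, LinearMap.map_smulₛₗ, Total.map_one, Total.map_one,
      RingHomCompTriple.comp_apply]
  · refine (Total.map_inl _ _ v).trans ?_
    change _ = Total.map a' b' (Total.map a b (inl R W v))
    rw [Total.map_inl, Total.map_inl, h]
  · refine (Total.map_inr _ _ w).trans ?_
    change _ = Total.map a' b' (Total.map a b (inr R V w))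
    rw [Total.map_inr, Total.map_inr, h']

end SymComplex

end

open CategoryTheory MonoidalCategory CartesianMonoidalCategory AlgebraicGeometry
open scoped MonObj

/-- The base scheme `Spec ℂ`. -/
noncomputable abbrev SpecC : Scheme.{0} := Spec (CommRingCat.of ℂ)

/-- A scheme `space` over `ℂ` with an action of a group scheme `grp` over `ℂ`. -/
structure ActedScheme where
  grp : Over SpecC
  space : Over SpecC
  [grpObj : GrpObj grp]
  [modObj : ModObj grp space]

namespace ActedScheme

attribute [instance] ActedScheme.grpObj ActedScheme.modObj

/-- A morphism of schemes with group actions: a homomorphism of group schemes and a morphism of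
schemes which is equivariant with respect to it. -/
structure Hom (Y Z : ActedScheme) where
  grp : Y.grp ⟶ Z.grp
  [isMonHom : IsMonHom grp]
  space : Y.space ⟶ Z.space
  smul_comp (T : Over SpecC) (k : T ⟶ Y.grp) (y : T ⟶ Y.space) :
    (k • y) ≫ space = (k ≫ grp) • (y ≫ space)

attribute [instance] Hom.isMonHom

/-- An affine point of a scheme `Y` with an action of a group scheme `K`: an affine scheme `T`
over `ℂ` together with a morphism `T ⟶ Y` over `ℂ`. -/
structure Point (Y : ActedScheme) where
  base : Over SpecC
  [isAffine : IsAffine base.left]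
  pt : base ⟶ Y.space

/-- The affine points of `Y` are the objects of a category, in which a morphism from `y' ∈ Y(T')` to
`y ∈ Y(T)` is a morphism `f : T' ⟶ T` over `ℂ` together with an element `k ∈ K(T')` of the group
such that `k • f^*(y) = y'`. This is the category of affine schemes over the quotient
(pre)stack `Y / K`, which is the Grothendieck construction of the functor
`T ↦ (action groupoid of K(T) on Y(T))`. -/
@[ext]
structure Point.Hom {Y : ActedScheme} (p q : Y.Point) where
  base : p.base ⟶ q.base
  elt : p.base ⟶ Y.grp
  smul_eq : elt • (base ≫ q.pt) = p.pt

variable {Y Z : ActedScheme}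

noncomputable instance : Category Y.Point where
  Hom := Point.Hom
  id p := ⟨𝟙 _, 1, by simp⟩
  comp {p q r} f g := ⟨f.base ≫ g.base, f.elt * (f.base ≫ g.elt), by
    rw [mul_smul, Category.assoc, ← ModObj.comp_smul, g.smul_eq, f.smul_eq]⟩
  id_comp f := Point.Hom.ext (by simp) (by simp)
  comp_id f := Point.Hom.ext (by simp) (by simp)
  assoc {p q r t} f g h := Point.Hom.ext (Category.assoc _ _ _) (by
    change (f.elt * (f.base ≫ g.elt)) * ((f.base ≫ g.base) ≫ h.elt) =
      f.elt * (f.base ≫ (g.elt * (g.base ≫ h.elt)))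
    rw [MonObj.comp_mul, _root_.mul_assoc, Category.assoc])

variable (Y) in
/-- The affine scheme underlying an affine point. -/
@[simps]
noncomputable def toOver : Y.Point ⥤ Over SpecC where
  obj p := p.base
  map f := f.base

variable (Y) in
/-- The structure presheaf: it sends an affine point `T ⟶ Y` to the ring of functions on `T`. -/
noncomputable abbrev O : Y.Pointᵒᵖ ⥤ CommRingCat.{0} :=
  (Y.toOver ⋙ Over.forget SpecC).op ⋙ Scheme.Γ

/-- The functor on categories of affine points induced by an equivariant morphism. -/
@[simps]
noncomputable def Hom.points (f : Hom Y Z) : Y.Point ⥤ Z.Point where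
  obj p := letI := p.isAffine; ⟨p.base, p.pt ≫ f.space⟩
  map {p q} g := ⟨g.base, g.elt ≫ f.grp, by
    dsimp
    rw [← Category.assoc, ← f.smul_comp, g.smul_eq]⟩
  map_id p := Point.Hom.ext rfl (MonObj.one_comp _)
  map_comp {p q r} g h := Point.Hom.ext rfl (by
    change (g.elt * (g.base ≫ h.elt)) ≫ f.grp = (g.elt ≫ f.grp) * (g.base ≫ h.elt ≫ f.grp)
    rw [MonObj.mul_comp, Category.assoc])

variable (Y) in
/-- Presheaves of modules over the structure presheaf on the category of affine points of `Y`. -/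
abbrev PMod := PresheafOfModules.{0} (Y.O ⋙ forget₂ CommRingCat RingCat)

variable (Y) in
/-- A presheaf of modules `M` is cartesian if for every morphism `f` from an affine point
`y' ∈ Y(T')` to `y ∈ Y(T)`, the induced map `Γ(T') ⊗_{Γ(T)} M(y) ⟶ M(y')` is an isomorphism. -/
noncomputable def isCartesian : ObjectProperty Y.PMod := fun M =>
  ∀ ⦃p q : Y.Pointᵒᵖ⦄ (f : p ⟶ q),
    IsIso (((ModuleCat.extendRestrictScalarsAdj (Y.O.map f).hom).homEquiv
      (M.obj p) (M.obj q)).symm (M.map f))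

section

open SymComplex

lemma isIso_iff_isBaseChangeMap {R S : CommRingCat.{0}} (f : R ⟶ S) (M : ModuleCat.{0} R)
    (N : ModuleCat.{0} S) (g : M ⟶ (ModuleCat.restrictScalars f.hom).obj N) :
    IsIso (((ModuleCat.extendRestrictScalarsAdj f.hom).homEquiv M N).symm g) ↔
      IsBaseChangeMap ((ModuleCat.semilinearMapAddEquiv f.hom M N).symm g) := by
  rw [isIso_iff_coyoneda_map_bijective]
  have key : ∀ (Q : ModuleCat.{0} S) (k : N ⟶ Q),
      ((ModuleCat.extendRestrictScalarsAdj f.hom).homEquiv M Q)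
        (((ModuleCat.extendRestrictScalarsAdj f.hom).homEquiv M N).symm g ≫ k) =
        g ≫ (ModuleCat.restrictScalars f.hom).map k := by
    intro Q k
    rw [Adjunction.homEquiv_naturality_right, Equiv.apply_symm_apply]
  constructor
  · intro h Q _ _ l
    obtain ⟨k, hk⟩ := (h (ModuleCat.of S Q)).2
      (((ModuleCat.extendRestrictScalarsAdj f.hom).homEquiv M (ModuleCat.of S Q)).symm
        (ModuleCat.semilinearMapAddEquiv f.hom M (ModuleCat.of S Q) l))
    refine ⟨k.hom, fun m => ?_, fun k' hk' => ?_⟩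
    · have := key _ k
      dsimp only at hk
      rw [hk, Equiv.apply_symm_apply] at this
      exact (congrArg (fun t => t.hom m) this).symm
    · have : ModuleCat.ofHom k' = k := (h (ModuleCat.of S Q)).1 <| by
        refine ((ModuleCat.extendRestrictScalarsAdj f.hom).homEquiv M _).injective ?_
        refine Eq.trans ?_ (congrArg _ hk.symm)
        rw [key, Equiv.apply_symm_apply]
        ext m
        exact hk' m
      exact congrArg ModuleCat.Hom.hom this
  · intro h Q
    constructor
    · intro k k' e
      have h1 := key _ k
      have h2 := key _ k'
      rw [show _ ≫ k = _ ≫ k' from e, h2] at h1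
      ext1
      exact h.hom_ext fun m => (congrArg (fun t => t.hom m) h1).symm
    · intro l
      obtain ⟨k, hk, -⟩ := h Q ((ModuleCat.semilinearMapAddEquiv f.hom M Q).symm
        ((ModuleCat.extendRestrictScalarsAdj f.hom).homEquiv M Q l))
      refine ⟨ModuleCat.ofHom k,
        ((ModuleCat.extendRestrictScalarsAdj f.hom).homEquiv M _).injective ?_⟩
      refine (key _ _).trans ?_
      ext m
      exact hk m

/-- The semilinear restriction maps of a presheaf of modules. -/
noncomputable def resMap (M : Y.PMod) {p q : Y.Pointᵒᵖ} (f : p ⟶ q) :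
    (M.obj p : ModuleCat (Y.O.obj p)) →ₛₗ[(Y.O.map f).hom] (M.obj q : ModuleCat (Y.O.obj q)) :=
  (ModuleCat.semilinearMapAddEquiv (Y.O.map f).hom (M.obj p) (M.obj q)).symm (M.map f)

lemma isCartesian_iff (M : Y.PMod) :
    isCartesian Y M ↔ ∀ ⦃p q : Y.Pointᵒᵖ⦄ (f : p ⟶ q), IsBaseChangeMap (resMap M f) :=
  forall₃_congr fun _ _ _ => isIso_iff_isBaseChangeMap _ _ _ _

lemma resMap_tensor (M N : Y.PMod) {p q : Y.Pointᵒᵖ} (f : p ⟶ q) :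
    resMap (M ⊗ N) f = TensorProduct.map (resMap M f) (resMap N f) := by
  refine TensorProduct.ext' fun x y => ?_
  rfl

lemma isCartesian_tensor (M N : Y.PMod) (hM : isCartesian Y M) (hN : isCartesian Y N) :
    isCartesian Y (M ⊗ N) := by
  rw [isCartesian_iff] at *
  intro p q f
  rw [resMap_tensor]
  exact (hM f).tensor (hN f)

lemma isCartesian_unit : isCartesian Y (𝟙_ _) := by
  rw [isCartesian_iff]
  intro p q f Q _ _ h
  change (Y.O.obj p) →ₛₗ[(Y.O.map f).hom] Q at h
  refine ⟨LinearMap.toSpanSingleton (Y.O.obj q) Q (h 1), fun (m : Y.O.obj p) => ?_,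
    fun k hk => ?_⟩
  · change (Y.O.map f).hom m • h 1 = h m
    rw [← LinearMap.map_smulₛₗ, smul_eq_mul, mul_one]
  · refine LinearMap.ext_ring ?_
    rw [LinearMap.toSpanSingleton_apply, one_smul]
    refine Eq.trans ?_ (hk (1 : Y.O.obj p))
    exact congrArg k (map_one (Y.O.map f).hom).symm

instance : (isCartesian Y).IsMonoidal where
  prop_unit := isCartesian_unit
  prop_tensor := isCartesian_tensor

end

section Linear

variable (Y) in
/-- The structure of `ℂ`-algebra on the ring of functions of an affine point. -/
noncomputable def scalar (p : Y.Pointᵒᵖ) : ℂ →+* Y.O.obj p :=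
  ((Scheme.ΓSpecIso (CommRingCat.of ℂ)).inv ≫ Scheme.Γ.map p.unop.base.hom.op).hom

lemma map_scalar {p q : Y.Pointᵒᵖ} (f : p ⟶ q) (c : ℂ) :
    (Y.O.map f).hom (scalar Y p c) = scalar Y q c := by
  have h : Scheme.Γ.map p.unop.base.hom.op ≫ Y.O.map f = Scheme.Γ.map q.unop.base.hom.op := by
    rw [← Over.w f.unop.base, op_comp, Functor.map_comp]
    rfl
  rw [scalar, scalar, ← h]
  rfl

/-- The module of sections of a presheaf of modules over an affine point. -/
abbrev sec (M : Y.PMod) (p : Y.Pointᵒᵖ) : ModuleCat (Y.O.obj p) := M.obj p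

/-- The map on sections induced by a morphism of presheaves of modules. -/
abbrev secMap {M N : Y.PMod} (f : M ⟶ N) (p : Y.Pointᵒᵖ) : sec M p ⟶ sec N p := f.app p

noncomputable instance (M N : Y.PMod) : SMul ℂ (M ⟶ N) where
  smul c f :=
    { app p := scalar Y p c • secMap f p
      naturality {p q} g := by
        ext m
        have h1 : (f.app q).hom (M.map g m) = N.map g (f.app p m) :=
          PresheafOfModules.naturality_apply f g m
        change scalar Y q c • (secMap f q).hom (resMap M g m) =
          resMap N g (scalar Y p c • (secMap f p).hom m)
        rw [LinearMap.map_smulₛₗ, map_scalar]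
        exact congrArg _ h1 }

lemma secMap_smul {M N : Y.PMod} (c : ℂ) (f : M ⟶ N) (p : Y.Pointᵒᵖ) :
    secMap (c • f) p = scalar Y p c • secMap f p := rfl

lemma pmod_hom_ext {M N : Y.PMod} {f g : M ⟶ N} (h : ∀ p, secMap f p = secMap g p) : f = g :=
  PresheafOfModules.hom_ext h

noncomputable instance (M N : Y.PMod) : Module ℂ (M ⟶ N) where
  one_smul f := pmod_hom_ext fun p => by rw [secMap_smul, map_one, one_smul]
  mul_smul c d f := pmod_hom_ext fun p => by rw [secMap_smul, map_mul, mul_smul]; rfl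
  smul_zero c := pmod_hom_ext fun p => smul_zero (A := sec M p ⟶ sec N p) (scalar Y p c)
  smul_add c f g := pmod_hom_ext fun p =>
    smul_add (A := sec M p ⟶ sec N p) (scalar Y p c) (secMap f p) (secMap g p)
  add_smul c d f := pmod_hom_ext fun p => by rw [secMap_smul, map_add, add_smul]; rfl
  zero_smul f := pmod_hom_ext fun p => by rw [secMap_smul, map_zero, zero_smul]; rfl

noncomputable instance : Linear ℂ Y.PMod where
  smul_comp M N P c f g := pmod_hom_ext fun p =>
    Linear.smul_comp _ _ _ (scalar Y p c) (secMap f p) (secMap g p)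
  comp_smul M N P f c g := pmod_hom_ext fun p =>
    Linear.comp_smul _ _ _ (secMap f p) (scalar Y p c) (secMap g p)

instance : MonoidalPreadditive Y.PMod where
  whiskerLeft_zero {M N P} := by
    ext1 p
    exact MonoidalPreadditive.whiskerLeft_zero (C := ModuleCat (Y.O.obj p))
  zero_whiskerRight {M N P} := by
    ext1 p
    exact MonoidalPreadditive.zero_whiskerRight (C := ModuleCat (Y.O.obj p))
  whiskerLeft_add f g := by
    ext1 p
    exact MonoidalPreadditive.whiskerLeft_add (C := ModuleCat (Y.O.obj p)) (f.app p) (g.app p)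
  add_whiskerRight f g := by
    ext1 p
    exact MonoidalPreadditive.add_whiskerRight (C := ModuleCat (Y.O.obj p)) (f.app p) (g.app p)

instance : MonoidalLinear ℂ Y.PMod where
  whiskerLeft_smul M N P c f := by
    refine pmod_hom_ext fun p => ?_
    exact MonoidalLinear.whiskerLeft_smul (sec M p) (scalar Y p c) (secMap f p)
  smul_whiskerRight c M N f P := by
    refine pmod_hom_ext fun p => ?_
    exact MonoidalLinear.smul_whiskerRight (scalar Y p c) (secMap f p) (sec P p)

end Linear

variable (Y) in
/-- The category of quasi-coherent sheaves on a scheme `Y`, equivariant with respect to the group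
scheme `K` acting on it: an equivariant quasi-coherent sheaf is a compatible family of modules on
all affine schemes over the quotient of `Y` by `K`. Concretely it assigns a `Γ(T)`-module `M(y)`
to every morphism `y : T ⟶ Y` from an affine scheme, with compatible isomorphisms
`Γ(T') ⊗ M(y) ≅ M(k • f^*(y))` for all `f : T' ⟶ T` and `k ∈ K(T')`. -/
abbrev QCoh := (isCartesian Y).FullSubcategory

/-- Pullback of presheaves of modules along an equivariant morphism `f`: the value of the pullback
at an affine point `y` is the value of the given presheaf at `f(y)`. -/
noncomputable def Hom.pullbackPMod (f : Hom Y Z) : Z.PMod ⥤ Y.PMod :=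
  PresheafOfModules.pushforward₀OfCommRingCat f.points Z.O

noncomputable instance (f : Hom Y Z) : f.pullbackPMod.Monoidal :=
  inferInstanceAs (PresheafOfModules.pushforward₀OfCommRingCat f.points Z.O).Monoidal

/-- Pullback of equivariant quasi-coherent sheaves along an equivariant morphism. -/
noncomputable def Hom.pullback (f : Hom Y Z) : Z.QCoh ⥤ Y.QCoh :=
  (isCartesian Y).lift ((isCartesian Z).ι ⋙ f.pullbackPMod) fun M _ _ g =>
    M.property (f.points.op.map g)

open Functor.LaxMonoidal Functor.OplaxMonoidal in
noncomputable instance (f : Hom Y Z) : f.pullback.Monoidal :=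
  Functor.CoreMonoidal.toMonoidal
    { εIso := (isCartesian Y).isoMk (Functor.Monoidal.εIso f.pullbackPMod)
      μIso := fun M N => (isCartesian Y).isoMk (Functor.Monoidal.μIso f.pullbackPMod M.obj N.obj)
      μIso_hom_natural_left := fun g N => by
        ext1
        exact μ_natural_left f.pullbackPMod g.hom N.obj
      μIso_hom_natural_right := fun M g => by
        ext1
        exact μ_natural_right f.pullbackPMod M.obj g.hom
      associativity := fun M N P => by
        ext1
        exact Functor.LaxMonoidal.associativity f.pullbackPMod M.obj N.obj P.obj
      left_unitality := fun M => by
        ext1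
        exact Functor.LaxMonoidal.left_unitality f.pullbackPMod M.obj
      right_unitality := fun M => by
        ext1
        exact Functor.LaxMonoidal.right_unitality f.pullbackPMod M.obj }

noncomputable instance (f : Hom Y Z) : f.pullback.Braided where
  braided M N := by
    ext1
    refine pmod_hom_ext fun p => ?_
    exact ModuleCat.MonoidalCategory.tensor_ext
      (M₁ := sec M.obj (f.points.op.obj p)) (M₂ := sec N.obj (f.points.op.obj p)) fun _ _ => rfl

instance (f : Hom Y Z) : f.pullback.Additive where
  map_add := rfl

instance (f : Hom Y Z) : f.pullback.Linear ℂ where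
  map_smul _ _ := rfl

end ActedScheme

section

open scoped TensorProduct

namespace SymComplex

universe u

variable {R : Type u} [CommRing R] {V W : Type u} [AddCommGroup V] [Module R V] [AddCommGroup W]
  [Module R W]

lemma Total.map_eq_self {φ : R →+* R} (hφ : φ = RingHom.id R) (a : V →ₛₗ[φ] V) (b : W →ₛₗ[φ] W)
    (ha : ∀ v, a v = v) (hb : ∀ w, b w = w) (z : Total R V W) : Total.map a b z = z := by
  subst hφ
  obtain rfl : a = LinearMap.id := LinearMap.ext ha
  obtain rfl : b = LinearMap.id := LinearMap.ext hb
  exact Total.map_id z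

variable (R V W) in
/-- The components of the multiplication of `Λ(V) ⊗ Sym(W)`. -/
noncomputable def mulPart (p q r : ℤ) (h : p + q = r) :
    part R V W p →ₗ[R] part R V W q →ₗ[R] part R V W r :=
  LinearMap.mk₂ R (fun x y => ⟨x.1 * y.1, h ▸ part_mul_mem x.2 y.2⟩)
    (fun _ _ _ => Subtype.ext (add_mul _ _ _)) (fun _ _ _ => Subtype.ext (smul_mul_assoc _ _ _))
    (fun _ _ _ => Subtype.ext (mul_add _ _ _)) (fun _ _ _ => Subtype.ext (mul_smul_comm _ _ _))

/-- The components of the differential of `Λ(V) ⊗ Sym(W)`. -/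
noncomputable def diffPart (f : V →ₗ[R] W) (n m : ℤ) : part R V W n →ₗ[R] part R V W m :=
  if h : n + 1 = m then (diff f).restrict fun _ hz => diff_mem f h hz else 0

lemma diffPart_apply (f : V →ₗ[R] W) {n m : ℤ} (h : n + 1 = m) (z : part R V W n) :
    (diffPart f n m z : Total R V W) = diff f z := by
  rw [diffPart, dif_pos h]
  rfl

end SymComplex

namespace ActedScheme

open SymComplex

variable {Y Z : ActedScheme}

noncomputable def mkMap {M N : Y.PMod} (F : ∀ p, sec M p →ₗ[Y.O.obj p] sec N p)
    (h : ∀ ⦃p q : Y.Pointᵒᵖ⦄ (g : p ⟶ q) (m : sec M p), F q (resMap M g m) = resMap N g (F p m)) :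
    M ⟶ N where
  app p := ModuleCat.ofHom (F p)
  naturality g := by
    ext m
    exact h g m

lemma resMap_secMap {M N : Y.PMod} (f : M ⟶ N) {p q : Y.Pointᵒᵖ} (g : p ⟶ q) (m : sec M p) :
    resMap N g ((secMap f p).hom m) = (secMap f q).hom (resMap M g m) :=
  (PresheafOfModules.naturality_apply f g m).symm

noncomputable def mkPMod (M : ∀ p : Y.Pointᵒᵖ, ModuleCat.{0} (Y.O.obj p))
    (r : ∀ ⦃p q : Y.Pointᵒᵖ⦄ (g : p ⟶ q), M p →ₛₗ[(Y.O.map g).hom] M q)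
    (r_id : ∀ p m, r (𝟙 p) m = m)
    (r_comp : ∀ ⦃p q s : Y.Pointᵒᵖ⦄ (g : p ⟶ q) (h : q ⟶ s) m, r (g ≫ h) m = r h (r g m)) :
    Y.PMod where
  obj p := M p
  map g := ModuleCat.semilinearMapAddEquiv (Y.O.map g).hom _ _ (r g)
  map_id p := by
    ext m
    exact r_id p m
  map_comp g h := by
    ext m
    exact r_comp g h m

lemma resMap_id (M : Y.PMod) (p : Y.Pointᵒᵖ) (m : sec M p) : resMap M (𝟙 p) m = m :=
  congrArg (fun k => k.hom m) (M.map_id p)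

lemma resMap_comp (M : Y.PMod) {p q s : Y.Pointᵒᵖ} (g : p ⟶ q) (h : q ⟶ s) (m : sec M p) :
    resMap M (g ≫ h) m = resMap M h (resMap M g m) :=
  congrArg (fun k => k.hom m) (M.map_comp g h)

/-- The part of cohomological degree `n` of `Λ(V) ⊗ Sym(W)`, as a presheaf of modules. -/
noncomputable def symPMod (V W : Y.PMod) (n : ℤ) : Y.PMod :=
  mkPMod (fun p => ModuleCat.of (Y.O.obj p) (part (Y.O.obj p) (sec V p) (sec W p) n))
    (fun p q g => partMap (resMap V g) (resMap W g) n)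
    (fun p m => Subtype.ext (Total.map_eq_self (congrArg CommRingCat.Hom.hom (Y.O.map_id p)) _ _
      (resMap_id V p) (resMap_id W p) _))
    (fun p q s g h m => Subtype.ext (by
      have : RingHomCompTriple (Y.O.map g).hom (Y.O.map h).hom (Y.O.map (g ≫ h)).hom :=
        ⟨by rw [← CommRingCat.hom_comp, ← Functor.map_comp]⟩
      exact Total.map_comp _ _ _ _ _ _ (resMap_comp V g h) (resMap_comp W g h) _))

lemma resMap_symPMod (V W : Y.PMod) (n : ℤ) {p q : Y.Pointᵒᵖ} (g : p ⟶ q) :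
    resMap (symPMod V W n) g = partMap (resMap V g) (resMap W g) n := rfl

lemma isCartesian_symPMod {V W : Y.PMod} (hV : isCartesian Y V) (hW : isCartesian Y W) (n : ℤ) :
    isCartesian Y (symPMod V W n) :=
  (isCartesian_iff _).2 fun _ _ g => isBaseChangeMap_part ((isCartesian_iff _).1 hV g)
    ((isCartesian_iff _).1 hW g) n

/-- The components of the differential. -/
noncomputable def symDiff {V W : Y.PMod} (f : V ⟶ W) (n m : ℤ) :
    symPMod V W n ⟶ symPMod V W m :=
  mkMap (fun p => diffPart (secMap f p).hom n m) fun p q g z => by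
    by_cases h : n + 1 = m
    · refine Subtype.ext ?_
      refine (diffPart_apply _ h _).trans ?_
      refine (map_diff _ _ _ _ (fun v => resMap_secMap f g v) _).symm.trans ?_
      exact congrArg _ (diffPart_apply _ h _).symm
    · simp only [diffPart, dif_neg h]
      exact (map_zero _).symm

/-- The components of the multiplication. -/
noncomputable def symMul (V W : Y.PMod) (p q r : ℤ) (h : p + q = r) :
    symPMod V W p ⊗ symPMod V W q ⟶ symPMod V W r :=
  mkMap (fun t => TensorProduct.lift (mulPart (Y.O.obj t) (sec V t) (sec W t) p q r h))
    fun s t g z => by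
      have e : (TensorProduct.lift (mulPart (Y.O.obj t) (sec V t) (sec W t) p q r h)).comp
          (TensorProduct.map (resMap (symPMod V W p) g) (resMap (symPMod V W q) g)) =
          (resMap (symPMod V W r) g).comp
            (TensorProduct.lift (mulPart (Y.O.obj s) (sec V s) (sec W s) p q r h)) :=
        TensorProduct.ext' fun x y => Subtype.ext (Total.map_mul _ _ _ _).symm
      exact LinearMap.congr_fun e z

/-- The unit. -/
noncomputable def symOne (V W : Y.PMod) : 𝟙_ Y.PMod ⟶ symPMod V W 0 :=
  mkMap (fun t => LinearMap.toSpanSingleton (Y.O.obj t)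
      (part (Y.O.obj t) (sec V t) (sec W t) 0) ⟨1, one_mem_part⟩)
    fun s t g (z : Y.O.obj s) => by
      refine Subtype.ext ?_
      change (Y.O.map g).hom z • (1 : Total (Y.O.obj t) (sec V t) (sec W t)) =
        Total.map (resMap V g) (resMap W g) (z • 1)
      rw [LinearMap.map_smulₛₗ, Total.map_one]

/-- The inclusion of `V` in degree `-1`. -/
noncomputable def symInl (V W : Y.PMod) : V ⟶ symPMod V W (-1) :=
  mkMap (fun t => (inl (Y.O.obj t) (sec W t)).codRestrict _ inl_mem) fun _ _ _ _ =>
    Subtype.ext (Total.map_inl _ _ _).symm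

/-- The inclusion of `W` in degree `0`. -/
noncomputable def symInr (V W : Y.PMod) : W ⟶ symPMod V W 0 :=
  mkMap (fun t => (inr (Y.O.obj t) (sec V t)).codRestrict _ inr_mem) fun _ _ _ _ =>
    Subtype.ext (Total.map_inr _ _ _).symm

lemma tensor_hom_ext {M N P : Y.PMod} {f g : M ⊗ N ⟶ P}
    (h : ∀ (t) (x : sec M t) (y : sec N t),
      (secMap f t).hom (x ⊗ₜ[Y.O.obj t] y) = (secMap g t).hom (x ⊗ₜ[Y.O.obj t] y)) : f = g :=
  pmod_hom_ext fun t => ModuleCat.MonoidalCategory.tensor_ext (h t)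

lemma symDiff_comp {V W : Y.PMod} (f : V ⟶ W) (n m l : ℤ) (h : n + 1 = m) (h' : m + 1 = l) :
    symDiff f n m ≫ symDiff f m l = 0 := by
  refine pmod_hom_ext fun p => ?_
  ext z
  refine Subtype.ext ?_
  refine (diffPart_apply _ h' _).trans ?_
  refine (congrArg _ (diffPart_apply _ h _)).trans ?_
  exact diff_diff _ _

lemma symOne_mul (V W : Y.PMod) (p : ℤ) :
    symOne V W ▷ symPMod V W p ≫ symMul V W 0 p p (zero_add p) = (λ_ _).hom :=
  tensor_hom_ext fun t (x : Y.O.obj t) (y : part _ _ _ _) => Subtype.ext (by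
    change (x • (1 : Total (Y.O.obj t) (sec V t) (sec W t))) * y.1 = x • y.1
    rw [smul_mul_assoc, one_mul])

lemma symMul_one (V W : Y.PMod) (p : ℤ) :
    symPMod V W p ◁ symOne V W ≫ symMul V W p 0 p (add_zero p) = (ρ_ _).hom :=
  tensor_hom_ext fun t (y : part _ _ _ _) (x : Y.O.obj t) => Subtype.ext (by
    change y.1 * (x • (1 : Total (Y.O.obj t) (sec V t) (sec W t))) = x • y.1
    rw [mul_smul_comm, mul_one])

lemma symMul_assoc (V W : Y.PMod) (p q r pq qr pqr : ℤ) (hpq : p + q = pq) (hqr : q + r = qr)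
    (h : pq + r = pqr) (h' : p + qr = pqr) :
    symMul V W p q pq hpq ▷ symPMod V W r ≫ symMul V W pq r pqr h =
      (α_ _ _ _).hom ≫ symPMod V W p ◁ symMul V W q r qr hqr ≫ symMul V W p qr pqr h' :=
  pmod_hom_ext fun _ => ModuleCat.MonoidalCategory.tensor_ext₃' fun _ _ _ =>
    Subtype.ext (mul_assoc _ _ _)

lemma symMul_leibniz {V W : Y.PMod} (f : V ⟶ W) (p q r p' q' r' : ℤ) (h : p + q = r)
    (hp : p + 1 = p') (hq : q + 1 = q') (hr : r + 1 = r') :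
    symMul V W p q r h ≫ symDiff f r r' =
      symDiff f p p' ▷ symPMod V W q ≫ symMul V W p' q r' (by omega) +
        p.negOnePow • (symPMod V W p ◁ symDiff f q q' ≫ symMul V W p q' r' (by omega)) := by
  refine tensor_hom_ext fun _ (x : part _ _ _ _) (y : part _ _ _ _) => Subtype.ext ?_
  have h1 := diff_leibniz (secMap f _).hom x.2 y.1
  rw [← diffPart_apply _ hp x, ← diffPart_apply _ hq y] at h1
  refine (diffPart_apply _ hr _).trans (h1.trans ?_)
  rcases Int.units_eq_one_or p.negOnePow with e | e
  · rw [e, one_smul, one_smul]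
    rfl
  · rw [e, Units.neg_smul, Units.neg_smul, one_smul, one_smul]
    rfl

/-- The complex underlying the symmetric algebra of the complex `V ⟶ W`. -/
@[simps]
noncomputable def symCx {V W : Y.QCoh} (f : V ⟶ W) : CochainComplex Y.QCoh ℤ where
  X n := ⟨symPMod V.obj W.obj n, isCartesian_symPMod V.property W.property n⟩
  d n m := ObjectProperty.homMk (symDiff f.hom n m)
  shape n m h := by
    ext1
    refine pmod_hom_ext fun p => ?_
    ext1
    exact dif_neg h
  d_comp_d' n m l h h' := by
    ext1
    exact symDiff_comp f.hom n m l h h'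

lemma qcoh_leibniz {A B C A' B' C' : Y.QCoh} {m : A ⊗ B ⟶ C} {d : C ⟶ C'} {a : A ⟶ A'}
    {b : B ⟶ B'} {m₁ : A' ⊗ B ⟶ C'} {m₂ : A ⊗ B' ⟶ C'} {s : ℤˣ}
    (h : m.hom ≫ d.hom = a.hom ▷ B.obj ≫ m₁.hom + s • (A.obj ◁ b.hom ≫ m₂.hom)) :
    m ≫ d = a ▷ B ≫ m₁ + s • (A ◁ b ≫ m₂) := by
  rcases Int.units_eq_one_or s with rfl | rfl
  · rw [one_smul] at h ⊢
    ext1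
    exact h
  · rw [Units.neg_smul, one_smul] at h ⊢
    ext1
    exact h

/-- The symmetric algebra of the complex `V ⟶ W`, with `V` in cohomological degree `-1` and `W` in
degree `0`. -/
noncomputable def Sym {V W : Y.QCoh} (f : V ⟶ W) : DGAlgebra Y.QCoh where
  cx := symCx f
  one := ObjectProperty.homMk (symOne _ _)
  mul p q r h := ObjectProperty.homMk (symMul _ _ p q r h)
  one_mul p := by
    ext1
    exact symOne_mul _ _ p
  mul_one p := by
    ext1
    exact symMul_one _ _ p
  mul_assoc p q r pq qr pqr hpq hqr h h' := by
    ext1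
    exact symMul_assoc _ _ p q r pq qr pqr hpq hqr h h'
  leibniz p q r p' q' r' h hp hq hr :=
    qcoh_leibniz (symMul_leibniz f.hom p q r p' q' r' h hp hq hr)

/-- The inclusion of `V` in the part of degree `-1` of the symmetric algebra. -/
noncomputable def inclV {V W : Y.QCoh} (f : V ⟶ W) : V ⟶ (Sym f).cx.X (-1) :=
  ObjectProperty.homMk (symInl _ _)

/-- The inclusion of `W` in the part of degree `0` of the symmetric algebra. -/
noncomputable def inclW {V W : Y.QCoh} (f : V ⟶ W) : W ⟶ (Sym f).cx.X 0 :=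
  ObjectProperty.homMk (symInr _ _)

end ActedScheme

end

section

universe v u

variable {C : Type u} [Category.{v} C] [CartesianMonoidalCategory C] [BraidedCategory C]

/-- An action of a monoid object given by a morphism which satisfies the axioms of an action on
generalized points. -/
@[reducible]
def modObjOfPoints {M X : C} [MonObj M] (s : M ⊗ X ⟶ X)
    (h1 : ∀ (Z : C) (x : Z ⟶ X), lift (1 : Z ⟶ M) x ≫ s = x)
    (h2 : ∀ (Z : C) (m n : Z ⟶ M) (x : Z ⟶ X),
      lift (m * n) x ≫ s = lift m (lift n x ≫ s) ≫ s) : ModObj M X where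
  smul := s
  one_smul := by
    have h := h1 (𝟙_ C ⊗ X) (snd _ _)
    have e : lift (1 : 𝟙_ C ⊗ X ⟶ M) (snd _ _) = η[M] ▷ X := by
      ext
      · rw [lift_fst, whiskerRight_fst, Hom.one_def]
        exact congrArg (· ≫ η[M]) (toUnit_unique _ _)
      · simp
    rw [e] at h
    exact h.trans (leftUnitor_hom X).symm
  mul_smul := by
    have h := h2 ((M ⊗ M) ⊗ X) (fst _ _ ≫ fst _ _) (fst _ _ ≫ snd _ _) (snd _ _)
    have e1 : lift ((fst (M ⊗ M) X ≫ fst _ _) * (fst _ _ ≫ snd _ _)) (snd _ _) = μ[M] ▷ X := by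
      ext
      · simp [Hom.mul_def]
      · simp
    have e2 : lift (fst (M ⊗ M) X ≫ fst _ _) (lift (fst (M ⊗ M) X ≫ snd _ _) (snd _ _) ≫ s) =
        (α_ M M X).hom ≫ M ◁ s := by
      ext
      · simp
      · simp only [lift_snd, Category.assoc, whiskerLeft_snd]
        rw [← Category.assoc (α_ M M X).hom]
        congr 1
        ext <;> simp
    rw [e1, e2, Category.assoc] at h
    exact h

variable {G H : C} [GrpObj G] [GrpObj H] (ρ : H ⟶ G) [IsMonHom ρ] (X : C) [ModObj H X]

/-- The action of `G × H` on `G × X` given by `(g, h) • (g', x) = (g g' ρ(h)⁻¹, h x)`. -/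
@[reducible]
def inductionAction : ModObj (G ⊗ H) (G ⊗ X) :=
  modObjOfPoints
    (lift
      ((fst (G ⊗ H) (G ⊗ X) ≫ fst G H) * (snd (G ⊗ H) (G ⊗ X) ≫ fst G X) *
        (fst (G ⊗ H) (G ⊗ X) ≫ snd G H ≫ ρ)⁻¹)
      ((fst (G ⊗ H) (G ⊗ X) ≫ snd G H) • (snd (G ⊗ H) (G ⊗ X) ≫ snd G X)))
    (fun Z x => by
      have e1 : (1 : Z ⟶ G ⊗ H) ≫ fst G H = 1 := MonObj.one_comp _
      have e2 : (1 : Z ⟶ G ⊗ H) ≫ snd G H = 1 := MonObj.one_comp _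
      rw [comp_lift, MonObj.comp_mul, MonObj.comp_mul, GrpObj.comp_inv, ModObj.comp_smul]
      simp only [lift_fst_assoc, lift_snd_assoc, reassoc_of% e2, e1, e2, MonObj.one_comp, inv_one,
        _root_.mul_one, _root_.one_mul, one_smul]
      ext <;> simp)
    (fun Z m n x => by
      have e1 : (m * n) ≫ fst G H = (m ≫ fst G H) * (n ≫ fst G H) := MonObj.mul_comp _ _ _
      have e2 : (m * n) ≫ snd G H = (m ≫ snd G H) * (n ≫ snd G H) := MonObj.mul_comp _ _ _
      simp only [comp_lift, MonObj.comp_mul, GrpObj.comp_inv, ModObj.comp_smul]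
      simp only [lift_fst_assoc, lift_snd_assoc, reassoc_of% e2, e1, e2, MonObj.mul_comp, lift_fst,
        lift_snd, Category.assoc, mul_inv_rev, _root_.mul_assoc, mul_smul])

lemma inductionAction_smul {T : C} (k : T ⟶ G ⊗ H) (z : T ⟶ G ⊗ X) :
    let _ := inductionAction ρ X
    k • z = lift ((k ≫ fst G H) * (z ≫ fst G X) * (k ≫ snd G H ≫ ρ)⁻¹)
      ((k ≫ snd G H) • (z ≫ snd G X)) := by
  let _ := inductionAction ρ X
  change lift k z ≫ lift _ _ = _
  simp only [comp_lift, MonObj.comp_mul, GrpObj.comp_inv, ModObj.comp_smul, lift_fst_assoc,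
    lift_snd_assoc]

end

section

variable {G H : Over SpecC} [GrpObj G] [GrpObj H] (ρ : H ⟶ G) [IsMonHom ρ]
  (X : Over SpecC) [ModObj H X]

/-- The scheme `G × X` with the action `(g, h) • (g', x) = (g g' ρ(h)⁻¹, h x)` of `G × H`. -/
noncomputable abbrev inductionSpace : ActedScheme where
  grp := G ⊗ H
  space := G ⊗ X
  modObj := inductionAction ρ X

/-- The projection `G × X ⟶ X`, which is equivariant with respect to `G × H ⟶ H`. -/
noncomputable def inductionPr : (inductionSpace ρ X).Hom ⟨H, X⟩ where
  grp := snd G H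
  space := snd G X
  smul_comp T k y := by
    rw [inductionAction_smul, lift_snd]

variable {X}

/-- For an action of `H` on `X` and a homomorphism `ρ : H ⟶ G`, the data of a scheme `X'` with an
action of `G` and of a morphism `π : G × X ⟶ X'` which exhibits `X'` as the induced space
`G ×^H X = (G × X) / H`: the morphism `π` is `G`-equivariant and `H`-invariant, it is flat, surjective
and locally of finite presentation, and any two points of `G × X` with the same image
differ by a unique point of `H`. In other words, `π` is a principal `H`-bundle. -/
structure IsInducedSpace {X' : Over SpecC} [ModObj G X'] (π : G ⊗ X ⟶ X') : Prop where
  smul_comp (T : Over SpecC) (g : T ⟶ G) (z : T ⟶ G ⊗ X) :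
    lift (g * (z ≫ fst G X)) (z ≫ snd G X) ≫ π = g • (z ≫ π)
  smul_comp_eq (T : Over SpecC) (h : T ⟶ H) (z : T ⟶ G ⊗ X) :
    lift ((z ≫ fst G X) * (h ≫ ρ)⁻¹) (h • (z ≫ snd G X)) ≫ π = z ≫ π
  flat : Flat π.left
  surjective : Surjective π.left
  locallyOfFinitePresentation : LocallyOfFinitePresentation π.left
  existsUnique_smul (T : Over SpecC) (z z' : T ⟶ G ⊗ X) (e : z ≫ π = z' ≫ π) :
    ∃! h : T ⟶ H, lift ((z ≫ fst G X) * (h ≫ ρ)⁻¹) (h • (z ≫ snd G X)) = z'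

variable {ρ}

/-- The quotient morphism `G × X ⟶ G ×^H X`, which is equivariant with respect to
`G × H ⟶ G`. -/
noncomputable def IsInducedSpace.hom {X' : Over SpecC} [ModObj G X'] {π : G ⊗ X ⟶ X'}
    (hπ : IsInducedSpace ρ π) : (inductionSpace ρ X).Hom ⟨G, X'⟩ where
  grp := fst G H
  space := π
  smul_comp T k y := by
    have e := hπ.smul_comp T (k ≫ fst G H)
      (lift ((y ≫ fst G X) * (k ≫ snd G H ≫ ρ)⁻¹) ((k ≫ snd G H) • (y ≫ snd G X)))
    rw [lift_fst, lift_snd, ← _root_.mul_assoc, ← Category.assoc k, hπ.smul_comp_eq T] at e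
    rw [inductionAction_smul]
    exact e

end

-- An equivariant quasi-coherent sheaf on `Y` is a cartesian module on the category `Y.Point` of
-- affine schemes over the quotient prestack of `Y` by its group. The quotient of `G × X` by `G × H`
-- can be formed in two ways: dividing by `G` first gives `X` with its `H`-action, dividing by `H`
-- first gives `X'` with its `G`-action. Both equivalences `A` and `B` are therefore descent
-- statements, and they are instances of one theorem, `Hom.IsSieve.isEquivalence_pullback`.
--
-- Its hypotheses on an equivariant morphism are these. The functor on affine points is fully
-- faithful and its image is, up to isomorphism, closed under passing to sources of morphisms
-- (`Hom.IsSieve`); every affine point of the target admits a faithfully flat map from a point in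
-- the image (`Hom.IsCovering`). For `pr` the first condition holds because the `G`-component of a
-- group element can be solved for, and for `π` it holds because two points with equal image differ
-- by a unique point of `H`. The second condition is trivial for `pr`, by the unit section of `G`;
-- for `π` it follows from `π` being flat, surjective and locally of finite presentation.
--
-- A cartesian module on such a sieve is extended to all points `b` by its compatible families on
-- the sieve over `b`. That this is again cartesian, and inverse to restriction, is faithfully flat
-- descent for modules. The engine is `isBaseChangeMap_equalizer`: after base change along the flat
-- map, the equalizer of descent data becomes a split fork, hence is computed by its splitting. All
-- of this is phrased with semilinear maps having the universal property of base change
-- (`IsBaseChangeMap`), so that no tensor product has to be chosen.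
--
-- For the second claim, `Ind` is `A` followed by a quasi-inverse of `B`. A quasi-inverse of a
-- monoidal functor is monoidal as a right adjoint, and `B ∘ Ind ≅ A` comes from the counit. Since
-- `Λ(V) ⊗ Sym(W)` is built section by section, its pullback depends only on the pullbacks of `V`,
-- `W` and the map between them. So the isomorphism `B ∘ Ind ≅ A` on `V` and `W` induces an
-- isomorphism of dg-algebras on `G × X`, which lifts through the fully faithful `B` to `θ`
-- (`exists_sym_iso`). Finally a linear monoidal equivalence transports dg-modules together with all
-- their graded linear maps, and restriction along the isomorphism `θ⁻¹` changes only the action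
-- (`DGModule.isDGEquivalence_map`, `DGModule.isDGEquivalence_restrictScalars`).

section

universe w

open CochainComplex CochainComplex.HomComplex

-- Equivalences of dg-categories: composition, and change of rings along isomorphisms

namespace DGFunctor

variable {k : Type w} [CommRing k] {𝒞 𝒟 ℰ : Type*} [DGCategory k 𝒞] [DGCategory k 𝒟]
  [DGCategory k ℰ]

lemma d_comp_eq_zero {X Y Z : 𝒞} {u : DGCategory.Hom k X Y 0} {v : DGCategory.Hom k Y Z 0}
    (hu : DGCategory.d 0 1 (zero_add 1) u = 0) (hv : DGCategory.d 0 1 (zero_add 1) v = 0) :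
    DGCategory.d 0 1 (zero_add 1) (DGCategory.comp 0 0 0 (zero_add 0) u v) = 0 := by
  rw [DGCategory.leibniz 0 0 0 1 1 1 (zero_add 0) (zero_add 1) (zero_add 1) (zero_add 1), hu, hv]
  simp

lemma comp_comp_eq_id {X Y Z : 𝒞} {u : DGCategory.Hom k X Y 0} {v : DGCategory.Hom k Y X 0}
    {u' : DGCategory.Hom k Y Z 0} {v' : DGCategory.Hom k Z Y 0}
    (h : DGCategory.comp 0 0 0 (zero_add 0) u v = DGCategory.id X)
    (h' : DGCategory.comp 0 0 0 (zero_add 0) u' v' = DGCategory.id Y) :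
    DGCategory.comp 0 0 0 (zero_add 0) (DGCategory.comp 0 0 0 (zero_add 0) u u')
      (DGCategory.comp 0 0 0 (zero_add 0) v' v) = DGCategory.id X := by
  rw [DGCategory.assoc 0 0 0 0 0 0 (zero_add 0) (zero_add 0) (zero_add 0) (zero_add 0),
    ← DGCategory.assoc 0 0 0 0 0 0 (zero_add 0) (zero_add 0) (zero_add 0) (zero_add 0) u', h',
    DGCategory.id_comp, h]

/-- Equivalences of dg-categories are stable under composition. -/
lemma IsDGEquivalence.comp {F : DGFunctor k 𝒞 𝒟} {G : DGFunctor k 𝒟 ℰ} (hF : F.IsDGEquivalence)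
    (hG : G.IsDGEquivalence) : (F.comp G).IsDGEquivalence := by
  refine ⟨fun X Y n => (hG.1 _ _ n).comp (hF.1 X Y n), fun Z => ?_⟩
  obtain ⟨Y, u, v, hu, hv, huv, hvu⟩ := hG.2 Z
  obtain ⟨X, u', v', hu', hv', huv', hvu'⟩ := hF.2 Y
  refine ⟨X, DGCategory.comp 0 0 0 (zero_add 0) (G.map 0 u') u,
    DGCategory.comp 0 0 0 (zero_add 0) v (G.map 0 v'), d_comp_eq_zero ?_ hu,
    d_comp_eq_zero hv ?_, comp_comp_eq_id ?_ huv, comp_comp_eq_id hvu ?_⟩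
  · exact (G.map_d 0 1 (zero_add 1) u').symm.trans (by rw [hu', map_zero]; rfl)
  · exact (G.map_d 0 1 (zero_add 1) v').symm.trans (by rw [hv', map_zero]; rfl)
  · exact (G.map_comp 0 0 0 (zero_add 0) u' v').symm.trans (by rw [huv', G.map_id]; rfl)
  · exact (G.map_comp 0 0 0 (zero_add 0) v' u').symm.trans (by rw [hvu', G.map_id])

end DGFunctor

namespace DGModule

universe v u

variable {C : Type u} [Category.{v} C] [Preadditive C] [MonoidalCategory C]
  (k : Type w) [CommRing k] [Linear k C] [MonoidalPreadditive C] [MonoidalLinear k C]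

/-- Dg-modules whose underlying complexes are isomorphic compatibly with the actions are
isomorphic in the dg-category of dg-modules. -/
lemma exists_iso {A : DGAlgebra C} {M N : DGModule A} (e : M.cx ≅ N.cx)
    (he : ∀ (p i j : ℤ) (h : p + i = j),
      M.act p i j h ≫ e.hom.f j = A.cx.X p ◁ e.hom.f i ≫ N.act p i j h) :
    ∃ (u : DGCategory.Hom k M N 0) (v : DGCategory.Hom k N M 0),
      DGCategory.d 0 1 (zero_add 1) u = 0 ∧ DGCategory.d 0 1 (zero_add 1) v = 0 ∧
      DGCategory.comp 0 0 0 (zero_add 0) u v = DGCategory.id M ∧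
      DGCategory.comp 0 0 0 (zero_add 0) v u = DGCategory.id N := by
  have he' : ∀ (p i j : ℤ) (h : p + i = j),
      N.act p i j h ≫ e.inv.f j = A.cx.X p ◁ e.inv.f i ≫ M.act p i j h := by
    intro p i j h
    have h1 : e.hom.f j ≫ e.inv.f j = 𝟙 _ := by
      rw [← HomologicalComplex.comp_f, e.hom_inv_id, HomologicalComplex.id_f]
    have h2 : e.inv.f i ≫ e.hom.f i = 𝟙 _ := by
      rw [← HomologicalComplex.comp_f, e.inv_hom_id, HomologicalComplex.id_f]
    rw [← Category.comp_id (M.act p i j h), ← h1, reassoc_of% (he p i j h),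
      ← MonoidalCategory.whiskerLeft_comp_assoc, h2, MonoidalCategory.whiskerLeft_id,
      Category.id_comp]
  have mem : ∀ {M N : DGModule A} (f : M.cx ⟶ N.cx) (_ : ∀ (p i j : ℤ) (h : p + i = j),
      M.act p i j h ≫ f.f j = A.cx.X p ◁ f.f i ≫ N.act p i j h),
      Cochain.ofHom f ∈ linearCochains k M N 0 := by
    intro M N f hf p i j i' j' h hi hj
    obtain rfl : i = i' := by omega
    obtain rfl : j = j' := by omega
    simp [hf]
  refine ⟨⟨_, mem e.hom he⟩, ⟨_, mem e.inv he'⟩, Subtype.ext (δ_ofHom _), Subtype.ext (δ_ofHom _),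
    Subtype.ext ?_, Subtype.ext ?_⟩
  · refine (Cochain.ofHom_comp e.hom e.inv).symm.trans ?_
    rw [e.hom_inv_id]
    rfl
  · refine (Cochain.ofHom_comp e.inv e.hom).symm.trans ?_
    rw [e.inv_hom_id]
    rfl

-- Precomposing with `g ▷ X` cancels `f`, because `g` is a section of `f`. It serves to recover
-- linearity over a dg-algebra from linearity over an isomorphic one.
omit [MonoidalPreadditive C] in
lemma hom_linear_of_iso {P Q X X' Y Y' : C} (f : P ⟶ Q) (g : Q ⟶ P) (h : g ≫ f = 𝟙 Q)
    (a : Q ⊗ X ⟶ Y) (φ : X ⟶ X') (ψ : Y ⟶ Y') (b : Q ⊗ X' ⟶ Y') (s : ℤˣ)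
    (e : (f ▷ X ≫ a) ≫ ψ = s • (P ◁ φ ≫ f ▷ X' ≫ b)) : a ≫ ψ = s • (Q ◁ φ ≫ b) := by
  have e' := congrArg (g ▷ X ≫ ·) e
  simp only [Category.assoc, Units.smul_def, Preadditive.comp_zsmul, ← whisker_exchange_assoc,
    ← comp_whiskerRight_assoc, h, id_whiskerRight, Category.id_comp] at e'
  simpa only [Units.smul_def, Category.assoc, ← comp_whiskerRight_assoc, h, id_whiskerRight, Category.id_comp,
    whisker_exchange_assoc] using e'

/-- Restriction of scalars along an isomorphism of dg-algebras is an equivalence of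
dg-categories. -/
lemma isDGEquivalence_restrictScalars {A B : DGAlgebra C} (θ : A ≅ B) :
    (restrictScalars k θ.hom).IsDGEquivalence := by
  have h : ∀ p, θ.inv.hom.f p ≫ θ.hom.hom.f p = 𝟙 _ := fun p =>
    congrArg (fun t => t.hom.f p) θ.inv_hom_id
  have h' : ∀ p, θ.hom.hom.f p ≫ θ.inv.hom.f p = 𝟙 _ := fun p =>
    congrArg (fun t => t.hom.f p) θ.hom_inv_id
  refine ⟨fun M N n => ⟨fun φ ψ e => Subtype.ext (Subtype.ext_iff.1 e :), fun φ =>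
    ⟨⟨φ.1, fun p i j i' j' hj hi hj' => ?_⟩, rfl⟩⟩, fun Z => ⟨restrict θ.inv Z, ?_⟩⟩
  · obtain ⟨φ, hφ⟩ := φ
    change Cochain M.cx N.cx n at φ
    have e : (θ.hom.hom.f p ▷ M.cx.X i ≫ M.act p i j hj) ≫ φ.v j j' hj' =
        (n * p).negOnePow • (A.cx.X p ◁ φ.v i i' hi ≫ θ.hom.hom.f p ▷ N.cx.X i' ≫
          N.act p i' j' (by omega)) := hφ p i j i' j' hj hi hj'
    exact hom_linear_of_iso _ _ (h p) _ _ _ _ _ e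
  -- The preimage of `Z` is its restriction along `θ⁻¹`. Restricting back leaves the complex of `Z`
  -- untouched and changes the action by `θ` followed by `θ⁻¹`, which is the identity.
  · refine exists_iso k (M := restrict θ.hom (restrict θ.inv Z)) (Iso.refl Z.cx) fun p i j hj => ?_
    change (θ.hom.hom.f p ▷ Z.cx.X i ≫ θ.inv.hom.f p ▷ Z.cx.X i ≫ Z.act p i j hj) ≫ 𝟙 _ =
      A.cx.X p ◁ 𝟙 _ ≫ Z.act p i j hj
    rw [Category.comp_id, ← comp_whiskerRight_assoc, h', id_whiskerRight, Category.id_comp,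
      MonoidalCategory.whiskerLeft_id, Category.id_comp]

end DGModule

-- Transport of dg-modules along a monoidal equivalence

section

universe v u

variable {C : Type u} [Category.{v} C] [MonoidalCategory C] {D : Type*} [Category* D]
  [MonoidalCategory D] (F : C ⥤ D) [F.Monoidal]

open Functor Functor.LaxMonoidal Functor.Monoidal

/-- The action `a` upstairs is defined so that its image under `F` is the given action `n`
conjugated by the chosen isomorphisms. As `F` is faithful and its structure maps are invertible,
each module axiom may be tested after applying `F` and precomposing with `μ` (here also with `ε`),
where it reduces to the axiom for `n`. The lemmas `mul_act_of_map` and `leibniz_of_map` follow the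
same pattern. -/
lemma one_act_of_map [F.Faithful] {A X : C} {Y : D} (e : F.obj X ≅ Y) (o : 𝟙_ C ⟶ A)
    (n : F.obj A ⊗ Y ⟶ Y) (a : A ⊗ X ⟶ X)
    (ha : LaxMonoidal.μ F A X ≫ F.map a = F.obj A ◁ e.hom ≫ n ≫ e.inv)
    (h : (ε F ≫ F.map o) ▷ Y ≫ n = (λ_ Y).hom) : o ▷ X ≫ a = (λ_ X).hom := by
  apply F.map_injective
  rw [← cancel_epi (LaxMonoidal.μ F _ _), ← cancel_epi (ε F ▷ F.obj X),
    ← LaxMonoidal.left_unitality, F.map_comp, ← μ_natural_left_assoc, ha,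
    ← comp_whiskerRight_assoc, ← whisker_exchange_assoc, reassoc_of% h,
    leftUnitor_naturality_assoc, Iso.hom_inv_id, Category.comp_id]

lemma mul_act_of_map [F.Faithful] {P Q PQ X X' X'' : C} {Y Y' Y'' : D} (e : F.obj X ≅ Y)
    (e' : F.obj X' ≅ Y') (e'' : F.obj X'' ≅ Y'') (m : P ⊗ Q ⟶ PQ) (n : F.obj PQ ⊗ Y ⟶ Y'')
    (n' : F.obj Q ⊗ Y ⟶ Y') (n'' : F.obj P ⊗ Y' ⟶ Y'') (a : PQ ⊗ X ⟶ X'') (a' : Q ⊗ X ⟶ X')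
    (a'' : P ⊗ X' ⟶ X'')
    (ha : LaxMonoidal.μ F PQ X ≫ F.map a = F.obj PQ ◁ e.hom ≫ n ≫ e''.inv)
    (ha' : LaxMonoidal.μ F Q X ≫ F.map a' = F.obj Q ◁ e.hom ≫ n' ≫ e'.inv)
    (ha'' : LaxMonoidal.μ F P X' ≫ F.map a'' = F.obj P ◁ e'.hom ≫ n'' ≫ e''.inv)
    (h : (LaxMonoidal.μ F P Q ≫ F.map m) ▷ Y ≫ n =
      (α_ (F.obj P) (F.obj Q) Y).hom ≫ F.obj P ◁ n' ≫ n'') :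
    m ▷ X ≫ a = (α_ P Q X).hom ≫ P ◁ a' ≫ a'' := by
  apply F.map_injective
  rw [← cancel_epi (LaxMonoidal.μ F _ _), ← cancel_epi (LaxMonoidal.μ F _ _ ▷ F.obj X),
    F.map_comp, F.map_comp, F.map_comp, ← μ_natural_left_assoc, ha,
    LaxMonoidal.associativity_assoc, ← μ_natural_right_assoc, ha'',
    ← comp_whiskerRight_assoc, ← whisker_exchange_assoc, reassoc_of% h,
    ← MonoidalCategory.whiskerLeft_comp_assoc, ha']
  simp

variable [Preadditive C] [Preadditive D] [F.Additive]

lemma leibniz_of_map [F.Faithful] {P P' X X' Z Z' : C} {Y Y' T T' : D} (e : F.obj X ≅ Y)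
    (e' : F.obj X' ≅ Y') (u : F.obj Z ≅ T) (u' : F.obj Z' ≅ T') (p : P ⟶ P') (x : X ⟶ X')
    (y : Y ⟶ Y') (z : Z ⟶ Z') (t : T ⟶ T') (hx : F.map x = e.hom ≫ y ≫ e'.inv)
    (hz : F.map z = u.hom ≫ t ≫ u'.inv)
    (n : F.obj P ⊗ Y ⟶ T) (n₁ : F.obj P' ⊗ Y ⟶ T') (n₂ : F.obj P ⊗ Y' ⟶ T')
    (a : P ⊗ X ⟶ Z) (a₁ : P' ⊗ X ⟶ Z') (a₂ : P ⊗ X' ⟶ Z')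
    (ha : LaxMonoidal.μ F P X ≫ F.map a = F.obj P ◁ e.hom ≫ n ≫ u.inv)
    (ha₁ : LaxMonoidal.μ F P' X ≫ F.map a₁ = F.obj P' ◁ e.hom ≫ n₁ ≫ u'.inv)
    (ha₂ : LaxMonoidal.μ F P X' ≫ F.map a₂ = F.obj P ◁ e'.hom ≫ n₂ ≫ u'.inv) (s : ℤˣ)
    (h : n ≫ t = F.map p ▷ Y ≫ n₁ + s • (F.obj P ◁ y ≫ n₂)) :
    a ≫ z = p ▷ X ≫ a₁ + s • (P ◁ x ≫ a₂) := by
  apply F.map_injective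
  rw [← cancel_epi (LaxMonoidal.μ F _ _), F.map_comp, reassoc_of% ha, hz,
    Iso.inv_hom_id_assoc, reassoc_of% h, F.map_add, Units.smul_def, Units.smul_def, F.map_zsmul,
    F.map_comp, F.map_comp, Preadditive.comp_add, Preadditive.comp_zsmul, ← μ_natural_left_assoc,
    ← μ_natural_right_assoc, ha₁, ha₂, hx, ← whisker_exchange_assoc]
  simp

/-- The converse of `lax_linear`: graded linearity is reflected by a faithful monoidal functor
because `μ` can be cancelled. This is what makes the induced dg-functor full. -/
lemma linear_of_map [F.Faithful] {P X X' Z Z' : C} (x : X ⟶ X') (z : Z ⟶ Z') (a : P ⊗ X ⟶ Z)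
    (a' : P ⊗ X' ⟶ Z') (s : ℤˣ) (h : (LaxMonoidal.μ F P X ≫ F.map a) ≫ F.map z =
      s • (F.obj P ◁ F.map x ≫ LaxMonoidal.μ F P X' ≫ F.map a')) :
    a ≫ z = s • (P ◁ x ≫ a') := by
  apply F.map_injective
  rw [← cancel_epi (LaxMonoidal.μ F _ _), F.map_comp, ← Category.assoc, h, Units.smul_def,
    Units.smul_def, F.map_zsmul, Preadditive.comp_zsmul, F.map_comp, μ_natural_right_assoc]

/-- A dg-module over the image of a dg-algebra under an equivalence of monoidal categories is
isomorphic to the image of a dg-module. -/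
lemma DGModule.exists_map_iso (k : Type w) [CommRing k] [Linear k C] [Linear k D]
    [MonoidalPreadditive C] [MonoidalPreadditive D] [MonoidalLinear k C] [MonoidalLinear k D]
    [F.Linear k] [F.IsEquivalence] (A : DGAlgebra C) (N : DGModule (A.map F)) :
    ∃ (M : DGModule A) (e : ((DGModule.map F k A).obj M).cx ≅ N.cx),
      ∀ (p i j : ℤ) (h : p + i = j), ((DGModule.map F k A).obj M).act p i j h ≫ e.hom.f j =
        F.obj (A.cx.X p) ◁ e.hom.f i ≫ N.act p i j h := by
  -- Essential surjectivity is used degree by degree, with arbitrary choices; fullness then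
  -- transports the differentials and the action.
  let X : ℤ → C := fun i => F.objPreimage (N.cx.X i)
  let e : ∀ i, F.obj (X i) ≅ N.cx.X i := fun i => F.objObjPreimageIso (N.cx.X i)
  let d : ∀ i j, X i ⟶ X j := fun i j => F.preimage ((e i).hom ≫ N.cx.d i j ≫ (e j).inv)
  have hd : ∀ i j, F.map (d i j) = (e i).hom ≫ N.cx.d i j ≫ (e j).inv := fun i j =>
    F.map_preimage _
  -- The action of `N`, retyped: the component of degree `p` of `A.map F` is `F.obj (A.cx.X p)` by
  -- definition.
  let n : ∀ p i j, p + i = j → (F.obj (A.cx.X p) ⊗ N.cx.X i ⟶ N.cx.X j) := N.act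
  let a : ∀ p i j, p + i = j → (A.cx.X p ⊗ X i ⟶ X j) := fun p i j h =>
    F.preimage (OplaxMonoidal.δ F (A.cx.X p) (X i) ≫ F.obj (A.cx.X p) ◁ (e i).hom ≫ n p i j h ≫
      (e j).inv)
  have ha : ∀ p i j h, LaxMonoidal.μ F (A.cx.X p) (X i) ≫ F.map (a p i j h) =
      F.obj (A.cx.X p) ◁ (e i).hom ≫ n p i j h ≫ (e j).inv := fun p i j h => by
    rw [F.map_preimage, μ_δ_assoc]
  let M : DGModule A :=
    { cx :=
        { X := X
          d := d
          shape := fun i j h => F.map_injective (by rw [hd, N.cx.shape i j h]; simp)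
          d_comp_d' := fun i j l _ _ => F.map_injective (by simp [hd]) }
      act := a
      one_act := fun i => one_act_of_map F (e i) _ _ _ (ha _ _ _ _) (N.one_act i)
      mul_act := fun p q i pq qi pqi hpq hqi h h' =>
        mul_act_of_map F (e i) (e qi) (e pqi) _ _ _ _ _ _ _ (ha _ _ _ _) (ha _ _ _ _)
          (ha _ _ _ _) (N.mul_act p q i pq qi pqi hpq hqi h h')
      leibniz := fun p i j p' i' j' h hp hi hj =>
        leibniz_of_map F (e i) (e i') (e j) (e j') _ _ _ _ _ (hd _ _) (hd _ _) _ _ _ _ _ _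
          (ha _ _ _ _) (ha _ _ _ _) (ha _ _ _ _) _ (N.leibniz p i j p' i' j' h hp hi hj) }
  refine ⟨M, HomologicalComplex.Hom.isoOfComponents e fun i j _ => ?_, fun p i j h => ?_⟩
  · change (e i).hom ≫ N.cx.d i j = F.map (d i j) ≫ (e j).hom
    simp [hd]
  · change (LaxMonoidal.μ F (A.cx.X p) (X i) ≫ F.map (a p i j h)) ≫ (e j).hom =
      F.obj (A.cx.X p) ◁ (e i).hom ≫ n p i j h
    rw [ha]
    simp

/-- A linear equivalence of monoidal categories induces equivalences of dg-categories of
dg-modules. -/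
lemma DGModule.isDGEquivalence_map (k : Type w) [CommRing k] [Linear k C] [Linear k D]
    [MonoidalPreadditive C] [MonoidalPreadditive D] [MonoidalLinear k C] [MonoidalLinear k D]
    [F.Linear k] [F.IsEquivalence] (A : DGAlgebra C) :
    (DGModule.map F k A).IsDGEquivalence := by
  refine ⟨fun M N n => ⟨fun φ ψ e => Subtype.ext ?_, fun φ => ?_⟩, fun Z => ?_⟩
  · ext p q h
    have := Cochain.congr_v (congrArg Subtype.val e) p q h
    exact F.map_injective this
  · let ψ : Cochain M.cx N.cx n := Cochain.mk fun p q h => F.preimage (φ.1.v p q h)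
    have hψ : ∀ p q h, F.map (ψ.v p q h) = φ.1.v p q h := fun p q h => F.map_preimage _
    have mem : ψ ∈ linearCochains k M N n := fun p i j i' j' h hi hj => by
      refine linear_of_map F _ _ _ _ _ ?_
      rw [hψ, hψ]
      exact φ.2 p i j i' j' h hi hj
    exact ⟨⟨ψ, mem⟩, Subtype.ext (by ext p q h; exact hψ p q h)⟩
  · obtain ⟨M, e, he⟩ := DGModule.exists_map_iso F k A Z
    exact ⟨M, DGModule.exists_iso k e he⟩

end

end

-- Base change of modules: composition, descent of the property, equalizers, pushouts

section

open scoped TensorProduct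

namespace SymComplex

universe u

variable {R S T : Type u} [CommRing R] [CommRing S] [CommRing T] {φ : R →+* S} {ψ : S →+* T}
  {χ : R →+* T} {M N Q : Type u} [AddCommGroup M] [Module R M] [AddCommGroup N] [Module S N]
  [AddCommGroup Q] [Module T Q]

lemma isBaseChangeMap_tmul [Algebra R S] (g : M →ₛₗ[algebraMap R S] S ⊗[R] M)
    (hg : ∀ m, g m = 1 ⊗ₜ m) : IsBaseChangeMap g := by
  refine isBaseChangeMap_of_span (fun x => ?_) LinearMap.id hg
  induction x using TensorProduct.induction_on with
  | zero => exact zero_mem _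
  | add x y hx hy => exact add_mem hx hy
  | tmul s m =>
    rw [← mul_one s, ← smul_eq_mul, ← TensorProduct.smul_tmul', ← hg]
    exact Submodule.smul_mem _ _ (Submodule.subset_span ⟨m, rfl⟩)

variable (S M) in
/-- The map `m ↦ 1 ⊗ m`, as a semilinear map. -/
noncomputable def tmulₛₗ [Algebra R S] : M →ₛₗ[algebraMap R S] S ⊗[R] M where
  toFun m := 1 ⊗ₜ m
  map_add' := TensorProduct.tmul_add 1
  map_smul' r m := by rw [TensorProduct.tmul_smul, algebraMap_smul]

lemma isBaseChangeMap_tmulₛₗ [Algebra R S] :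
    IsBaseChangeMap (tmulₛₗ S M : M →ₛₗ[algebraMap R S] S ⊗[R] M) :=
  isBaseChangeMap_tmul _ fun _ => rfl

/-- A semilinear map to a `T`-module is extended first over `S`, with the target regarded as an
`S`-module through `ψ`, and then over `T`. Uniqueness holds at both stages. -/
lemma IsBaseChangeMap.comp [RingHomCompTriple φ ψ χ] {g : M →ₛₗ[φ] N} {h : N →ₛₗ[ψ] Q}
    (hg : IsBaseChangeMap g) (hh : IsBaseChangeMap h) (k : M →ₛₗ[χ] Q)
    (hk : ∀ m, k m = h (g m)) : IsBaseChangeMap k := by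
  intro L _ _ l
  let _ : Module S L := Module.compHom L ψ
  obtain ⟨a, ha, -⟩ := hg L
    { toFun := l
      map_add' := map_add l
      map_smul' := fun r m => by
        rw [LinearMap.map_smulₛₗ, ← RingHomCompTriple.comp_apply (σ₁₂ := φ) (σ₂₃ := ψ)]
        rfl }
  obtain ⟨b, hb, -⟩ := hh L
    { toFun := a
      map_add' := map_add a
      map_smul' := fun r m => a.map_smul r m }
  refine ⟨b, fun m => ?_, fun c hc => ?_⟩
  · rw [hk, hb]
    exact ha m
  · refine hh.hom_ext fun n => ?_
    rw [hb]
    let c' : N →ₗ[S] L :=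
      { toFun := fun n => c (h n)
        map_add' := fun x y => by rw [map_add, map_add]
        map_smul' := fun s x => by rw [LinearMap.map_smulₛₗ, c.map_smul]; rfl }
    have : c' = a := hg.hom_ext fun m => by
      rw [ha]
      exact (congrArg c (hk m).symm).trans (hc m)
    exact LinearMap.congr_fun this n

/-- Two solutions of the same universal problem: the extension of `g` along `g'` is an inverse of
the comparison map. -/
lemma IsBaseChangeMap.bijective_of_comp {N' : Type u} [AddCommGroup N'] [Module S N']
    {g : M →ₛₗ[φ] N} {g' : M →ₛₗ[φ] N'} (hg : IsBaseChangeMap g) (hg' : IsBaseChangeMap g')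
    (k : N →ₗ[S] N') (hk : ∀ m, k (g m) = g' m) : Function.Bijective k := by
  obtain ⟨l, hl, -⟩ := hg' N g
  have h1 : l ∘ₗ k = LinearMap.id := hg.hom_ext fun m => by simp [hk, hl]
  have h2 : k ∘ₗ l = LinearMap.id := hg'.hom_ext fun m => by simp [hk, hl]
  exact ⟨Function.LeftInverse.injective (LinearMap.congr_fun h1),
    Function.RightInverse.surjective (LinearMap.congr_fun h2)⟩

lemma IsBaseChangeMap.of_bijective {N' : Type u} [AddCommGroup N'] [Module S N']
    {g : M →ₛₗ[φ] N} {g' : M →ₛₗ[φ] N'} (hg : IsBaseChangeMap g)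
    (k : N →ₗ[S] N') (hk : ∀ m, k (g m) = g' m) (hb : Function.Bijective k) :
    IsBaseChangeMap g' := by
  intro L _ _ l
  obtain ⟨a, ha, -⟩ := hg L l
  let e := LinearEquiv.ofBijective k hb
  have he : ∀ m, e.symm (g' m) = g m := fun m => by
    rw [LinearEquiv.symm_apply_eq]
    exact (hk m).symm
  refine ⟨a ∘ₗ e.symm.toLinearMap, fun m => ?_, fun b hb' => ?_⟩
  · exact (congrArg a (he m)).trans (ha m)
  · have : b ∘ₗ k = a := hg.hom_ext fun m => by rw [LinearMap.comp_apply, hk, hb', ha]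
    ext x
    obtain ⟨y, rfl⟩ := e.surjective x
    rw [LinearMap.comp_apply, LinearEquiv.coe_coe, e.symm_apply_apply, ← this]
    rfl

/-- Being a base change can be checked after a faithfully flat base change. -/
lemma IsBaseChangeMap.of_faithfullyFlat [RingHomCompTriple φ ψ χ] {g : M →ₛₗ[φ] N}
    {h : N →ₛₗ[ψ] Q} {k : M →ₛₗ[χ] Q} (hψ : ψ.FaithfullyFlat) (hh : IsBaseChangeMap h)
    (hk : IsBaseChangeMap k) (e : ∀ m, k m = h (g m)) : IsBaseChangeMap g := by
  obtain rfl : ψ.comp φ = χ := RingHomCompTriple.comp_eq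
  let _ := φ.toAlgebra
  let _ := ψ.toAlgebra
  have : Module.FaithfullyFlat S T := hψ
  change M →ₛₗ[algebraMap R S] N at g
  obtain ⟨l, hl, -⟩ := isBaseChangeMap_tmulₛₗ (S := S) (M := M) N g
  obtain ⟨a, ha, -⟩ := isBaseChangeMap_tmulₛₗ (S := T) (M := N) Q h
  have ha' : Function.Bijective a := isBaseChangeMap_tmulₛₗ.bijective_of_comp hh a ha
  have h1 := (isBaseChangeMap_tmulₛₗ (R := R) (S := S) (M := M)).comp
    (isBaseChangeMap_tmulₛₗ (S := T) (M := S ⊗[R] M)) (χ := ψ.comp φ)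
    ((tmulₛₗ T (S ⊗[R] M)).comp (tmulₛₗ S M)) (fun _ => rfl)
  -- The composite `T ⊗ (S ⊗ M) → T ⊗ N → Q` compares two base changes of `M` along `ψ ∘ φ`. Its
  -- second factor is bijective, hence so is its first, and faithful flatness then removes `T ⊗ -`.
  have h2 : Function.Bijective (a ∘ₗ l.baseChange T) := h1.bijective_of_comp hk _ fun m => by
    refine Eq.trans ?_ (e m).symm
    rw [← ha, ← hl]
    rfl
  have h3 : Function.Bijective (l.baseChange T) := by
    rw [LinearMap.coe_comp] at h2
    exact ⟨h2.1.of_comp, fun y => by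
      obtain ⟨x, hx⟩ := h2.2 (a y)
      exact ⟨x, ha'.1 hx⟩⟩
  exact isBaseChangeMap_tmulₛₗ.of_bijective l hl
    ((Module.FaithfullyFlat.lTensor_bijective_iff_bijective S T l).1 h3)

/-- Equalizers commute with flat base change. -/
lemma IsBaseChangeMap.equalizer {K N N₂ K' N' N₂' : Type u} [AddCommGroup K] [Module R K]
    [AddCommGroup N] [Module R N] [AddCommGroup N₂] [Module R N₂]
    [AddCommGroup K'] [Module S K'] [AddCommGroup N'] [Module S N'] [AddCommGroup N₂'] [Module S N₂']
    (hφ : φ.Flat) {j : K →ₗ[R] N} {f g : N →ₗ[R] N₂} (hj : Function.Injective j)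
    (hfg : ∀ n, n ∈ Set.range j ↔ f n = g n) {j' : K' →ₗ[S] N'} {f' g' : N' →ₗ[S] N₂'}
    (hj' : Function.Injective j') (hfg' : ∀ n, n ∈ Set.range j' ↔ f' n = g' n)
    {b : N →ₛₗ[φ] N'} (hb : IsBaseChangeMap b) {b₂ : N₂ →ₛₗ[φ] N₂'} (hb₂ : IsBaseChangeMap b₂)
    (ef : ∀ n, b₂ (f n) = f' (b n)) (eg : ∀ n, b₂ (g n) = g' (b n))
    {c : K →ₛₗ[φ] K'} (hc : ∀ x, j' (c x) = b (j x)) : IsBaseChangeMap c := by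
  let _ := φ.toAlgebra
  have : Module.Flat R S := hφ
  obtain ⟨k, hk, -⟩ := isBaseChangeMap_tmulₛₗ (R := R) (S := S) (M := K) K' c
  obtain ⟨l, hl, -⟩ := isBaseChangeMap_tmulₛₗ (R := R) (S := S) (M := N) N' b
  obtain ⟨l₂, hl₂, -⟩ := isBaseChangeMap_tmulₛₗ (R := R) (S := S) (M := N₂) N₂' b₂
  have hl' : Function.Bijective l := isBaseChangeMap_tmulₛₗ.bijective_of_comp hb l hl
  have hl₂' : Function.Bijective l₂ := isBaseChangeMap_tmulₛₗ.bijective_of_comp hb₂ l₂ hl₂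
  have e1 : j' ∘ₗ k = l ∘ₗ j.baseChange S :=
    isBaseChangeMap_tmulₛₗ.hom_ext (φ := algebraMap R S) fun x => by
      rw [LinearMap.comp_apply, hk, hc, ← hl]
      rfl
  have e2 : f' ∘ₗ l = l₂ ∘ₗ f.baseChange S :=
    isBaseChangeMap_tmulₛₗ.hom_ext (φ := algebraMap R S) fun x => by
      rw [LinearMap.comp_apply, hl, ← ef, ← hl₂]
      rfl
  have e3 : g' ∘ₗ l = l₂ ∘ₗ g.baseChange S :=
    isBaseChangeMap_tmulₛₗ.hom_ext (φ := algebraMap R S) fun x => by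
      rw [LinearMap.comp_apply, hl, ← eg, ← hl₂]
      rfl
  -- The equalizer is the kernel of `f - g`, and it is in this form that flatness applies.
  have hex : Function.Exact j (f - g) := fun n => by
    rw [hfg, LinearMap.sub_apply, sub_eq_zero]
  have hex' := Module.Flat.lTensor_exact S hex
  have hinj := Module.Flat.lTensor_preserves_injective_linearMap (M := S) j hj
  refine isBaseChangeMap_tmulₛₗ.of_bijective (φ := algebraMap R S) k hk ⟨?_, fun x => ?_⟩
  · have : Function.Injective (j' ∘ₗ k) := by
      rw [e1]
      exact hl'.1.comp hinj
    exact Function.Injective.of_comp this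
  -- For surjectivity, an element of `K'` is viewed in `N' ≅ S ⊗ N`. It is equalized there, so by
  -- exactness it comes from `S ⊗ K`.
  · obtain ⟨t, ht⟩ := hl'.2 (j' x)
    have h1 : f.baseChange S t = g.baseChange S t := hl₂'.1 (by
      have h2 := LinearMap.congr_fun e2 t
      have h3 := LinearMap.congr_fun e3 t
      simp only [LinearMap.comp_apply, ht] at h2 h3
      rw [← h2, ← h3]
      exact (hfg' _).1 ⟨x, rfl⟩)
    obtain ⟨s, hs⟩ := (hex' t).1 (by
      rw [LinearMap.lTensor_sub, LinearMap.sub_apply, sub_eq_zero]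
      exact h1)
    refine ⟨s, hj' ?_⟩
    rw [← ht, ← hs]
    exact LinearMap.congr_fun e1 s

/-- A base change along a pushout of `R → R'` is a base change along `R → R'`. -/
lemma IsBaseChangeMap.of_isPushout {R S R' S' : CommRingCat.{u}} {α : R ⟶ S} {φ : R ⟶ R'}
    {ψ : S ⟶ S'} {α' : R' ⟶ S'} (h : IsPushout φ α α' ψ) {N N' : Type u} [AddCommGroup N]
    [Module S N] [Module R N] (hN : ∀ (r : R) (n : N), r • n = α.hom r • n) [AddCommGroup N']
    [Module S' N'] [Module R' N'] (hN' : ∀ (r : R') (n : N'), r • n = α'.hom r • n)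
    {g : N →ₛₗ[ψ.hom] N'} (hg : IsBaseChangeMap g) {g' : N →ₛₗ[φ.hom] N'}
    (e : ∀ n, g' n = g n) : IsBaseChangeMap g' := by
  let _ := α.hom.toAlgebra
  let _ := φ.hom.toAlgebra
  let _ := ψ.hom.toAlgebra
  let _ := α'.hom.toAlgebra
  let _ := (α'.hom.comp φ.hom).toAlgebra
  have : IsScalarTower R R' S' := .of_algebraMap_eq fun _ => rfl
  have : IsScalarTower R S S' := .of_algebraMap_eq fun x =>
    congrArg (fun k => k.hom x) h.w
  have : IsScalarTower R S N := ⟨fun r s n => by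
    rw [hN, Algebra.smul_def, mul_smul]; rfl⟩
  have : Algebra.IsPushout R R' S S' := CommRingCat.isPushout_iff_isPushout.1 h
  have : Algebra.IsPushout R S R' S' := this.symm
  obtain ⟨l, hl, -⟩ := isBaseChangeMap_tmulₛₗ (R := S) (S := S') (M := N) N' g
  have hl' : Function.Bijective l := isBaseChangeMap_tmulₛₗ.bijective_of_comp hg l hl
  -- For a pushout square, `S' ⊗[S] N` and `R' ⊗[R] N` agree, and `1 ⊗ n` corresponds to `1 ⊗ n`.
  let c := Algebra.IsPushout.cancelBaseChange R R' S S' N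
  have : IsScalarTower R' S' N' := ⟨fun r s n => by
    rw [hN', Algebra.smul_def, mul_smul]; rfl⟩
  refine isBaseChangeMap_tmulₛₗ.of_bijective (φ := algebraMap R R')
    (l.restrictScalars R' ∘ₗ c.symm.toLinearMap) (fun n => ?_) (hl'.comp c.symm.bijective)
  rw [e, ← hl]
  change l (c.symm (1 ⊗ₜ n)) = l (1 ⊗ₜ n)
  rw [Algebra.IsPushout.cancelBaseChange_symm_tmul, map_one]

end SymComplex

end

-- The category of affine points and the descent equalizer

namespace ActedScheme

open Limits Opposite

variable {Y Z : ActedScheme}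

namespace Point

@[simp]
lemma id_base (p : Y.Point) : Point.Hom.base (𝟙 p) = 𝟙 p.base := rfl

@[simp]
lemma comp_base {p q r : Y.Point} (f : p ⟶ q) (g : q ⟶ r) :
    Point.Hom.base (f ≫ g) = f.base ≫ g.base := rfl

@[simp]
lemma comp_elt {p q r : Y.Point} (f : p ⟶ q) (g : q ⟶ r) :
    Point.Hom.elt (f ≫ g) = f.elt * (f.base ≫ g.elt) := rfl

/-- Every morphism of affine points is cartesian over the category of affine schemes. -/
lemma exists_lift {t p q : Y.Point} (u : p ⟶ q) (g : t ⟶ q) (b : t.base ⟶ p.base)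
    (h : b ≫ u.base = g.base) : ∃ k : t ⟶ p, k.base = b ∧ k ≫ u = g := by
  refine ⟨⟨b, g.elt * (b ≫ u.elt)⁻¹, ?_⟩, rfl, Point.Hom.ext h ?_⟩
  · rw [← g.smul_eq, ← u.smul_eq, ModObj.comp_smul, smul_smul, inv_mul_cancel_right, ← h,
      Category.assoc]
  · exact inv_mul_cancel_right _ _

/-- The group component of `k ≫ u` is that of `k` times a factor depending only on the base of `k`,
so it can be cancelled. -/
lemma hom_ext_of_comp {t p q : Y.Point} (u : p ⟶ q) {k k' : t ⟶ p} (hb : k.base = k'.base)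
    (h : k ≫ u = k' ≫ u) : k = k' := by
  refine Point.Hom.ext hb ?_
  have := congrArg Point.Hom.elt h
  rw [comp_elt, comp_elt, hb] at this
  exact mul_right_cancel this

/-- The category of affine points has pullbacks, and they induce pullbacks of affine schemes. -/
lemma exists_isPullback {p p' q : Y.Point} (u : p ⟶ q) (v : p' ⟶ q) :
    ∃ (r : Y.Point) (f : r ⟶ p) (g : r ⟶ p'), IsPullback f g u v ∧
      IsPullback f.base.left g.base.left u.base.left v.base.left := by
  have := p.isAffine
  have := p'.isAffine
  have := q.isAffine
  have H := IsPullback.of_hasPullback u.base v.base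
  have H' : IsPullback (pullback.fst u.base v.base).left (pullback.snd u.base v.base).left
      u.base.left v.base.left := H.map (Over.forget SpecC)
  have : IsAffine (pullback u.base v.base).left := .of_isPullback H'
  -- The fibre product of the bases is made a point by restricting `p.pt`, so the first projection
  -- has trivial group component. The group component of the second projection is then forced by
  -- commutativity of the square and is supplied by `exists_lift`.
  let r : Y.Point := ⟨pullback u.base v.base, pullback.fst _ _ ≫ p.pt⟩
  let f : r ⟶ p := Point.Hom.mk (pullback.fst _ _) 1 (one_smul _ _)
  obtain ⟨g, hg, w⟩ := exists_lift v (f ≫ u) (pullback.snd _ _) pullback.condition.symm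
  have lift : ∀ (t : Y.Point) (f' : t ⟶ p) (g' : t ⟶ p') (_ : f' ≫ u = g' ≫ v),
      ∃ k : t ⟶ r, k ≫ f = f' ∧ k ≫ g = g' := by
    intro t f' g' e
    let k : t ⟶ r := Point.Hom.mk (pullback.lift f'.base g'.base (congrArg Point.Hom.base e))
      f'.elt (by
        rw [← f'.smul_eq]
        exact congrArg _ (pullback.lift_fst_assoc _ _ _ _))
    have hk : k ≫ f = f' :=
      Point.Hom.ext (pullback.lift_fst _ _ _) (by simp [k, f, MonObj.comp_one])
    refine ⟨k, hk, hom_ext_of_comp v ?_ ?_⟩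
    · rw [comp_base, hg]
      exact pullback.lift_snd _ _ _
    · rw [Category.assoc, w, ← e, ← Category.assoc, hk]
  have ext : ∀ (t : Y.Point) (k k' : t ⟶ r), k ≫ f = k' ≫ f → k ≫ g = k' ≫ g → k = k' := by
    intro t k k' h h'
    refine hom_ext_of_comp f (pullback.hom_ext ?_ ?_) h
    · exact congrArg Point.Hom.base h
    · rw [← hg]
      exact congrArg Point.Hom.base h'
  choose l hl hl' using lift
  refine ⟨r, f, g, ⟨⟨w.symm⟩, ⟨PullbackCone.IsLimit.mk w.symm
    (fun s => l _ s.fst s.snd s.condition) (fun s => hl _ _ _ _) (fun s => hl' _ _ _ _)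
      (fun s m h h' => ext _ _ _ (h.trans (hl _ _ _ _).symm) (h'.trans (hl' _ _ _ _).symm))⟩⟩, ?_⟩
  rw [hg]
  exact H'

lemma isPushout_appTop {p p' q : Y.Point} {T : Over SpecC} (u : p.base ⟶ q.base)
    (v : p'.base ⟶ q.base) (f : T ⟶ p.base) (g : T ⟶ p'.base)
    (h : IsPullback f.left g.left u.left v.left) :
    IsPushout u.left.appTop v.left.appTop f.left.appTop g.left.appTop :=
  have := p.isAffine
  have := p'.isAffine
  have := q.isAffine
  isPushout_appTop_of_isPullback h

end Point

open SymComplex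

/-- A morphism of affine points is a cover if the underlying morphism of affine schemes is
faithfully flat. -/
def IsCover {p q : Y.Point} (u : p ⟶ q) : Prop := (Y.O.map u.op).hom.FaithfullyFlat

lemma map_O_comp {p q r : Y.Point} (f : p ⟶ q) (g : q ⟶ r) (s : Y.O.obj (op r)) :
    (Y.O.map (f ≫ g).op).hom s = (Y.O.map f.op).hom ((Y.O.map g.op).hom s) := by
  rw [op_comp, Functor.map_comp]
  rfl

lemma resMap_op_comp (M : Y.PMod) {p q r : Y.Point} (f : p ⟶ q) (g : q ⟶ r) (m : sec M (op r)) :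
    resMap M (f ≫ g).op m = resMap M f.op (resMap M g.op m) :=
  resMap_comp M g.op f.op m

lemma resMap_op_id (M : Y.PMod) {p : Y.Point} (m : sec M (op p)) :
    resMap M (𝟙 p : p ⟶ p).op m = m :=
  resMap_id M (op p) m

/-- Flat descent for modules: let `p₁, p₂ : a₂ ⟶ a` and `p₁₂, p₁₃, p₂₃ : a₃ ⟶ a₂` be affine
points whose rings are `S`, `S ⊗ S` and `S ⊗ S ⊗ S`, for a flat `R`-algebra `S`. Then the equalizer
of `M(a) ⇉ M(a₂)` has base change `M(a)`. -/
lemma isBaseChangeMap_equalizer {M : Y.PMod} (hM : isCartesian Y M) {a a₂ a₃ : Y.Point}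
    {R : CommRingCat.{0}} {φ : R ⟶ Y.O.obj (op a)} (hφ : φ.hom.Flat) {p₁ p₂ : a₂ ⟶ a}
    {p₁₂ p₁₃ p₂₃ : a₃ ⟶ a₂} {Δ : a ⟶ a₂} {σ : a₂ ⟶ a₃}
    (h₂ : IsPushout φ φ (Y.O.map p₁.op) (Y.O.map p₂.op))
    (h₃ : IsPushout φ (φ ≫ Y.O.map p₁.op) (Y.O.map (p₁₂ ≫ p₁).op) (Y.O.map p₂₃.op))
    (e₁ : p₁₂ ≫ p₂ = p₂₃ ≫ p₁) (e₂ : p₁₃ ≫ p₁ = p₁₂ ≫ p₁) (e₃ : p₁₃ ≫ p₂ = p₂₃ ≫ p₂)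
    (eΔ : Δ ≫ p₁ = 𝟙 a) (eσ : σ ≫ p₁₂ = 𝟙 a₂) (eσ' : σ ≫ p₁₃ = p₁ ≫ Δ)
    {K : Type} [AddCommGroup K] [Module R K] {j : K →ₛₗ[φ.hom] sec M (op a)}
    (hj : Function.Injective j)
    (hj' : ∀ m, m ∈ Set.range j ↔ resMap M p₁.op m = resMap M p₂.op m) : IsBaseChangeMap j := by
  rw [isCartesian_iff] at hM
  -- Write `S` for the ring of `a`. The modules `M(a₂)` and `M(a₃)` are regarded as `S`-modules
  -- through the first coordinate `p₁`, respectively `p₁₂ ≫ p₁`.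
  let _ : Module R (sec M (op a)) := Module.compHom _ φ.hom
  let _ : Module R (sec M (op a₂)) := Module.compHom _ (φ ≫ Y.O.map p₁.op).hom
  let _ : Module (Y.O.obj (op a)) (sec M (op a₂)) := Module.compHom _ (Y.O.map p₁.op).hom
  let _ : Module (Y.O.obj (op a)) (sec M (op a₃)) := Module.compHom _ (Y.O.map (p₁₂ ≫ p₁).op).hom
  have w : ∀ r, (Y.O.map p₂.op).hom (φ.hom r) = (Y.O.map p₁.op).hom (φ.hom r) := fun r =>
    congrArg (fun k => k.hom r) h₂.w.symm
  let jl : K →ₗ[R] sec M (op a) := { j with map_smul' := fun r x => j.map_smulₛₗ r x }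
  let f : sec M (op a) →ₗ[R] sec M (op a₂) :=
    { resMap M p₁.op with map_smul' := fun r x => (resMap M p₁.op).map_smulₛₗ (φ.hom r) x }
  let g : sec M (op a) →ₗ[R] sec M (op a₂) :=
    { resMap M p₂.op with
      map_smul' := fun r x => ((resMap M p₂.op).map_smulₛₗ (φ.hom r) x).trans (by rw [w]; rfl) }
  -- The fork `M(a) → M(a₂) ⇉ M(a₃)` given by `p₁`, `p₁₂`, `p₁₃` is `S`-linear; it will turn out to
  -- be the base change along `φ` of the fork `K → M(a) ⇉ M(a₂)`.
  let j' : sec M (op a) →ₗ[Y.O.obj (op a)] sec M (op a₂) :=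
    { resMap M p₁.op with map_smul' := fun r x => (resMap M p₁.op).map_smulₛₗ r x }
  let f' : sec M (op a₂) →ₗ[Y.O.obj (op a)] sec M (op a₃) :=
    { resMap M p₁₂.op with
      map_smul' := fun r x =>
        ((resMap M p₁₂.op).map_smulₛₗ ((Y.O.map p₁.op).hom r) x).trans
          (by rw [← map_O_comp]; rfl) }
  let g' : sec M (op a₂) →ₗ[Y.O.obj (op a)] sec M (op a₃) :=
    { resMap M p₁₃.op with
      map_smul' := fun r x =>
        ((resMap M p₁₃.op).map_smulₛₗ ((Y.O.map p₁.op).hom r) x).trans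
          (by rw [← map_O_comp, e₂]; rfl) }
  -- The base change maps between the two forks forget the new first coordinate, so they are
  -- pullbacks along `p₂` and `p₂₃`. They are base changes along `φ` because the squares `h₂` and
  -- `h₃` are pushouts and `M` is cartesian.
  let b : sec M (op a) →ₛₗ[φ.hom] sec M (op a₂) :=
    { resMap M p₂.op with
      map_smul' := fun r x => ((resMap M p₂.op).map_smulₛₗ (φ.hom r) x).trans (by rw [w]; rfl) }
  let b₂ : sec M (op a₂) →ₛₗ[φ.hom] sec M (op a₃) :=
    { resMap M p₂₃.op with
      map_smul' := fun r x =>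
        ((resMap M p₂₃.op).map_smulₛₗ ((Y.O.map p₁.op).hom (φ.hom r)) x).trans
          (congrArg (· • _) (congrArg (fun k => k.hom r) h₃.w.symm)) }
  have hb : IsBaseChangeMap b := IsBaseChangeMap.of_isPushout h₂ (fun _ _ => rfl)
    (fun _ _ => rfl) (hM p₂.op) fun _ => rfl
  have hb₂ : IsBaseChangeMap b₂ := IsBaseChangeMap.of_isPushout h₃ (fun _ _ => rfl)
    (fun _ _ => rfl) (hM p₂₃.op) fun _ => rfl
  have hΔ : ∀ m, resMap M Δ.op (resMap M p₁.op m) = m := fun m => by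
    rw [← resMap_op_comp, eΔ, resMap_op_id]
  refine IsBaseChangeMap.equalizer (j := jl) (f := f) (g := g) (j' := j') (f' := f') (g' := g')
    hφ hj hj' (Function.LeftInverse.injective hΔ) (fun n => ⟨?_, fun h => ?_⟩) hb hb₂ (fun n => ?_)
    (fun n => ?_) fun x => ?_
  · rintro ⟨m, rfl⟩
    change resMap M p₁₂.op (resMap M p₁.op m) = resMap M p₁₃.op (resMap M p₁.op m)
    rw [← resMap_op_comp, ← resMap_op_comp, e₂]
  -- Pulling back along `σ`, which is `(x, y) ↦ (x, y, x)` on coordinates, turns the hypothesis into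
  -- `n = p₁^* (Δ^* n)`. Together with `hΔ` this splits the second fork.
  · change resMap M p₁₂.op n = resMap M p₁₃.op n at h
    have := congrArg (resMap M σ.op) h
    rw [← resMap_op_comp, ← resMap_op_comp, eσ, eσ', resMap_op_id, resMap_op_comp] at this
    exact ⟨_, this.symm⟩
  · change resMap M p₂₃.op (resMap M p₁.op n) = resMap M p₁₂.op (resMap M p₂.op n)
    rw [← resMap_op_comp, ← resMap_op_comp, e₁]
  · change resMap M p₂₃.op (resMap M p₂.op n) = resMap M p₁₃.op (resMap M p₂.op n)
    rw [← resMap_op_comp, ← resMap_op_comp, e₃]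
  -- Compatibility of `j` with the forks says that its values have the same pullbacks along `p₁` and
  -- `p₂`, which is the equalizer condition.
  · exact (hj' _).1 ⟨x, rfl⟩

end ActedScheme

-- Sieves of affine points and faithfully flat descent for elements

namespace ActedScheme

open Limits Opposite SymComplex

variable {Y Z : ActedScheme}

/-- An equivariant morphism for which the functor on affine points is the inclusion of a sieve. -/
structure Hom.IsSieve (f : Hom Y Z) : Prop where
  full : f.points.Full
  faithful : f.points.Faithful
  exists_iso {a : Y.Point} {b : Z.Point} (v : b ⟶ f.points.obj a) :
    ∃ a', Nonempty (f.points.obj a' ≅ b)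

variable (Y) in
/-- The identity. -/
noncomputable def Hom.id : Hom Y Y where
  grp := 𝟙 _
  space := 𝟙 _
  smul_comp _ _ _ := by simp

/-- The sieve of all points. It makes descent inside a single category of affine points a special
case of descent along a sieve. -/
lemma Hom.isSieve_id : (Hom.id Y).IsSieve where
  full := ⟨fun {p q} g => ⟨Point.Hom.mk g.base g.elt (by
    have h : g.elt • (g.base ≫ q.pt ≫ 𝟙 _) = p.pt ≫ 𝟙 _ := g.smul_eq
    rw [Category.comp_id] at h
    refine Eq.trans ?_ h
    exact congrArg (fun t => g.elt • (g.base ≫ t)) (Category.comp_id q.pt).symm), Point.Hom.ext rfl (Category.comp_id _)⟩⟩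
  faithful := ⟨fun {p q} g h e => Point.Hom.ext (congrArg Point.Hom.base e) (by
    have h : g.elt ≫ 𝟙 _ = h.elt ≫ 𝟙 _ := congrArg Point.Hom.elt e
    rwa [Category.comp_id, Category.comp_id] at h)⟩
  exists_iso {a b} v := ⟨b, ⟨
    { hom := Point.Hom.mk (𝟙 _) 1 ((one_smul _ _).trans
        ((Category.id_comp _).trans (Category.comp_id b.pt).symm))
      inv := Point.Hom.mk (𝟙 _) 1 ((one_smul _ _).trans
        ((Category.id_comp _).trans (Category.comp_id b.pt)))
      hom_inv_id := Point.Hom.ext (Category.comp_id _)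
        ((one_mul _).trans (MonObj.comp_one _))
      inv_hom_id := Point.Hom.ext (Category.comp_id _)
        ((one_mul _).trans (MonObj.comp_one _)) }⟩⟩

/-- The homomorphism of rings of functions attached to a morphism from the image of an affine
point. -/
noncomputable def Hom.resO (f : Hom Y Z) {a : Y.Point} {b : Z.Point}
    (u : f.points.obj a ⟶ b) : Z.O.obj (op b) ⟶ Y.O.obj (op a) := u.base.left.appTop

lemma Hom.resO_comp (f : Hom Y Z) {a a' : Y.Point} {b : Z.Point} (t : a' ⟶ a)
    (u : f.points.obj a ⟶ b) : f.resO (f.points.map t ≫ u) = f.resO u ≫ Y.O.map t.op :=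
  Z.O.map_comp u.op (f.points.map t).op

lemma Hom.resO_comp' (f : Hom Y Z) {a : Y.Point} {b b' : Z.Point} (u : f.points.obj a ⟶ b)
    (v : b ⟶ b') : f.resO (u ≫ v) = Z.O.map v.op ≫ f.resO u :=
  Z.O.map_comp v.op u.op

namespace Hom.IsSieve

variable {f : Hom Y Z} (hf : f.IsSieve)

include hf

/-- The fibre product formed in `Z.Point` maps to the image point of `a`, so by the sieve condition
it is itself isomorphic to an image point. -/
lemma exists_isPullback {a : Y.Point} {b b₁ : Z.Point} (u : f.points.obj a ⟶ b) (w : b₁ ⟶ b) :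
    ∃ (a' : Y.Point) (g : a' ⟶ a) (g₁ : f.points.obj a' ⟶ b₁),
      IsPullback (f.points.map g) g₁ u w ∧
      IsPushout (f.resO u) (Z.O.map w.op) (Y.O.map g.op) (f.resO g₁) := by
  have := hf.full
  obtain ⟨r, g, g₁, h, h'⟩ := Point.exists_isPullback u w
  obtain ⟨a', ⟨e⟩⟩ := hf.exists_iso g
  refine ⟨a', f.points.preimage (e.hom ≫ g), e.hom ≫ g₁, ?_, ?_⟩
  · rw [f.points.map_preimage]
    exact h.of_iso' e (Iso.refl _) (Iso.refl _) (Iso.refl _) (by simp) (by simp) (by simp)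
      (by simp)
  · have e1 : (f.points.preimage (e.hom ≫ g)).base = e.hom.base ≫ g.base :=
      congrArg Point.Hom.base (f.points.map_preimage (e.hom ≫ g))
    have key : IsPullback (f.points.preimage (e.hom ≫ g)).base.left
        (e.hom ≫ g₁).base.left u.base.left w.base.left := by
      rw [e1]
      exact h'.of_iso' ((toOver Z ⋙ Over.forget _).mapIso e) (Iso.refl _) (Iso.refl _)
        (Iso.refl _) (by simp; rfl) (by simp; rfl) ((Category.id_comp _).trans (Category.comp_id _).symm)
        ((Category.id_comp _).trans (Category.comp_id _).symm)
    exact Point.isPushout_appTop (p := f.points.obj a) (p' := b₁) u.base w.base _ _ key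

lemma exists_isPullback' {a a₁ : Y.Point} {b : Z.Point} (u : f.points.obj a ⟶ b)
    (w : f.points.obj a₁ ⟶ b) :
    ∃ (a' : Y.Point) (g : a' ⟶ a) (g₁ : a' ⟶ a₁),
      IsPullback (f.points.map g) (f.points.map g₁) u w ∧
      IsPushout (f.resO u) (f.resO w) (Y.O.map g.op) (Y.O.map g₁.op) := by
  have := hf.full
  obtain ⟨a', g, g₁, h, h'⟩ := hf.exists_isPullback u w
  obtain ⟨g₁, rfl⟩ := f.points.map_surjective g₁
  exact ⟨a', g, g₁, h, h'⟩

/-- Flat descent for modules. -/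
lemma isBaseChangeMap {M : Y.PMod} (hM : isCartesian Y M) {a : Y.Point} {b : Z.Point}
    (u : f.points.obj a ⟶ b) (hu : (f.resO u).hom.Flat) {K : Type} [AddCommGroup K]
    [Module (Z.O.obj (op b)) K] {j : K →ₛₗ[(f.resO u).hom] sec M (op a)}
    (hj : Function.Injective j)
    (hj' : ∀ m, m ∈ Set.range j ↔ ∀ (t : Y.Point) (g h : t ⟶ a),
      f.points.map g ≫ u = f.points.map h ≫ u → resMap M g.op m = resMap M h.op m) :
    IsBaseChangeMap j := by
  have := hf.full
  have := hf.faithful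
  obtain ⟨a₂, p₁, p₂, hp, h₂⟩ := hf.exists_isPullback' u u
  -- The triple fibre product is formed as `a ×_b a₂`, with `q₁` the first coordinate and `q₂₃` the
  -- last two.
  obtain ⟨a₃, q₁, q₂₃, hq, h₃⟩ := hf.exists_isPullback' u (f.points.map p₁ ≫ u)
  have lift₂ : ∀ (t : Y.Point) (g h : t ⟶ a) (_ : f.points.map g ≫ u = f.points.map h ≫ u),
      ∃ k : t ⟶ a₂, k ≫ p₁ = g ∧ k ≫ p₂ = h := fun t g h e =>
    ⟨f.points.preimage (hp.lift _ _ e), f.points.map_injective (by simp),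
      f.points.map_injective (by simp)⟩
  have ext₂ : ∀ (t : Y.Point) (k k' : t ⟶ a₂), k ≫ p₁ = k' ≫ p₁ → k ≫ p₂ = k' ≫ p₂ → k = k' :=
    fun t k k' e e' => f.points.map_injective (hp.hom_ext
      (by rw [← Functor.map_comp, e, Functor.map_comp])
      (by rw [← Functor.map_comp, e', Functor.map_comp]))
  have hp' := hp.w
  have hq' := hq.w
  obtain ⟨p₁₂, h12, h12'⟩ := lift₂ a₃ q₁ (q₂₃ ≫ p₁) (by rw [hq']; simp)
  obtain ⟨p₁₃, h13, h13'⟩ := lift₂ a₃ q₁ (q₂₃ ≫ p₂) (by rw [hq']; simp [hp'])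
  obtain ⟨Δ, hΔ, hΔ'⟩ := lift₂ a (𝟙 a) (𝟙 a) rfl
  -- The exchange of the two factors. With it, `σ` below sends `(x, y)` to `x` paired with `(y, x)`.
  obtain ⟨τ, hτ, hτ'⟩ := lift₂ a₂ p₂ p₁ hp'.symm
  have e : f.points.map p₁ ≫ u = f.points.map τ ≫ f.points.map p₁ ≫ u := by
    rw [← Functor.map_comp_assoc, hτ, hp']
  let σ : a₂ ⟶ a₃ := f.points.preimage (hq.lift _ _ e)
  have hσ : σ ≫ q₁ = p₁ := f.points.map_injective (by simp [σ])
  have hσ' : σ ≫ q₂₃ = τ := f.points.map_injective (by simp [σ])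
  refine isBaseChangeMap_equalizer hM (φ := f.resO u) hu (p₁ := p₁) (p₂ := p₂) (p₁₂ := p₁₂)
    (p₁₃ := p₁₃) (p₂₃ := q₂₃) (Δ := Δ) (σ := σ) h₂ ?_ h12' (h13.trans h12.symm) h13' hΔ ?_ ?_ hj
    fun m => (hj' m).trans ⟨fun h => h _ _ _ hp', fun h t g g' e => ?_⟩
  · rw [h12]
    rwa [← f.resO_comp]
  · exact ext₂ _ _ _ (by rw [Category.assoc, h12, hσ, Category.id_comp])
      (by rw [Category.assoc, h12', reassoc_of% hσ', hτ, Category.id_comp])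
  · exact ext₂ _ _ _ (by rw [Category.assoc, h13, hσ, Category.assoc, hΔ, Category.comp_id])
      (by rw [Category.assoc, h13', reassoc_of% hσ', hτ', Category.assoc, hΔ', Category.comp_id])
  · obtain ⟨k, rfl, rfl⟩ := lift₂ _ _ _ e
    rw [resMap_op_comp, resMap_op_comp, h]

end Hom.IsSieve

variable {M : Y.PMod} (hM : isCartesian Y M) {p q : Y.Point} {u : p ⟶ q} (hu : IsCover u)

include hM hu

/-- Faithfully flat descent for elements of modules. -/
lemma bijective_resMap : Function.Injective (resMap M u.op) ∧
    ∀ m, (∀ (t : Y.Point) (g h : t ⟶ p), g ≫ u = h ≫ u → resMap M g.op m = resMap M h.op m) →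
      ∃ n, resMap M u.op n = m := by
  let _ : Module (Y.O.obj (op q)) (sec M (op p)) := Module.compHom _ (Y.O.map u.op).hom
  -- The elements of `M(p)` satisfying the descent condition. The claim is that restriction
  -- identifies `M(q)` with `K`.
  let K : Submodule (Y.O.obj (op q)) (sec M (op p)) :=
    { carrier := {m | ∀ (t : Y.Point) (g h : t ⟶ p), g ≫ u = h ≫ u →
        resMap M g.op m = resMap M h.op m}
      add_mem' := fun {x y} hx hy t g h e => by rw [map_add, map_add, hx t g h e, hy t g h e]
      zero_mem' := fun t g h e => by rw [map_zero, map_zero]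
      smul_mem' := fun r x hx t g h e => by
        change resMap M g.op ((Y.O.map u.op).hom r • x) = resMap M h.op ((Y.O.map u.op).hom r • x)
        rw [LinearMap.map_smulₛₗ, LinearMap.map_smulₛₗ, hx t g h e, ← map_O_comp, ← map_O_comp,
          e] }
  let j : K →ₛₗ[(Y.O.map u.op).hom] sec M (op p) :=
    { K.subtype with map_smul' := fun _ _ => rfl }
  have hj : IsBaseChangeMap j := by
    let _ : Module (Y.O.obj (op ((Hom.id Y).points.obj q))) K :=
      K.module
    refine Hom.isSieve_id.isBaseChangeMap hM (b := (Hom.id Y).points.obj q)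
      ((Hom.id Y).points.map u) (show RingHom.Flat _ from hu.flat) (j := j) Subtype.val_injective
      fun m => ?_
    have := Hom.isSieve_id (Y := Y).faithful
    refine (show m ∈ Set.range j ↔ m ∈ K from Set.ext_iff.1 Subtype.range_val m).trans
      (forall₃_congr fun t g h => ?_)
    rw [← Functor.map_comp, ← Functor.map_comp, (Hom.id Y).points.map_injective.eq_iff]
  have hM' := (isCartesian_iff M).1 hM u.op
  let c : sec M (op q) →ₗ[Y.O.obj (op q)] K :=
    { toFun := fun n => ⟨resMap M u.op n, fun t g h e => by
        rw [← resMap_op_comp, ← resMap_op_comp, e]⟩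
      map_add' := fun x y => Subtype.ext (map_add _ _ _)
      map_smul' := fun r x => Subtype.ext ((resMap M u.op).map_smulₛₗ r x) }
  -- Both `K → M(p)`, by flat descent, and `M(q) → M(p)`, since `M` is cartesian, are base changes
  -- along a faithfully flat map. Hence `M(q) → K` is a base change along the identity ring map,
  -- which means that it is bijective.
  have hc : IsBaseChangeMap c := IsBaseChangeMap.of_faithfullyFlat hu hj hM' fun _ => rfl
  have hid : IsBaseChangeMap (LinearMap.id : sec M (op q) →ₗ[Y.O.obj (op q)] sec M (op q)) :=
    fun Q _ _ h => ⟨h, fun _ => rfl, fun k hk => LinearMap.ext hk⟩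
  have hb := hid.bijective_of_comp hc c fun _ => rfl
  refine ⟨fun x y e => hb.1 (Subtype.ext e), fun m hm => ?_⟩
  obtain ⟨n, hn⟩ := hb.2 ⟨m, hm⟩
  exact ⟨n, congrArg Subtype.val hn⟩

end ActedScheme

-- Compatible families and their evaluation on covers

namespace ActedScheme

open Limits Opposite SymComplex

lemma faithfullyFlat_of_isPushout {R S R' S' : CommRingCat.{0}} {α : R ⟶ S} {φ : R ⟶ R'}
    {ψ : S ⟶ S'} {α' : R' ⟶ S'} (h : IsPushout α φ ψ α') (hα : α.hom.FaithfullyFlat) :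
    α'.hom.FaithfullyFlat := by
  have := RingHom.isStableUnderCobaseChange_toMorphismProperty_iff.2
    RingHom.FaithfullyFlat.isStableUnderBaseChange
  exact MorphismProperty.of_isPushout (P := RingHom.toMorphismProperty RingHom.FaithfullyFlat)
    h.flip hα

variable {Y Z : ActedScheme} (f : Hom Y Z)

namespace Hom

/-- Families of sections of `M` indexed by the morphisms from the image of `f` to `b`. -/
def PreFamily (M : Y.PMod) (b : Z.Point) : Type 1 :=
  ∀ a : Y.Point, (f.points.obj a ⟶ b) → sec M (op a)

noncomputable instance (M : Y.PMod) (b : Z.Point) : AddCommGroup (f.PreFamily M b) :=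
  inferInstanceAs (AddCommGroup (∀ a : Y.Point, (f.points.obj a ⟶ b) → sec M (op a)))

noncomputable instance (M : Y.PMod) (b : Z.Point) :
    Module (Z.O.obj (op b)) (f.PreFamily M b) where
  smul r s := fun a w => (f.resO w).hom r • s a w
  one_smul s := funext₂ fun a w => by
    change (f.resO w).hom 1 • s a w = s a w
    rw [map_one, one_smul]
  mul_smul r r' s := funext₂ fun a w => by
    change (f.resO w).hom (r * r') • s a w = (f.resO w).hom r • (f.resO w).hom r' • s a w
    rw [map_mul, mul_smul]
  smul_zero r := funext₂ fun a w => smul_zero _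
  smul_add r s t := funext₂ fun a w => smul_add _ _ _
  add_smul r r' s := funext₂ fun a w => by
    change (f.resO w).hom (r + r') • s a w = (f.resO w).hom r • s a w + (f.resO w).hom r' • s a w
    rw [map_add, add_smul]
  zero_smul s := funext₂ fun a w => by
    change (f.resO w).hom 0 • s a w = 0
    rw [map_zero, zero_smul]

lemma smul_preFamily {M : Y.PMod} {b : Z.Point} (r : Z.O.obj (op b)) (s : f.PreFamily M b)
    (a : Y.Point) (w : f.points.obj a ⟶ b) : (r • s) a w = (f.resO w).hom r • s a w := rfl

/-- Compatible families of sections of `M` indexed by the morphisms from the image of `f` to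
`b`. -/
noncomputable def families (M : Y.PMod) (b : Z.Point) : Submodule (Z.O.obj (op b)) (f.PreFamily M b) where
  carrier := {s | ∀ (a a' : Y.Point) (t : a' ⟶ a) (w : f.points.obj a ⟶ b),
    resMap M t.op (s a w) = s a' (f.points.map t ≫ w)}
  add_mem' {s s'} hs hs' a a' t w := (map_add _ _ _).trans (congrArg₂ _ (hs a a' t w) (hs' a a' t w))
  zero_mem' a a' t w := map_zero _
  smul_mem' r s hs a a' t w := by
    rw [smul_preFamily, smul_preFamily, LinearMap.map_smulₛₗ, hs, f.resO_comp]
    rfl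

variable {f} {M : Y.PMod}

/-- The value of a compatible family. -/
noncomputable def evalFamily {a : Y.Point} {b : Z.Point} (w : f.points.obj a ⟶ b) :
    f.families M b →ₛₗ[(f.resO w).hom] sec M (op a) where
  toFun s := s.1 a w
  map_add' _ _ := rfl
  map_smul' _ _ := rfl

/-- The restriction of compatible families. -/
noncomputable def restrictFamily {b b' : Z.Point} (v : b' ⟶ b) :
    f.families M b →ₛₗ[(Z.O.map v.op).hom] f.families M b' where
  toFun s := ⟨fun a w => s.1 a (w ≫ v), fun a a' t w =>
    (s.2 a a' t (w ≫ v)).trans (congrArg (s.1 a') (Category.assoc _ _ _).symm)⟩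
  map_add' _ _ := rfl
  map_smul' r s := Subtype.ext <| funext₂ fun a w => by
    change (f.resO (w ≫ v)).hom r • s.1 a (w ≫ v) =
      (f.resO w).hom ((Z.O.map v.op).hom r) • s.1 a (w ≫ v)
    rw [f.resO_comp']
    rfl

lemma resMap_evalFamily {a a' : Y.Point} {b : Z.Point} (t : a' ⟶ a) (w : f.points.obj a ⟶ b)
    (s : f.families M b) :
    resMap M t.op (evalFamily w s) = evalFamily (f.points.map t ≫ w) s := s.2 a a' t w

lemma family_ext {b : Z.Point} {s s' : f.families M b}
    (h : ∀ (a : Y.Point) (w : f.points.obj a ⟶ b), evalFamily w s = evalFamily w s') : s = s' :=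
  Subtype.ext (funext₂ h)

namespace IsSieve

variable (hf : f.IsSieve) (hM : isCartesian Y M)

include hf hM

/-- The value at any `w` is determined by the value at `u`: the two have the same restriction to the
fibre product of `u` and `w`. This fibre product covers the source of `w`, and restriction along a
cover is injective. -/
lemma evalFamily_injective {a : Y.Point} {b : Z.Point} {u : f.points.obj a ⟶ b}
    (hu : (f.resO u).hom.FaithfullyFlat) :
    Function.Injective (evalFamily (M := M) u) := fun s s' e => family_ext fun a₁ w => by
  obtain ⟨a', g, g₁, h, h'⟩ := hf.exists_isPullback' u w
  refine (bijective_resMap hM (u := g₁) (faithfullyFlat_of_isPushout h' hu)).1 ?_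
  rw [resMap_evalFamily, resMap_evalFamily, ← h.w, ← resMap_evalFamily, e, resMap_evalFamily]

/-- The value at `w` is obtained by restricting `m` to the fibre product of `u` and `w` and
descending along the resulting cover of the source of `w`. -/
lemma exists_evalFamily {a : Y.Point} {b : Z.Point} {u : f.points.obj a ⟶ b}
    (hu : (f.resO u).hom.FaithfullyFlat) (m : sec M (op a))
    (hm : ∀ (t : Y.Point) (g h : t ⟶ a), f.points.map g ≫ u = f.points.map h ≫ u →
      resMap M g.op m = resMap M h.op m) :
    ∃ s : f.families M b, evalFamily u s = m := by
  have := hf.full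
  have := hf.faithful
  -- The value is characterized by agreement with `m` over every test point `t`, not only over the
  -- chosen fibre product. This stronger form is what gives compatibility of the values below.
  have key : ∀ (a₁ : Y.Point) (w : f.points.obj a₁ ⟶ b), ∃ n : sec M (op a₁),
      ∀ (t : Y.Point) (g : t ⟶ a) (g₁ : t ⟶ a₁), f.points.map g ≫ u = f.points.map g₁ ≫ w →
        resMap M g₁.op n = resMap M g.op m := by
    intro a₁ w
    obtain ⟨a', g, g₁, h, h'⟩ := hf.exists_isPullback' u w
    obtain ⟨n, hn⟩ := (bijective_resMap hM (u := g₁) (faithfullyFlat_of_isPushout h' hu)).2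
      (resMap M g.op m) fun t k k' e => by
        rw [← resMap_op_comp, ← resMap_op_comp]
        refine hm _ _ _ ?_
        rw [Functor.map_comp, Functor.map_comp, Category.assoc, Category.assoc, h.w,
          ← Functor.map_comp_assoc, e, Functor.map_comp_assoc]
    refine ⟨n, fun t k k₁ e => ?_⟩
    obtain ⟨k', rfl, rfl⟩ : ∃ k', k' ≫ g = k ∧ k' ≫ g₁ = k₁ :=
      ⟨f.points.preimage (h.lift _ _ e), f.points.map_injective (by simp),
        f.points.map_injective (by simp)⟩
    rw [resMap_op_comp, resMap_op_comp, hn]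
  choose s hs using key
  refine ⟨⟨s, fun a₁ a₂ t w => ?_⟩, ?_⟩
  · obtain ⟨a', g, g₁, h, h'⟩ := hf.exists_isPullback' u (f.points.map t ≫ w)
    refine (bijective_resMap hM (u := g₁) (faithfullyFlat_of_isPushout h' hu)).1 ?_
    rw [hs a₂ _ _ g g₁ h.w, ← resMap_op_comp, hs a₁ w _ g (g₁ ≫ t) (by rw [h.w]; simp)]
  · have := hs a u a (𝟙 a) (𝟙 a) rfl
    rwa [resMap_op_id, resMap_op_id] at this

/-- Evaluation at a cover identifies families with the elements satisfying the descent condition, to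
which flat descent applies. The module `K` stands for a small model of the families, as these are
indexed by a large category. -/
lemma isBaseChangeMap_evalFamily {a : Y.Point} {b : Z.Point} {u : f.points.obj a ⟶ b}
    (hu : (f.resO u).hom.FaithfullyFlat) {K : Type} [AddCommGroup K] [Module (Z.O.obj (op b)) K]
    (e : K ≃ₗ[Z.O.obj (op b)] f.families M b) (j : K →ₛₗ[(f.resO u).hom] sec M (op a))
    (hj : ∀ x, j x = evalFamily u (e x)) : IsBaseChangeMap j := by
  refine hf.isBaseChangeMap hM u hu.flat (fun x y h => ?_) fun m => ⟨?_, fun h => ?_⟩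
  · rw [hj, hj] at h
    exact e.injective (hf.evalFamily_injective hM hu h)
  · rintro ⟨x, rfl⟩ t g h w
    rw [hj, resMap_evalFamily, resMap_evalFamily, w]
  · obtain ⟨s, hs⟩ := hf.exists_evalFamily hM hu m h
    exact ⟨e.symm s, by rw [hj, e.apply_symm_apply, hs]⟩

end IsSieve

/-- The restriction of compatible families, in a small model. -/
noncomputable def restrictShrink {b b' : Z.Point} (v : b' ⟶ b) [Small.{0} (f.families M b)]
    [Small.{0} (f.families M b')] :
    Shrink.{0} (f.families M b) →ₛₗ[(Z.O.map v.op).hom] Shrink.{0} (f.families M b') :=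
  ((Shrink.linearEquiv (Z.O.obj (op b')) (f.families M b')).symm.toLinearMap.comp
    (restrictFamily v)).comp (Shrink.linearEquiv (Z.O.obj (op b)) (f.families M b)).toLinearMap

lemma linearEquiv_restrictShrink {b b' : Z.Point} (v : b' ⟶ b) [Small.{0} (f.families M b)]
    [Small.{0} (f.families M b')] (x : Shrink.{0} (f.families M b)) :
    Shrink.linearEquiv (Z.O.obj (op b')) (f.families M b') (restrictShrink v x) =
      restrictFamily v (Shrink.linearEquiv (Z.O.obj (op b)) (f.families M b) x) :=
  LinearEquiv.apply_symm_apply _ _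

lemma restrictFamily_id {b : Z.Point} (s : f.families M b) : restrictFamily (𝟙 b) s = s :=
  family_ext fun a w => congrArg (s.1 a) (Category.comp_id w)

lemma restrictFamily_comp {b b' b'' : Z.Point} (v : b' ⟶ b) (v' : b'' ⟶ b')
    (s : f.families M b) :
    restrictFamily (v' ≫ v) s = restrictFamily v' (restrictFamily v s) :=
  family_ext fun a w => congrArg (s.1 a) (Category.assoc w v' v).symm

lemma restrictShrink_id {b : Z.Point} [Small.{0} (f.families M b)]
    (x : Shrink.{0} (f.families M b)) : restrictShrink (𝟙 b) x = x :=
  (Shrink.linearEquiv (Z.O.obj (op b)) (f.families M b)).injective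
    ((linearEquiv_restrictShrink _ _).trans (restrictFamily_id _))

lemma restrictShrink_comp {b b' b'' : Z.Point} (v : b' ⟶ b) (v' : b'' ⟶ b')
    [Small.{0} (f.families M b)] [Small.{0} (f.families M b')] [Small.{0} (f.families M b'')]
    (x : Shrink.{0} (f.families M b)) :
    restrictShrink (v' ≫ v) x = restrictShrink v' (restrictShrink v x) :=
  (Shrink.linearEquiv (Z.O.obj (op b'')) (f.families M b'')).injective <| by
    rw [linearEquiv_restrictShrink, linearEquiv_restrictShrink, linearEquiv_restrictShrink,
      restrictFamily_comp]

variable (f M) in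
/-- The presheaf of modules of compatible families. -/
noncomputable def descend [∀ b, Small.{0} (f.families M b)] : Z.PMod :=
  mkPMod (fun b => ModuleCat.of (Z.O.obj b) (Shrink.{0} (f.families M b.unop)))
    (fun _ _ v => restrictShrink v.unop) (fun _ => restrictShrink_id)
    (fun _ _ _ v v' => restrictShrink_comp v.unop v'.unop)

section

variable [∀ b, Small.{0} (f.families M b)]

/-- The family attached to a section of the presheaf of compatible families. -/
noncomputable def descendEquiv (b : Z.Point) :
    sec (f.descend M) (op b) ≃ₗ[Z.O.obj (op b)] f.families M b :=
  Shrink.linearEquiv (Z.O.obj (op b)) (f.families M b)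

/-- The value of a section of the presheaf of compatible families. -/
noncomputable def evalDescend {a : Y.Point} {b : Z.Point} (w : f.points.obj a ⟶ b) :
    sec (f.descend M) (op b) →ₛₗ[(f.resO w).hom] sec M (op a) :=
  (evalFamily w).comp (descendEquiv b).toLinearMap

lemma evalDescend_resMap {a : Y.Point} {b b' : Z.Point} (v : b' ⟶ b) (w : f.points.obj a ⟶ b')
    (x : sec (f.descend M) (op b)) :
    evalDescend w (resMap (f.descend M) v.op x) = evalDescend (w ≫ v) x :=
  congrArg (evalFamily w) (linearEquiv_restrictShrink v x)

lemma resMap_evalDescend {a a' : Y.Point} {b : Z.Point} (t : a' ⟶ a) (w : f.points.obj a ⟶ b)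
    (x : sec (f.descend M) (op b)) :
    resMap M t.op (evalDescend w x) = evalDescend (f.points.map t ≫ w) x :=
  resMap_evalFamily t w _

lemma IsSieve.isBaseChangeMap_evalDescend (hf : f.IsSieve) (hM : isCartesian Y M) {a : Y.Point}
    {b : Z.Point} {u : f.points.obj a ⟶ b} (hu : (f.resO u).hom.FaithfullyFlat) :
    IsBaseChangeMap (evalDescend (M := M) u) :=
  hf.isBaseChangeMap_evalFamily hM hu (descendEquiv b) _ fun _ => rfl

end

end Hom

end ActedScheme

-- Pullback along a covering sieve is an equivalence

namespace ActedScheme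

open Limits Opposite SymComplex

variable {Y Z : ActedScheme} {f : Hom Y Z}

/-- An isomorphism of presheaves of modules from bijective linear maps on sections. -/
noncomputable def mkIso {M N : Y.PMod} (F : ∀ p, sec M p →ₗ[Y.O.obj p] sec N p)
    (hF : ∀ p, Function.Bijective (F p))
    (h : ∀ ⦃p q : Y.Pointᵒᵖ⦄ (g : p ⟶ q) (m : sec M p), F q (resMap M g m) = resMap N g (F p m)) :
    M ≅ N :=
  PresheafOfModules.isoMk (fun p => (LinearEquiv.ofBijective (F p) (hF p)).toModuleIso)
    (fun _ _ g => (mkMap F h).naturality g)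

lemma faithfullyFlat_id (R : CommRingCat.{0}) : (CommRingCat.Hom.hom (𝟙 R)).FaithfullyFlat :=
  RingHom.FaithfullyFlat.of_bijective Function.bijective_id

namespace Hom

variable (f) in
/-- Every affine point of `Z` is covered by the image of an affine point of `Y`. -/
def IsCovering : Prop :=
  ∀ b : Z.Point, ∃ (a : Y.Point) (u : f.points.obj a ⟶ b), (f.resO u).hom.FaithfullyFlat

lemma resO_id (a : Y.Point) : f.resO (𝟙 (f.points.obj a)) = 𝟙 _ :=
  Z.O.map_id (op (f.points.obj a))

namespace IsSieve

variable (hf : f.IsSieve)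

include hf

/-- Although families are indexed by all points over `b`, they embed in the sections over one cover.
-/
lemma small_families (hc : f.IsCovering) {M : Y.PMod} (hM : isCartesian Y M) (b : Z.Point) :
    Small.{0} (f.families M b) := by
  obtain ⟨a, u, hu⟩ := hc b
  exact small_of_injective (hf.evalFamily_injective hM hu)

/-- For `v : b' ⟶ b`, choose a cover `u` of `b` and pull it back along `v` to a cover `g₁` of `b'`.
Families over `b` become sections of `M` over the fibre product by base change, through `u` and then
the cartesian module `M`. Families over `b'` do so through the faithfully flat `g₁`, which can be
cancelled by `IsBaseChangeMap.of_faithfullyFlat`. -/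
lemma isCartesian_descend (hc : f.IsCovering) {M : Y.PMod} (hM : isCartesian Y M)
    [∀ b, Small.{0} (f.families M b)] : isCartesian Z (f.descend M) := by
  refine (isCartesian_iff _).2 fun b b' v => ?_
  obtain ⟨b⟩ := b
  obtain ⟨b'⟩ := b'
  obtain ⟨v, rfl⟩ : ∃ v', v = Quiver.Hom.op v' := ⟨v.unop, rfl⟩
  obtain ⟨a, u, hu⟩ := hc b
  obtain ⟨a', g, g₁, h, h'⟩ := hf.exists_isPullback u v
  have hg₁ := faithfullyFlat_of_isPushout h' hu
  have : RingHomCompTriple (f.resO u).hom (Y.O.map g.op).hom (f.resO u ≫ Y.O.map g.op).hom := ⟨rfl⟩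
  have : RingHomCompTriple (Z.O.map v.op).hom (f.resO g₁).hom (f.resO u ≫ Y.O.map g.op).hom :=
    ⟨congrArg CommRingCat.Hom.hom h'.w.symm⟩
  let k : sec (f.descend M) (op b) →ₛₗ[(f.resO u ≫ Y.O.map g.op).hom] sec M (op a') :=
    (resMap M g.op).comp (evalDescend u)
  refine IsBaseChangeMap.of_faithfullyFlat (k := k) hg₁ (hf.isBaseChangeMap_evalDescend hM hg₁)
    ((hf.isBaseChangeMap_evalDescend hM hu).comp ((isCartesian_iff M).1 hM g.op) _ fun _ => rfl)
    fun x => ?_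
  refine (resMap_evalDescend g u x).trans ?_
  rw [evalDescend_resMap, h.w]

/-- The value of the family at one cover descends to a section over `b`. The family defined by this
section agrees with the given one on that cover, hence everywhere. -/
lemma exists_glue (hc : f.IsCovering) {N : Z.PMod} (hN : isCartesian Z N) {b : Z.Point}
    (s : f.families (f.pullbackPMod.obj N) b) :
    ∃ n : sec N (op b), ∀ (a : Y.Point) (w : f.points.obj a ⟶ b), resMap N w.op n = s.1 a w := by
  have := hf.full
  obtain ⟨a, u, hu⟩ := hc b
  obtain ⟨n, hn⟩ := (bijective_resMap hN (u := u) hu).2 (s.1 a u) fun t g h e => by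
    -- The test point `t` is an arbitrary point of `Z`, whereas the family is defined only on image
    -- points. As `t` maps to the image of `a`, it is isomorphic to an image point, and the descent
    -- condition is checked there.
    obtain ⟨a', ⟨i⟩⟩ := hf.exists_iso g
    obtain ⟨g', hg⟩ := f.points.map_surjective (i.hom ≫ g)
    obtain ⟨h', hh⟩ := f.points.map_surjective (i.hom ≫ h)
    have key : resMap N (i.hom ≫ g).op (s.1 a u) = resMap N (i.hom ≫ h).op (s.1 a u) := by
      rw [← hg, ← hh]
      refine (s.2 a a' g' u).trans (Eq.trans ?_ (s.2 a a' h' u).symm)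
      rw [hg, hh, Category.assoc, Category.assoc, e]
    have key' := congrArg (resMap N i.inv.op) key
    have e1 := resMap_op_comp N i.inv (i.hom ≫ g) (s.1 a u)
    have e2 := resMap_op_comp N i.inv (i.hom ≫ h) (s.1 a u)
    rw [i.inv_hom_id_assoc] at e1 e2
    exact e1.trans (key'.trans e2.symm)
  have hN' : isCartesian Y (f.pullbackPMod.obj N) := fun _ _ g => hN (f.points.op.map g)
  let s' : f.families (f.pullbackPMod.obj N) b :=
    ⟨fun a w => resMap N w.op n, fun a a' t w => (resMap_op_comp N (f.points.map t) w n).symm⟩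
  have hs : s' = s := hf.evalFamily_injective hN' hu hn
  exact ⟨n, fun a w => congrArg (fun s => s.1 a w) hs⟩

/-- A comparison theorem for sheaves on a covering sieve. Faithfulness is injectivity of restriction
to a cover; fullness is gluing of the images of sections under the given morphism; essential
surjectivity uses the module of compatible families. -/
lemma isEquivalence_pullback (hc : f.IsCovering) : f.pullback.IsEquivalence where
  faithful := ⟨fun {N N'} g h e => by
    ext1
    refine pmod_hom_ext fun p => ?_
    obtain ⟨b⟩ := p
    ext n
    obtain ⟨a, u, hu⟩ := hc b
    refine (bijective_resMap N'.property (u := u) hu).1 ?_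
    refine (resMap_secMap g.hom u.op n).trans (Eq.trans ?_ (resMap_secMap h.hom u.op n).symm)
    exact congrArg (fun k : f.pullback.obj N ⟶ f.pullback.obj N' =>
      (secMap k.hom (op a)).hom (resMap N.obj u.op n)) e⟩
  full := ⟨fun {N N'} χ => by
    -- Sections over `b` are separated by the image points over `b`. This yields linearity and
    -- naturality of the glued map.
    have inj : ∀ {b : Z.Point} {x y : sec N'.obj (op b)}, (∀ (a : Y.Point)
        (w : f.points.obj a ⟶ b), resMap N'.obj w.op x = resMap N'.obj w.op y) → x = y := by
      intro b x y h
      obtain ⟨a, u, hu⟩ := hc b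
      exact (bijective_resMap N'.property (u := u) hu).1 (h a u)
    have key : ∀ (b : Z.Point) (n : sec N.obj (op b)), ∃ n' : sec N'.obj (op b),
        ∀ (a : Y.Point) (w : f.points.obj a ⟶ b), resMap N'.obj w.op n' =
          (secMap χ.hom (op a)).hom (resMap N.obj w.op n) := fun b n =>
      hf.exists_glue hc N'.property ⟨fun a w => (secMap χ.hom (op a)).hom (resMap N.obj w.op n),
        fun a a' t w => (resMap_secMap χ.hom t.op _).trans (congrArg (secMap χ.hom (op a')).hom
          (resMap_op_comp N.obj (f.points.map t) w n).symm)⟩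
    choose F hF using key
    let F' : ∀ p, sec N.obj p →ₗ[Z.O.obj p] sec N'.obj p := fun p =>
      { toFun := F p.unop
        map_add' := fun x y => inj (b := p.unop) fun a w => by
          rw [hF, map_add, map_add, hF, hF]
          exact map_add (secMap χ.hom (op a)).hom _ _
        map_smul' := fun r x => inj (b := p.unop) fun a w => by
          rw [hF]
          refine (congrArg (secMap χ.hom (op a)).hom ((resMap N.obj w.op).map_smulₛₗ r x)).trans ?_
          refine (map_smul (secMap χ.hom (op a)).hom _ _).trans ?_
          refine Eq.trans ?_ ((resMap N'.obj w.op).map_smulₛₗ r _).symm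
          exact congrArg _ (hF _ _ _ _).symm }
    refine ⟨ObjectProperty.homMk (mkMap F' fun p q v n => inj (b := q.unop) fun a w => ?_), ?_⟩
    · refine (hF _ _ _ _).trans ?_
      refine Eq.trans ?_ (resMap_op_comp N'.obj w v.unop _)
      refine Eq.trans ?_ (hF _ _ _ _).symm
      exact congrArg _ (resMap_op_comp N.obj w v.unop n).symm
    · ext1
      refine pmod_hom_ext fun p => ?_
      obtain ⟨a⟩ := p
      ext n
      refine (resMap_op_id N'.obj (p := f.points.obj a) (F _ n)).symm.trans ?_
      refine (hF _ n a (𝟙 _)).trans ?_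
      exact congrArg (secMap χ.hom (op a)).hom (resMap_op_id N.obj (p := f.points.obj a) n)⟩
  essSurj := ⟨fun M => by
    have := hf.faithful
    have := fun b => hf.small_families hc M.property b
    -- Over an image point a family is determined by its value at the identity, which can be
    -- prescribed arbitrarily. Bijectivity of `F` is thus the case of the identity cover; there the
    -- descent condition is vacuous by faithfulness of the functor on points.
    let F : ∀ p, sec (f.pullbackPMod.obj (f.descend M.obj)) p →ₗ[Y.O.obj p] sec M.obj p := fun p =>
      { toFun := evalDescend (M := M.obj) (𝟙 (f.points.obj p.unop))
        map_add' := map_add _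
        map_smul' := fun r x => by
          refine (LinearMap.map_smulₛₗ (evalDescend (M := M.obj) (𝟙 (f.points.obj p.unop))) r x).trans ?_
          exact congrArg (fun t : Y.O.obj p ⟶ Y.O.obj p => t.hom r • (evalDescend (M := M.obj)
            (𝟙 (f.points.obj p.unop)) x : sec M.obj p)) (resO_id p.unop) }
    have hF : ∀ p, Function.Bijective (F p) := fun p => by
      have hu : (f.resO (𝟙 (f.points.obj p.unop))).hom.FaithfullyFlat := by
        rw [resO_id]
        exact faithfullyFlat_id _
      have h1 := hf.evalFamily_injective M.property hu
      have h2 := hf.exists_evalFamily M.property hu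
      refine ⟨h1.comp (descendEquiv _).injective, fun m => ?_⟩
      obtain ⟨s, hs⟩ := h2 m fun t g h e => by
        rw [Category.comp_id, Category.comp_id] at e
        rw [f.points.map_injective e]
      exact ⟨(descendEquiv _).symm s, (congrArg _ ((descendEquiv _).apply_symm_apply s)).trans hs⟩
    refine ⟨⟨f.descend M.obj, hf.isCartesian_descend hc M.property⟩,
      ⟨(isCartesian Y).isoMk (mkIso F hF fun p q g x => ?_)⟩⟩
    refine (evalDescend_resMap (f.points.map g.unop) (𝟙 _) x).trans ?_
    refine Eq.trans ?_ (resMap_evalDescend g.unop (𝟙 _) x).symm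
    rw [Category.id_comp, Category.comp_id]⟩

end IsSieve

end Hom

end ActedScheme

-- The two morphisms `G × X ⟶ X` and `G × X ⟶ X'` are covering sieves

section

open ActedScheme Opposite

variable {G H : Over SpecC} [GrpObj G] [GrpObj H] (ρ : H ⟶ G) [IsMonHom ρ]
  (X : Over SpecC) [ModObj H X]

lemma smul_eq_iff_inductionAction {T : Over SpecC} (k : T ⟶ G ⊗ H) (z z' : T ⟶ G ⊗ X) :
    (let _ := inductionAction ρ X; k • z = z') ↔
      lift ((k ≫ fst G H) * (z ≫ fst G X) * (k ≫ snd G H ≫ ρ)⁻¹)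
        ((k ≫ snd G H) • (z ≫ snd G X)) = z' := by
  rw [← inductionAction_smul ρ X k z]

lemma ActedScheme.Point.mk_eq {Y : ActedScheme} {T : Over SpecC} [IsAffine T.left]
    {x y : T ⟶ Y.space} (h : x = y) : (⟨T, x⟩ : Y.Point) = ⟨T, y⟩ := by rw [h]

/-- A morphism in `G × H` between points of `G × X` is the same as its `H`-component, since `G` acts
simply transitively on the first coordinate. Any point `x` of `X` is the image of `(1, x)`. -/
lemma isSieve_inductionPr : (inductionPr ρ X).IsSieve where
  full := ⟨fun {p q} u => by
    obtain ⟨b, h, e⟩ := u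
    change p.base ⟶ q.base at b
    change p.base ⟶ H at h
    change h • (b ≫ q.pt ≫ snd G X) = p.pt ≫ snd G X at e
    -- The `G`-component is the solution `g` of `g g₁ ρ(h)⁻¹ = g₂`, with `g₁` and `g₂` the
    -- `G`-coordinates of the pulled back `q` and of `p`.
    refine ⟨⟨b, lift ((p.pt ≫ fst G X) * (h ≫ ρ) * (b ≫ q.pt ≫ fst G X)⁻¹) h,
      (smul_eq_iff_inductionAction ρ X _ _ _).2 ?_⟩, Point.Hom.ext rfl (lift_snd _ _)⟩
    refine CartesianMonoidalCategory.hom_ext _ _ ?_ ?_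
    · rw [lift_fst, lift_fst, lift_snd_assoc, Category.assoc, inv_mul_cancel_right,
        mul_inv_cancel_right]
    · rw [lift_snd, lift_snd, Category.assoc, e]⟩
  faithful := ⟨fun {p q} u v e => by
    have hb := congrArg Point.Hom.base e
    have he := congrArg Point.Hom.elt e
    change u.base = v.base at hb
    change u.elt ≫ snd G H = v.elt ≫ snd G H at he
    refine Point.Hom.ext hb (CartesianMonoidalCategory.hom_ext _ _ ?_ he)
    have hu := congrArg (· ≫ fst G X) ((smul_eq_iff_inductionAction ρ X _ _ _).1 u.smul_eq)
    have hv := congrArg (· ≫ fst G X) ((smul_eq_iff_inductionAction ρ X _ _ _).1 v.smul_eq)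
    dsimp only at hu hv
    rw [lift_fst] at hu hv
    have h := hu.trans hv.symm
    rw [hb, reassoc_of% he] at h
    exact mul_right_cancel (mul_right_cancel h)⟩
  exists_iso {a b} v :=
    have := b.isAffine
    ⟨⟨b.base, lift 1 b.pt⟩, ⟨eqToIso (Point.mk_eq (lift_snd _ _))⟩⟩

/-- The unit section of `G` lifts every point, so the identity serves as a cover. -/
lemma isCovering_inductionPr : (inductionPr ρ X).IsCovering := fun b => by
  have := b.isAffine
  refine ⟨⟨b.base, lift 1 b.pt⟩, ⟨𝟙 _, 1, ?_⟩, ?_⟩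
  · exact (one_smul _ _).trans ((Category.id_comp _).trans (lift_snd _ _).symm)
  · change (CommRingCat.Hom.hom (𝟙 b.base.left : b.base.left ⟶ b.base.left).appTop).FaithfullyFlat
    rw [Scheme.Hom.id_appTop]
    exact faithfullyFlat_id _

lemma isEquivalence_pullback_inductionPr : (inductionPr ρ X).pullback.IsEquivalence :=
  (isSieve_inductionPr ρ X).isEquivalence_pullback (isCovering_inductionPr ρ X)

/-- An fppf morphism to an affine scheme is dominated by a faithfully flat morphism from an affine
scheme. -/
lemma exists_faithfullyFlat {P T : Scheme.{0}} [IsAffine T] (p : P ⟶ T) [Flat p] [Surjective p]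
    [LocallyOfFinitePresentation p] :
    ∃ (S : Scheme.{0}) (_ : IsAffine S) (s : S ⟶ P), (s ≫ p).appTop.hom.FaithfullyFlat := by
  let 𝒰 := P.affineCover
  -- Flat morphisms locally of finite presentation are open and `T` is quasi-compact, so finitely
  -- many affine pieces of `P` already cover `T`. Their coproduct is affine.
  obtain ⟨t, ht⟩ := isCompact_univ.elim_finite_subcover (fun i => Set.range (𝒰.f i ≫ p))
    (fun i => (𝒰.f i ≫ p).isOpenMap.isOpen_range) fun x _ => by
      obtain ⟨y, rfl⟩ := p.surjective x
      obtain ⟨i, z, rfl⟩ := 𝒰.exists_eq y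
      exact Set.mem_iUnion.2 ⟨i, z, by simp⟩
  let s : (∐ fun i : t => 𝒰.X i) ⟶ P := Limits.Sigma.desc fun i => 𝒰.f i
  refine ⟨_, inferInstance, s, ?_⟩
  refine (Flat.flat_and_surjective_iff_faithfullyFlat_of_isAffine _).1 ⟨?_, ⟨fun x => ?_⟩⟩
  · have : Flat s := inferInstanceAs (Flat (Limits.Sigma.desc _))
    infer_instance
  · obtain ⟨i, hi, z, rfl⟩ := Set.mem_iUnion₂.1 (ht (Set.mem_univ x))
    refine ⟨Limits.Sigma.ι (fun i : t => 𝒰.X i) ⟨i, hi⟩ z, ?_⟩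
    rw [← Scheme.Hom.comp_apply, Limits.Sigma.ι_desc_assoc]

variable {ρ X} {X' : Over SpecC} [ModObj G X'] {π : G ⊗ X ⟶ X'} (hπ : IsInducedSpace ρ π)

include hπ

/-- Equivariance of `π` turns a morphism `g` between image points into an equality of images of `g •
q` and `p`. The torsor condition then yields the missing `H`-component, and its uniqueness gives
faithfulness. A point mapping to an image point by `g` is lifted by translating the given lift by
`g`. -/
lemma IsInducedSpace.isSieve : hπ.hom.IsSieve where
  full := ⟨fun {p q} u => by
    obtain ⟨b, g, e⟩ := u
    change p.base ⟶ q.base at b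
    change p.base ⟶ G at g
    change g • (b ≫ q.pt ≫ π) = p.pt ≫ π at e
    rw [← Category.assoc, ← hπ.smul_comp] at e
    obtain ⟨h, hh, -⟩ := hπ.existsUnique_smul _ _ _ e
    rw [lift_fst, lift_snd] at hh
    refine ⟨⟨b, lift g h, (smul_eq_iff_inductionAction ρ X _ _ _).2 ?_⟩,
      Point.Hom.ext rfl (lift_fst _ _)⟩
    rw [lift_fst, lift_snd, lift_snd_assoc]
    exact hh⟩
  faithful := ⟨fun {p q} u v e => by
    have hb := congrArg Point.Hom.base e
    have he := congrArg Point.Hom.elt e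
    change u.base = v.base at hb
    change u.elt ≫ fst G H = v.elt ≫ fst G H at he
    refine Point.Hom.ext hb (CartesianMonoidalCategory.hom_ext _ _ he ?_)
    have hu := (smul_eq_iff_inductionAction ρ X _ _ _).1 u.smul_eq
    have hv := (smul_eq_iff_inductionAction ρ X _ _ _).1 v.smul_eq
    rw [hb, he] at hu
    have h0 := hπ.smul_comp _ (v.elt ≫ fst G H) (v.base ≫ q.pt)
    have h1 : (v.elt ≫ fst G H) • (v.base ≫ q.pt ≫ π) = p.pt ≫ π := (hπ.hom.points.map v).smul_eq
    -- The `H`-components of `u` and `v` both carry the translate of `q` to `p`, so both equal the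
    -- unique such element.
    obtain ⟨h, -, hh⟩ := hπ.existsUnique_smul _ (lift ((v.elt ≫ fst G H) *
      ((v.base ≫ q.pt) ≫ fst G X)) ((v.base ≫ q.pt) ≫ snd G X)) p.pt (by
        rw [h0, Category.assoc, h1])
    simp only [lift_fst, lift_snd] at hh
    rw [hh (u.elt ≫ snd G H) (by rw [Category.assoc u.elt]; exact hu),
      hh (v.elt ≫ snd G H) (by rw [Category.assoc v.elt]; exact hv)]⟩
  exists_iso {a b} v := by
    have := b.isAffine
    obtain ⟨f, g, e⟩ := v
    change b.base ⟶ a.base at f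
    change b.base ⟶ G at g
    change g • (f ≫ a.pt ≫ π) = b.pt at e
    rw [← Category.assoc, ← hπ.smul_comp] at e
    exact ⟨⟨b.base, lift (g * ((f ≫ a.pt) ≫ fst G X)) ((f ≫ a.pt) ≫ snd G X)⟩,
      ⟨eqToIso (Point.mk_eq e)⟩⟩

/-- The base change of `π` along the given point is flat, surjective and locally of finite
presentation, so it is refined by an affine faithfully flat scheme mapping to `G × X`. The group
component is taken to be `1`. -/
lemma IsInducedSpace.isCovering : hπ.hom.IsCovering := fun b => by
  have := b.isAffine
  have := hπ.flat
  have := hπ.surjective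
  have := hπ.locallyOfFinitePresentation
  obtain ⟨S, _, s, hs⟩ := exists_faithfullyFlat (Limits.pullback.snd π.left b.pt.left)
  have e : (s ≫ Limits.pullback.fst π.left b.pt.left) ≫ π.left =
      (s ≫ Limits.pullback.snd π.left b.pt.left) ≫ b.pt.left := by
    rw [Category.assoc, Limits.pullback.condition, Category.assoc]
  let a₀ : Over SpecC := Over.mk ((s ≫ Limits.pullback.snd π.left b.pt.left) ≫ b.base.hom)
  let v : a₀ ⟶ b.base := Over.homMk (s ≫ Limits.pullback.snd π.left b.pt.left) rfl
  let z : a₀ ⟶ G ⊗ X := Over.homMk (s ≫ Limits.pullback.fst π.left b.pt.left) (by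
    rw [← Over.w π, ← Category.assoc, e, Category.assoc]
    exact congrArg _ (Over.w b.pt))
  have hz : v ≫ b.pt = z ≫ π := by
    ext1
    exact e.symm
  have : IsAffine a₀.left := ‹IsAffine S›
  exact ⟨⟨a₀, z⟩, ⟨v, 1, (one_smul _ _).trans hz⟩, hs⟩

lemma IsInducedSpace.isEquivalence_pullback : hπ.hom.pullback.IsEquivalence :=
  hπ.isSieve.isEquivalence_pullback hπ.isCovering

end

-- Monoidal quasi-inverses and lifting dg-algebra isomorphisms

section

open Functor Functor.LaxMonoidal Functor.Monoidal

/-- Maps out of the image of `I` are specified by maps in `E` out of the image of `F`, through `a`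
and the faithful `G`. An identity between them is inherited from `E`. The lemmas `lift_one` and
`lift_mul` do this for units and products, where `a` must be monoidal. -/
lemma lift_comm {C D E : Type*} [Category* C] [Category* D] [Category* E] {I : C ⥤ D} {G : D ⥤ E}
    [G.Faithful] {F : C ⥤ E} (a : I ⋙ G ≅ F) {X Y : C} {X' Y' : D} {d : X ⟶ Y} {d' : X' ⟶ Y'} {u : I.obj X ⟶ X'}
    {v : I.obj Y ⟶ Y'} {s : F.obj X ⟶ G.obj X'} {t : F.obj Y ⟶ G.obj Y'}
    (hu : G.map u = a.hom.app X ≫ s) (hv : G.map v = a.hom.app Y ≫ t)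
    (h : s ≫ G.map d' = F.map d ≫ t) : u ≫ d' = I.map d ≫ v := by
  refine G.map_injective ?_
  have := a.hom.naturality d
  dsimp only [Functor.comp_map] at this
  rw [G.map_comp, G.map_comp, hu, hv, Category.assoc, h, reassoc_of% this]

variable {C D E : Type*} [Category* C] [Category* D] [Category* E] [MonoidalCategory C]
  [MonoidalCategory D] [MonoidalCategory E]

/-- A monoidal functor is braided if its composition with a faithful braided functor is isomorphic
to a braided functor. -/
@[reducible]
def CategoryTheory.Functor.Braided.ofCompIso [BraidedCategory C] [BraidedCategory D]
    [BraidedCategory E] {I : C ⥤ D} [I.Monoidal] {G : D ⥤ E} [G.Braided] [G.Faithful] {F : C ⥤ E}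
    [F.Braided] (a : I ⋙ G ≅ F) [NatTrans.IsMonoidal a.hom] : I.Braided where
  braided X Y := by
    have h : ∀ X Y, G.map (Functor.LaxMonoidal.μ I X Y) = Functor.OplaxMonoidal.δ G _ _ ≫
        (a.hom.app X ⊗ₘ a.hom.app Y) ≫ Functor.LaxMonoidal.μ F X Y ≫ a.inv.app (X ⊗ Y) := by
      intro X Y
      have := NatTrans.IsMonoidal.tensor (τ := a.hom) X Y
      rw [Functor.LaxMonoidal.comp_μ] at this
      rw [← reassoc_of% this]
      simp
    refine G.map_injective ?_
    rw [← cancel_epi (Functor.LaxMonoidal.μ G (I.obj X) (I.obj Y)), G.map_comp, G.map_comp, h, h,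
      Functor.map_braiding G]
    have e := a.inv.naturality (β_ X Y).hom
    dsimp only [Functor.comp_map] at e
    simp only [Category.assoc, ← e, Functor.map_braiding F, Monoidal.μ_δ_assoc,
      BraidedCategory.braiding_naturality_assoc]

/-- Two equivalences of braided linear categories with the same target differ by an equivalence of
the sources. -/
lemma exists_braided_linear_equivalence (k : Type*) [CommRing k] [BraidedCategory C]
    [BraidedCategory D] [BraidedCategory E] [Preadditive C] [Preadditive D] [Preadditive E]
    [Linear k C] [Linear k D] [Linear k E] (F : C ⥤ E) (G : D ⥤ E) [F.Braided] [G.Braided]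
    [F.Additive] [G.Additive] [F.Linear k] [G.Linear k] [F.IsEquivalence] [G.IsEquivalence] :
    ∃ (I : C ⥤ D) (_ : I.Braided) (_ : I.Additive) (_ : I.Linear k) (a : I ⋙ G ≅ F),
      I.IsEquivalence ∧ NatTrans.IsMonoidal a.hom := by
  -- Replacing `G` by the functor of an equivalence makes its quasi-inverse a right adjoint, which
  -- therefore carries a canonical lax monoidal structure with monoidal counit.
  obtain ⟨e, rfl⟩ : ∃ e : D ≌ E, e.functor = G := ⟨G.asEquivalence, rfl⟩
  obtain ⟨_, _⟩ : ∃ M : e.inverse.Monoidal, NatTrans.IsMonoidal e.toAdjunction.counit := by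
    let _ : e.inverse.LaxMonoidal := e.toAdjunction.rightAdjointLaxMonoidal
    have h : NatTrans.IsMonoidal e.toAdjunction.counit := inferInstance
    -- The structure maps of the right adjoint are adjoint transposes of isomorphisms. Since the
    -- unit is invertible, they are isomorphisms, so the lax structure is strong.
    have : IsIso (Functor.LaxMonoidal.ε e.inverse) := by
      rw [Adjunction.rightAdjointLaxMonoidal_ε, Adjunction.homEquiv_unit]
      infer_instance
    have (X Y : E) : IsIso (Functor.LaxMonoidal.μ e.inverse X Y) := by
      rw [Adjunction.rightAdjointLaxMonoidal_μ, Adjunction.homEquiv_unit]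
      infer_instance
    exact ⟨Monoidal.ofLaxMonoidal e.inverse, h⟩
  let a : (F ⋙ e.inverse) ⋙ e.functor ≅ F := Functor.associator _ _ _ ≪≫
    Functor.isoWhiskerLeft F e.counitIso ≪≫ F.rightUnitor
  have ha : NatTrans.IsMonoidal a.hom := by
    change NatTrans.IsMonoidal ((Functor.associator F e.inverse e.functor).hom ≫
      Functor.whiskerLeft F e.toAdjunction.counit ≫ F.rightUnitor.hom)
    infer_instance
  exact ⟨F ⋙ e.inverse, Functor.Braided.ofCompIso a, inferInstance, inferInstance, a,
    inferInstance, ha⟩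

/-- A morphism of dg-algebras whose components are isomorphisms is an isomorphism. -/
noncomputable def DGAlgebra.isoOfIsIso [Preadditive D] {A B : DGAlgebra D} (t : A ⟶ B)
    [∀ n, IsIso (t.hom.f n)] : A ≅ B :=
  have : IsIso t.hom := HomologicalComplex.Hom.isIso_of_components _
  { hom := t
    inv :=
      { hom := inv t.hom
        one_hom := by
          rw [← t.one_hom, Category.assoc, ← HomologicalComplex.comp_f, IsIso.hom_inv_id,
            HomologicalComplex.id_f, Category.comp_id]
        mul_hom := fun p q r h => by
          have e (n : ℤ) : t.hom.f n ≫ (inv t.hom).f n = 𝟙 _ := by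
            rw [← HomologicalComplex.comp_f, IsIso.hom_inv_id, HomologicalComplex.id_f]
          rw [← cancel_epi (t.hom.f p ⊗ₘ t.hom.f q), ← reassoc_of% t.mul_hom, e, Category.comp_id,
            tensorHom_comp_tensorHom_assoc, e, e, tensorHom_id, id_whiskerRight,
            Category.id_comp] }
    hom_inv_id := DGAlgebra.Hom.ext (IsIso.hom_inv_id _)
    inv_hom_id := DGAlgebra.Hom.ext (IsIso.inv_hom_id _) }

section

variable {I : C ⥤ D} {G : D ⥤ E} [G.Faithful] {F : C ⥤ E} (a : I ⋙ G ≅ F)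

variable [I.Monoidal] [G.Monoidal] [F.Monoidal] [NatTrans.IsMonoidal a.hom]

lemma lift_one {X : C} {X' : D} {o : 𝟙_ C ⟶ X} {o' : 𝟙_ D ⟶ X'} {u : I.obj X ⟶ X'}
    {s : F.obj X ⟶ G.obj X'} (hu : G.map u = a.hom.app X ≫ s)
    (h : (Functor.LaxMonoidal.ε F ≫ F.map o) ≫ s = Functor.LaxMonoidal.ε G ≫ G.map o') :
    (Functor.LaxMonoidal.ε I ≫ I.map o) ≫ u = o' := by
  refine G.map_injective ?_
  have h2 := NatTrans.IsMonoidal.unit (τ := a.hom)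
  have h3 := a.hom.naturality o
  rw [Functor.LaxMonoidal.comp_ε] at h2
  dsimp only [Functor.comp_map] at h3
  rw [← cancel_epi (Functor.LaxMonoidal.ε G), ← h, ← h2, G.map_comp, G.map_comp, hu]
  simp only [Category.assoc, reassoc_of% h3]

lemma lift_mul {X Y Z : C} {X' Y' Z' : D} {m : X ⊗ Y ⟶ Z} {m' : X' ⊗ Y' ⟶ Z'} {u : I.obj X ⟶ X'}
    {v : I.obj Y ⟶ Y'} {w : I.obj Z ⟶ Z'} {s : F.obj X ⟶ G.obj X'} {t : F.obj Y ⟶ G.obj Y'}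
    {r : F.obj Z ⟶ G.obj Z'} (hu : G.map u = a.hom.app X ≫ s) (hv : G.map v = a.hom.app Y ≫ t)
    (hw : G.map w = a.hom.app Z ≫ r)
    (h : (Functor.LaxMonoidal.μ F X Y ≫ F.map m) ≫ r =
      (s ⊗ₘ t) ≫ Functor.LaxMonoidal.μ G X' Y' ≫ G.map m') :
    (Functor.LaxMonoidal.μ I X Y ≫ I.map m) ≫ w = (u ⊗ₘ v) ≫ m' := by
  refine G.map_injective ?_
  have h2 := NatTrans.IsMonoidal.tensor (τ := a.hom) X Y
  have h3 := a.hom.naturality m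
  rw [Functor.LaxMonoidal.comp_μ] at h2
  dsimp only [Functor.comp_map, Functor.comp_obj] at h3 h2
  rw [← cancel_epi (Functor.LaxMonoidal.μ G _ _), G.map_comp (u ⊗ₘ v),
    ← Functor.LaxMonoidal.μ_natural_assoc, hu, hv, ← tensorHom_comp_tensorHom_assoc, ← h,
    G.map_comp, G.map_comp, hw]
  simp only [Category.assoc, reassoc_of% h3] at h2 ⊢
  rw [reassoc_of% h2]

end

/-- Isomorphisms of dg-algebras lift along fully faithful monoidal functors. -/
lemma DGAlgebra.exists_iso_of_map [Preadditive C] [Preadditive D] [Preadditive E] {I : C ⥤ D}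
    [I.Monoidal] [I.Additive] {G : D ⥤ E} [G.Monoidal] [G.Additive] [G.Full] [G.Faithful]
    {F : C ⥤ E} [F.Monoidal] [F.Additive] (a : I ⋙ G ≅ F) [NatTrans.IsMonoidal a.hom]
    {A : DGAlgebra C} {B : DGAlgebra D} (t : A.map F ⟶ B.map G) (ht : ∀ n, IsIso (t.hom.f n)) :
    ∃ s : A.map I ≅ B, ∀ n, G.map (s.hom.hom.f n) = a.hom.app (A.cx.X n) ≫ t.hom.f n := by
  -- Fullness of `G` gives the components one degree at a time; the dg-algebra axioms for them are
  -- inherited from `t`.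
  let u (n : ℤ) : I.obj (A.cx.X n) ⟶ B.cx.X n := G.preimage (a.hom.app (A.cx.X n) ≫ t.hom.f n)
  have hu (n : ℤ) : G.map (u n) = a.hom.app (A.cx.X n) ≫ t.hom.f n := G.map_preimage _
  have hiso (n : ℤ) : IsIso (u n) := by
    have : IsIso (G.map (u n)) := by
      rw [hu]
      exact IsIso.comp_isIso' inferInstance (ht n)
    exact isIso_of_fully_faithful G _
  let s : A.map I ⟶ B :=
    { hom :=
        { f := u
          comm' := fun i j h => lift_comm a (hu i) (hu j) (t.hom.comm i j) }
      one_hom := lift_one a (hu 0) t.one_hom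
      mul_hom := fun p q r h => lift_mul a (hu p) (hu q) (hu r) (t.mul_hom p q r h) }
  have (n : ℤ) : IsIso (s.hom.f n) := hiso n
  exact ⟨DGAlgebra.isoOfIsIso s, hu⟩

end

-- Symmetric algebras of complexes depend only on pullbacks

namespace ActedScheme

open SymComplex Opposite

variable {Y Z Z' : ActedScheme} {f : Hom Y Z} {f' : Hom Y Z'}

variable (f f') in
/-- The rings of functions on the images of an affine point agree. -/
noncomputable def pullO (p : Y.Pointᵒᵖ) :
    Z.O.obj (f.points.op.obj p) →+* Z'.O.obj (f'.points.op.obj p) :=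
  RingHom.id (Y.O.obj p)

/-- The map on sections induced by a morphism of pullbacks. -/
noncomputable def secPull {V : Z.PMod} {V' : Z'.PMod}
    (a : f.pullbackPMod.obj V ⟶ f'.pullbackPMod.obj V') (p : Y.Pointᵒᵖ) :
    sec V (f.points.op.obj p) →ₛₗ[pullO f f' p] sec V' (f'.points.op.obj p) where
  toFun := (secMap a p).hom
  map_add' := map_add (secMap a p).hom
  map_smul' := map_smul (secMap a p).hom

lemma secPull_resMap {V : Z.PMod} {V' : Z'.PMod}
    (a : f.pullbackPMod.obj V ⟶ f'.pullbackPMod.obj V') {p q : Y.Pointᵒᵖ} (g : p ⟶ q)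
    (v : sec V (f.points.op.obj p)) :
    secPull a q (resMap V (f.points.op.map g) v) =
      resMap V' (f'.points.op.map g) (secPull a p v) :=
  (resMap_secMap a g v).symm

/-- A morphism of pullbacks from semilinear maps on sections. -/
noncomputable def mkPull {V : Z.PMod} {V' : Z'.PMod}
    (F : ∀ p : Y.Pointᵒᵖ, sec V (f.points.op.obj p) →ₛₗ[pullO f f' p] sec V' (f'.points.op.obj p))
    (h : ∀ ⦃p q : Y.Pointᵒᵖ⦄ (g : p ⟶ q) (v : sec V (f.points.op.obj p)),
      F q (resMap V (f.points.op.map g) v) = resMap V' (f'.points.op.map g) (F p v)) :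
    f.pullbackPMod.obj V ⟶ f'.pullbackPMod.obj V' :=
  mkMap (fun p =>
    { toFun := F p
      map_add' := map_add (F p)
      map_smul' := (F p).map_smulₛₗ }) fun _ _ g v => h g v

lemma pullO_comp {p q : Y.Pointᵒᵖ} (g : p ⟶ q) :
    (pullO f f' q).comp (Z.O.map (f.points.op.map g)).hom =
      (Z'.O.map (f'.points.op.map g)).hom.comp (pullO f f' p) := rfl

/-- The morphism of pullbacks of symmetric algebras induced by morphisms of pullbacks. -/
noncomputable def symPull {V W : Z.PMod} {V' W' : Z'.PMod}
    (a : f.pullbackPMod.obj V ⟶ f'.pullbackPMod.obj V')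
    (b : f.pullbackPMod.obj W ⟶ f'.pullbackPMod.obj W') (n : ℤ) :
    f.pullbackPMod.obj (symPMod V W n) ⟶ f'.pullbackPMod.obj (symPMod V' W' n) :=
  mkPull (fun p => partMap (secPull a p) (secPull b p) n) fun p q g m => Subtype.ext (by
    have : RingHomCompTriple (Z.O.map (f.points.op.map g)).hom (pullO f f' q)
      ((pullO f f' q).comp (Z.O.map (f.points.op.map g)).hom) := ⟨rfl⟩
    have : RingHomCompTriple (pullO f f' p) (Z'.O.map (f'.points.op.map g)).hom
      ((pullO f f' q).comp (Z.O.map (f.points.op.map g)).hom) := ⟨(pullO_comp g).symm⟩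
    -- Both composites are the map of `Λ ⊗ Sym` induced by the same semilinear maps on generators,
    -- by naturality of `a` and `b`.
    have h (z : Total (Z.O.obj (f.points.op.obj p)) (sec V (f.points.op.obj p))
        (sec W (f.points.op.obj p))) :
        Total.map (secPull a q) (secPull b q) (Total.map (resMap V (f.points.op.map g))
          (resMap W (f.points.op.map g)) z) =
        Total.map (resMap V' (f'.points.op.map g)) (resMap W' (f'.points.op.map g))
          (Total.map (secPull a p) (secPull b p) z) :=
      (Total.map_comp (resMap V (f.points.op.map g)) (resMap W (f.points.op.map g)) (secPull a q)
        (secPull b q) ((secPull a q).comp (resMap V (f.points.op.map g)))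
        ((secPull b q).comp (resMap W (f.points.op.map g))) (fun _ => rfl) (fun _ => rfl) z).symm.trans
      (Total.map_comp (secPull a p) (secPull b p) (resMap V' (f'.points.op.map g))
        (resMap W' (f'.points.op.map g)) _ _ (secPull_resMap a g) (secPull_resMap b g) z)
    exact h m.1)

/-- On each affine point this is `map_diff`: semilinear maps that intertwine `φ` and `φ'` intertwine
the differentials they induce. -/
lemma symPull_symDiff {V W : Z.PMod} {V' W' : Z'.PMod}
    {a : f.pullbackPMod.obj V ⟶ f'.pullbackPMod.obj V'}
    {b : f.pullbackPMod.obj W ⟶ f'.pullbackPMod.obj W'} {φ : V ⟶ W} {φ' : V' ⟶ W'}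
    (h : a ≫ f'.pullbackPMod.map φ' = f.pullbackPMod.map φ ≫ b) (n m : ℤ) (hnm : n + 1 = m) :
    symPull a b n ≫ f'.pullbackPMod.map (symDiff φ' n m) =
      f.pullbackPMod.map (symDiff φ n m) ≫ symPull a b m := by
  refine pmod_hom_ext fun p => ?_
  ext z
  refine Subtype.ext ?_
  refine (diffPart_apply (secMap φ' (f'.points.op.obj p)).hom hnm
    (partMap (secPull a p) (secPull b p) n z)).trans ?_
  refine Eq.trans ?_ (congrArg (Total.map (secPull a p) (secPull b p))
    (diffPart_apply (secMap φ (f.points.op.obj p)).hom hnm z)).symm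
  refine (map_diff (secPull a p) (secPull b p) _ _ (fun v => ?_) _).symm
  exact (congrArg (fun k => (secMap k p).hom v) h).symm

end ActedScheme

namespace ActedScheme

open SymComplex Opposite

variable {Y Z Z' Z'' : ActedScheme} {f : Hom Y Z} {f' : Hom Y Z'} {f'' : Hom Y Z''}

/-- Functoriality in the pair `(a, b)`, used to see that isomorphisms of pullbacks of `V` and `W`
induce isomorphisms of the pulled back algebras. -/
lemma symPull_comp {V W : Z.PMod} {V' W' : Z'.PMod} {V'' W'' : Z''.PMod}
    (a : f.pullbackPMod.obj V ⟶ f'.pullbackPMod.obj V')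
    (b : f.pullbackPMod.obj W ⟶ f'.pullbackPMod.obj W')
    (a' : f'.pullbackPMod.obj V' ⟶ f''.pullbackPMod.obj V'')
    (b' : f'.pullbackPMod.obj W' ⟶ f''.pullbackPMod.obj W'') (n : ℤ) :
    symPull a b n ≫ symPull a' b' n = symPull (a ≫ a') (b ≫ b') n := by
  refine pmod_hom_ext fun p => ?_
  ext z
  refine Subtype.ext ?_
  have : RingHomCompTriple (pullO f f' p) (pullO f' f'' p) (pullO f f'' p) := ⟨rfl⟩
  exact (Total.map_comp (secPull a p) (secPull b p) (secPull a' p) (secPull b' p)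
    (secPull (a ≫ a') p) (secPull (b ≫ b') p) (fun _ => rfl) (fun _ => rfl) z.1).symm

lemma symPull_id (V W : Z.PMod) (n : ℤ) :
    symPull (𝟙 (f.pullbackPMod.obj V)) (𝟙 (f.pullbackPMod.obj W)) n = 𝟙 _ := by
  refine pmod_hom_ext fun p => ?_
  ext z
  exact Subtype.ext (Total.map_eq_self rfl (secPull (𝟙 (f.pullbackPMod.obj V)) p)
    (secPull (𝟙 (f.pullbackPMod.obj W)) p) (fun _ => rfl) (fun _ => rfl) z.1)

lemma symPull_comp_eq_id {V W : Z.PMod} {V' W' : Z'.PMod}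
    {a : f.pullbackPMod.obj V ⟶ f'.pullbackPMod.obj V'}
    {b : f.pullbackPMod.obj W ⟶ f'.pullbackPMod.obj W'}
    {a' : f'.pullbackPMod.obj V' ⟶ f.pullbackPMod.obj V}
    {b' : f'.pullbackPMod.obj W' ⟶ f.pullbackPMod.obj W} (ha : a ≫ a' = 𝟙 _) (hb : b ≫ b' = 𝟙 _)
    (n : ℤ) : symPull a b n ≫ symPull a' b' n = 𝟙 _ := by
  rw [symPull_comp, ha, hb, symPull_id]

variable {V W : Z.PMod} {V' W' : Z'.PMod} (a : f.pullbackPMod.obj V ⟶ f'.pullbackPMod.obj V')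
  (b : f.pullbackPMod.obj W ⟶ f'.pullbackPMod.obj W')

lemma symInl_symPull :
    f.pullbackPMod.map (symInl V W) ≫ symPull a b (-1) = a ≫ f'.pullbackPMod.map (symInl V' W') := by
  refine pmod_hom_ext fun p => ?_
  ext v
  exact Subtype.ext (Total.map_inl (secPull a p) (secPull b p) v)

lemma symInr_symPull :
    f.pullbackPMod.map (symInr V W) ≫ symPull a b 0 = b ≫ f'.pullbackPMod.map (symInr V' W') := by
  refine pmod_hom_ext fun p => ?_
  ext w
  exact Subtype.ext (Total.map_inr (secPull a p) (secPull b p) w)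

open Functor.LaxMonoidal in
lemma symOne_symPull :
    (ε f.pullbackPMod ≫ f.pullbackPMod.map (symOne V W)) ≫ symPull a b 0 =
      ε f'.pullbackPMod ≫ f'.pullbackPMod.map (symOne V' W') := by
  refine pmod_hom_ext fun p => ?_
  ext
  refine Subtype.ext ?_
  change Total.map (secPull a p) (secPull b p) ((1 : Z.O.obj (f.points.op.obj p)) • 1) =
    (1 : Z'.O.obj (f'.points.op.obj p)) • 1
  rw [one_smul, one_smul, Total.map_one]

open Functor.LaxMonoidal in
lemma symMul_symPull (p q r : ℤ) (h : p + q = r) :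
    (Functor.LaxMonoidal.μ f.pullbackPMod _ _ ≫ f.pullbackPMod.map (symMul V W p q r h)) ≫
      symPull a b r = (symPull a b p ⊗ₘ symPull a b q) ≫
        Functor.LaxMonoidal.μ f'.pullbackPMod _ _ ≫ f'.pullbackPMod.map (symMul V' W' p q r h) :=
  tensor_hom_ext fun t x y => Subtype.ext (Total.map_mul (secPull a t) (secPull b t) x.1 y.1)

/-- The morphism of dg-algebras, from the pullback of a symmetric algebra to the pullback of a
symmetric algebra, induced by a morphism of pullbacks of complexes. -/
noncomputable def symMap {V W : Z.QCoh} {V' W' : Z'.QCoh} {φ : V ⟶ W} {φ' : V' ⟶ W'}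
    (a : f.pullback.obj V ⟶ f'.pullback.obj V') (b : f.pullback.obj W ⟶ f'.pullback.obj W')
    (h : a ≫ f'.pullback.map φ' = f.pullback.map φ ≫ b) :
    (Sym φ).map f.pullback ⟶ (Sym φ').map f'.pullback where
  hom :=
    { f := fun n => ObjectProperty.homMk (symPull a.hom b.hom n)
      comm' := fun n m hnm => by
        ext1
        exact symPull_symDiff (congrArg (fun k => k.hom) h) n m hnm }
  one_hom := by
    ext1
    exact symOne_symPull a.hom b.hom
  mul_hom p q r h := by
    ext1
    exact symMul_symPull a.hom b.hom p q r h

lemma isIso_symMap {V W : Z.QCoh} {V' W' : Z'.QCoh} {φ : V ⟶ W} {φ' : V' ⟶ W'}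
    (a : f.pullback.obj V ≅ f'.pullback.obj V') (b : f.pullback.obj W ≅ f'.pullback.obj W')
    (h : a.hom ≫ f'.pullback.map φ' = f.pullback.map φ ≫ b.hom) (n : ℤ) :
    IsIso ((symMap a.hom b.hom h).hom.f n) := by
  refine ⟨ObjectProperty.homMk (symPull a.inv.hom b.inv.hom n), ?_, ?_⟩
  · ext1
    exact symPull_comp_eq_id (congrArg (fun k => k.hom) a.hom_inv_id)
      (congrArg (fun k => k.hom) b.hom_inv_id) n
  · ext1
    exact symPull_comp_eq_id (congrArg (fun k => k.hom) a.inv_hom_id)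
      (congrArg (fun k => k.hom) b.inv_hom_id) n

lemma inclV_symMap {V W : Z.QCoh} {V' W' : Z'.QCoh} {φ : V ⟶ W} {φ' : V' ⟶ W'}
    (a : f.pullback.obj V ⟶ f'.pullback.obj V') (b : f.pullback.obj W ⟶ f'.pullback.obj W')
    (h : a ≫ f'.pullback.map φ' = f.pullback.map φ ≫ b) :
    f.pullback.map (inclV φ) ≫ (symMap a b h).hom.f (-1) = a ≫ f'.pullback.map (inclV φ') := by
  ext1
  exact symInl_symPull a.hom b.hom

lemma inclW_symMap {V W : Z.QCoh} {V' W' : Z'.QCoh} {φ : V ⟶ W} {φ' : V' ⟶ W'}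
    (a : f.pullback.obj V ⟶ f'.pullback.obj V') (b : f.pullback.obj W ⟶ f'.pullback.obj W')
    (h : a ≫ f'.pullback.map φ' = f.pullback.map φ ≫ b) :
    f.pullback.map (inclW φ) ≫ (symMap a b h).hom.f 0 = b ≫ f'.pullback.map (inclW φ') := by
  ext1
  exact symInr_symPull a.hom b.hom

end ActedScheme

-- The comparison of dg-modules and the main theorem

namespace ActedScheme

variable {Y Z Z' : ActedScheme}

/-- After pullback along `f'`, the isomorphism `α` identifies the generators on both sides, hence
the symmetric algebras. Full faithfulness of this pullback lifts the identification. -/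
lemma exists_sym_iso {f : Hom Y Z} {f' : Hom Y Z'} {I : Z.QCoh ⥤ Z'.QCoh} [I.Monoidal] [I.Additive]
    [f'.pullback.IsEquivalence] (α : I ⋙ f'.pullback ≅ f.pullback) [NatTrans.IsMonoidal α.hom]
    {V W : Z.QCoh} (φ : V ⟶ W) :
    ∃ θ : (Sym φ).map I ≅ Sym (I.map φ), I.map (inclV φ) ≫ θ.hom.hom.f (-1) = inclV (I.map φ) ∧
      I.map (inclW φ) ≫ θ.hom.hom.f 0 = inclW (I.map φ) := by
  -- The inverse of `α` is used, so that in `θ` it cancels against the component of `α` coming from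
  -- `DGAlgebra.exists_iso_of_map`; this makes `θ` the identity on generators.
  let a : f.pullback.obj V ≅ f'.pullback.obj (I.obj V) := α.symm.app V
  let b : f.pullback.obj W ≅ f'.pullback.obj (I.obj W) := α.symm.app W
  have e : a.hom ≫ f'.pullback.map (I.map φ) = f.pullback.map φ ≫ b.hom :=
    (α.inv.naturality φ).symm
  obtain ⟨θ, hθ⟩ := DGAlgebra.exists_iso_of_map (F := f.pullback) (G := f'.pullback) α
    (A := Sym φ) (B := Sym (I.map φ)) (symMap a.hom b.hom e) (isIso_symMap a b e)
  refine ⟨θ, f'.pullback.map_injective ?_, f'.pullback.map_injective ?_⟩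
  · refine (f'.pullback.map_comp _ _).trans ?_
    refine (congrArg (f'.pullback.map (I.map (inclV φ)) ≫ ·) (hθ (-1))).trans ?_
    refine (NatTrans.naturality_assoc α.hom (inclV φ) _).trans ?_
    refine (congrArg (α.hom.app V ≫ ·) (inclV_symMap _ _ e)).trans ?_
    exact α.hom_inv_id_app_assoc V _
  · refine (f'.pullback.map_comp _ _).trans ?_
    refine (congrArg (f'.pullback.map (I.map (inclW φ)) ≫ ·) (hθ 0)).trans ?_
    refine (NatTrans.naturality_assoc α.hom (inclW φ) _).trans ?_
    refine (congrArg (α.hom.app W ≫ ·) (inclW_symMap _ _ e)).trans ?_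
    exact α.hom_inv_id_app_assoc W _

/-- Two acted schemes whose categories of quasi-coherent sheaves become equivalent after pullback to
a third one have equivalent categories of dg-modules over symmetric algebras. -/
lemma exists_isDGEquivalence (f : Hom Y Z) (f' : Hom Y Z') [f.pullback.IsEquivalence]
    [f'.pullback.IsEquivalence] :
    ∃ (I : Z.QCoh ⥤ Z'.QCoh) (_ : I.Braided) (_ : I.Additive) (_ : I.Linear ℂ)
      (α : I ⋙ f'.pullback ≅ f.pullback), I.IsEquivalence ∧ NatTrans.IsMonoidal α.hom ∧
      ∀ (V W : Z.QCoh) (φ : V ⟶ W), ∃ θ : (Sym φ).map I ≅ Sym (I.map φ),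
        I.map (inclV φ) ≫ θ.hom.hom.f (-1) = inclV (I.map φ) ∧
        I.map (inclW φ) ≫ θ.hom.hom.f 0 = inclW (I.map φ) ∧
        ((DGModule.map I ℂ (Sym φ)).comp (DGModule.restrictScalars ℂ θ.inv)).IsDGEquivalence := by
  obtain ⟨I, i1, i2, i3, α, h, hα⟩ := exists_braided_linear_equivalence ℂ f.pullback f'.pullback
  refine ⟨I, i1, i2, i3, α, h, hα, fun V W φ => ?_⟩
  obtain ⟨θ, h1, h2⟩ := exists_sym_iso α φ
  -- `I` itself lands in modules over the image of `Sym φ`; restriction along `θ⁻¹`, the forward map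
  -- of `θ.symm`, turns these into modules over `Sym (I.map φ)`.
  exact ⟨θ, h1, h2, (DGModule.isDGEquivalence_map I ℂ _).comp
    (DGModule.isDGEquivalence_restrictScalars ℂ θ.symm)⟩

end ActedScheme

theorem mainTheorem8
    (G H : Over SpecC) [GrpObj G] [GrpObj H]
    [IsAffine G.left] [LocallyOfFiniteType G.hom]
    (ρ : H ⟶ G) [IsMonHom ρ] [IsClosedImmersion ρ.left]
    (X : Over SpecC) [ModObj H X]
    (X' : Over SpecC) [ModObj G X']
    (π : G ⊗ X ⟶ X') (hπ : IsInducedSpace ρ π) :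
    (inductionPr ρ X).pullback.IsEquivalence ∧
    hπ.hom.pullback.IsEquivalence ∧
    ∃ (Ind : ActedScheme.QCoh ⟨H, X⟩ ⥤ ActedScheme.QCoh ⟨G, X'⟩) (_ : Ind.Braided)
      (_ : Ind.Additive) (_ : Ind.Linear ℂ)
      (α : Ind ⋙ hπ.hom.pullback ≅ (inductionPr ρ X).pullback),
      Ind.IsEquivalence ∧ NatTrans.IsMonoidal α.hom ∧
      ∀ (V W : ActedScheme.QCoh ⟨H, X⟩) (f : V ⟶ W),
        ∃ θ : (ActedScheme.Sym f).map Ind ≅ ActedScheme.Sym (Ind.map f),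
          Ind.map (ActedScheme.inclV f) ≫ θ.hom.hom.f (-1) = ActedScheme.inclV (Ind.map f) ∧
          Ind.map (ActedScheme.inclW f) ≫ θ.hom.hom.f 0 = ActedScheme.inclW (Ind.map f) ∧
          ((DGModule.map Ind ℂ (ActedScheme.Sym f)).comp
            (DGModule.restrictScalars ℂ θ.inv)).IsDGEquivalence := by
  have hA := isEquivalence_pullback_inductionPr ρ X
  have hB := hπ.isEquivalence_pullback
  -- The two equivalences share the target `QCoh` of `G × X` with its `G × H`-action, and so can be
  -- compared there.
  exact ⟨hA, hB, ActedScheme.exists_isDGEquivalence _ _⟩
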